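/- Let $\mathcal P(\mathbb R^d)$ be the set of everywhere positive, twice continuously differentiable probability densities on $\mathbb R^d$ with finite second moment. For $\rho,\pi\in\mathcal P(\mathbb R^d)$ let $\mathrm{KL}(\rho|\pi)=\int\rho\log\frac{\rho}{\pi}\,dx\in[0,\infty]$ and $I(\rho|\pi)=\int|\nabla\log\frac{\rho}{\pi}|^2\rho\,dx\in[0,\infty]$. We say that $\pi\in\mathcal P(\mathbb R^d)$ satisfies $\mathrm{LSI}(\lambda)$, $\lambda>0$, if $\mathrm{KL}(\mu|\pi)\le\frac1{2\lambda}I(\mu|\pi)$ for all $\mu\in\mathcal P(\mathbb R^d)$. Let $\mathcal H_k$ be a reproducing kernel Hilbert space of real functions on $\mathbb R^d$ with continuous kernel $k$. If $\int k(x,x)\rho(x)\,dx<\infty$, let $\iota_{k,\rho}:\mathcal H_k^d\to L_2^d(\rho)$ be the inclusion. Then $\iota_{k,\rho}\iota_{k,\rho}^*$ is compact, positive and self-adjoint on $L_2^d(\rho)$, and its powers are defined spectrally. For $\gamma\in(0,\frac12]$ let $\mathfrak I(\rho,\gamma)=(\iota_{k,\rho}\iota_{k,\rho}^*)^{-\gamma}\nabla\log\frac{\rho}{\pi}$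 be the pre-image of $\nabla\log\frac\rho\pi$ under $(\iota_{k,\rho}\iota_{k,\rho}^*)^{\gamma}$ (the one of smallest norm if it is not unique), with $\|\mathfrak I(\rho,\gamma)\|_{L_2^d(\rho)}=\infty$ if there is none. Let $\nu\in(0,1]$ and $\lambda>0$, and let $\pi\in\mathcal P(\mathbb R^d)$ satisfy $\mathrm{LSI}(\lambda)$. All curves $(\rho_t)_{t\ge0}$ of densities below lie in $\mathcal P(\mathbb R^d)$, are continuous in $(t,x)\in[0,\infty)\times\mathbb R^d$, and have a time derivative that is continuous in $(t,x)\in(0,\infty)\times\mathbb R^d$; the divergences are taken in the sense of distributions on $\mathbb R^d$, for every $t>0$. Let $(\rho_t)$ be a solution of the regularized Stein variational gradient flow $$\partial_t\rho_t=\nabla\cdot\Big(\rho_t\,\iota_{k,\rho_t}\big((1-\nu)\iota_{k,\rho_t}^*\iota_{k,\rho_t}+\nu I_d\big)^{-1}\iota_{k,\rho_t}^*\nabla\log\frac{\rho_t}{\pi}\Big),\qquad t>0,$$ where $I_d$ is the identity of $\mathcal H_k^d$, and $\int k(x,x)\rho_t(x)\,dx<\infty$ and $\nabla\log\frac{\rho_t}{\pi}\in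 L_2^d(\rho_t)$ for all $t>0$. Let $(\mu_t)$ be a solution of the Wasserstein gradient flow $$\partial_t\mu_t=\nabla\cdot\Big(\mu_t\nabla\log\frac{\mu_t}{\pi}\Big),\qquad t>0,$$ such that $\mu_t$ satisfies $\mathrm{LSI}(\lambda)$ for all $t>0$. For every $t>0$ let $\gamma_t\in(0,\frac12]$ be such that $\|\mathfrak I(\rho_t,\gamma_t)\|_{L_2^d(\rho_t)}<\infty$. Then, for every $T\in(0,\infty)$, $$\mathrm{KL}(\rho_T|\mu_T)\le e^{-3\lambda T/2}\,\mathrm{KL}(\rho_0|\mu_0)+\int_0^T(\lambda_{1,t}\vee1)^2\,\nu^{2\gamma_t}(1-\nu)^{-2\gamma_t}\,e^{-3\lambda(T-t)/2}\,\|\mathfrak I(\rho_t,\gamma_t)\|_{L_2^d(\rho_t)}^2\,dt,$$ where $\lambda_{1,t}$ is the largest eigenvalue of $\iota_{k,\rho_t}\iota_{k,\rho_t}^*$. The inequality is in $[0,\infty]$; for $\nu=1$ we read $0^{-2\gamma_t}=\infty$ and $\infty\cdot0=0$. If the integrand is not measurable in $t$, the integral is the lower integral. -/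

import Mathlib

open MeasureTheory Set Filter
open scoped ENNReal Topology

noncomputable section

/-! ### Probability densities, relative entropy, Fisher information, log-Sobolev inequality -/

/-- Twice continuously differentiable, everywhere positive probability densities on `ℝ^d`
with finite second moment. -/
structure IsDensity {d : ℕ} (ρ : EuclideanSpace ℝ (Fin d) → ℝ) : Prop where
  contDiff : ContDiff ℝ 2 ρ
  pos : ∀ x, 0 < ρ x
  integrable : Integrable ρ
  integral_eq_one : ∫ x, ρ x = 1
  secondMoment : Integrable fun x => ‖x‖ ^ 2 * ρ x

/-- The measure `ρ(x) dx`. -/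
def densMeasure {d : ℕ} (ρ : EuclideanSpace ℝ (Fin d) → ℝ) :
    Measure (EuclideanSpace ℝ (Fin d)) :=
  volume.withDensity fun x => ENNReal.ofReal (ρ x)

/-- The relative entropy `KL(ρ | π) ∈ [0, ∞]`. -/
def KL {d : ℕ} (ρ π : EuclideanSpace ℝ (Fin d) → ℝ) : ℝ≥0∞ :=
  InformationTheory.klDiv (densMeasure ρ) (densMeasure π)

/-- The relative score `∇ log (ρ / π)`. -/
def relScore {d : ℕ} (ρ π : EuclideanSpace ℝ (Fin d) → ℝ) (x : EuclideanSpace ℝ (Fin d)) :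
    EuclideanSpace ℝ (Fin d) :=
  gradient (fun y => Real.log (ρ y / π y)) x

/-- The relative Fisher information `I(ρ | π) = ∫ |∇ log (ρ / π)|² ρ dx ∈ [0, ∞]`. -/
def fisherInfo {d : ℕ} (ρ π : EuclideanSpace ℝ (Fin d) → ℝ) : ℝ≥0∞ :=
  ∫⁻ x, ‖relScore ρ π x‖ₑ ^ 2 ∂(densMeasure ρ)

/-- The log-Sobolev inequality with parameter `lam`. -/
def SatisfiesLSI {d : ℕ} (π : EuclideanSpace ℝ (Fin d) → ℝ) (lam : ℝ) : Prop :=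
  ∀ μ : EuclideanSpace ℝ (Fin d) → ℝ, IsDensity μ →
    KL μ π ≤ ENNReal.ofReal (1 / (2 * lam)) * fisherInfo μ π

/-! ### The inclusion of the reproducing kernel Hilbert space in `L²` -/

/-- The reproducing kernel `k(x, y)` of a Hilbert space `H` of real functions on `ℝ^d`. -/
def rkernel {d : ℕ} (H : Type*) [NormedAddCommGroup H] [InnerProductSpace ℝ H] [CompleteSpace H]
    [RKHS ℝ H (EuclideanSpace ℝ (Fin d)) ℝ] (x y : EuclideanSpace ℝ (Fin d)) : ℝ :=
  RKHS.kernel H x y 1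

/-- The kernel is continuous and `∫ k(x, x) dμ(x) < ∞`; under this condition the elements of the
reproducing kernel Hilbert space are square integrable. -/
def KernelAdmissible {d : ℕ} (H : Type*) [NormedAddCommGroup H] [InnerProductSpace ℝ H]
    [CompleteSpace H] [RKHS ℝ H (EuclideanSpace ℝ (Fin d)) ℝ]
    (μ : Measure (EuclideanSpace ℝ (Fin d))) : Prop :=
  (Continuous fun p : EuclideanSpace ℝ (Fin d) × EuclideanSpace ℝ (Fin d) =>
    rkernel H p.1 p.2) ∧ Integrable (fun x => rkernel H x x) μ

section RKHSInclusion

variable {d : ℕ} {H : Type*} [NormedAddCommGroup H] [InnerProductSpace ℝ H] [CompleteSpace H]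
  [RKHS ℝ H (EuclideanSpace ℝ (Fin d)) ℝ]

theorem rkernel_eq_inner (x y : EuclideanSpace ℝ (Fin d)) :
    rkernel H x y = inner ℝ (RKHS.kerFun H x (1 : ℝ)) (RKHS.kerFun H y (1 : ℝ)) := by
  rw [RKHS.kerFun_inner, RKHS.kerFun_apply, rkernel]
  simp

theorem rkhs_apply_eq_inner (f : H) (x : EuclideanSpace ℝ (Fin d)) :
    f x = inner ℝ (RKHS.kerFun H x (1 : ℝ)) f := by
  rw [RKHS.kerFun_inner]
  simp

theorem continuous_kerFun
    (hk : Continuous fun p : EuclideanSpace ℝ (Fin d) × EuclideanSpace ℝ (Fin d) =>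
      rkernel H p.1 p.2) :
    Continuous fun x : EuclideanSpace ℝ (Fin d) => RKHS.kerFun H x (1 : ℝ) := by
  have a1 : Continuous fun y : EuclideanSpace ℝ (Fin d) => rkernel H y y :=
    Continuous.comp (f := fun y : EuclideanSpace ℝ (Fin d) => (y, y)) hk (by fun_prop)
  refine continuous_iff_continuousAt.2 fun x => tendsto_iff_norm_sub_tendsto_zero.2 ?_
  have a2 : Continuous fun y : EuclideanSpace ℝ (Fin d) => rkernel H y x :=
    Continuous.comp (f := fun y : EuclideanSpace ℝ (Fin d) => (y, x)) hk (by fun_prop)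
  have h2 : ∀ y, ‖RKHS.kerFun H y (1 : ℝ) - RKHS.kerFun H x (1 : ℝ)‖
      = √(rkernel H y y - 2 * rkernel H y x + rkernel H x x) := by
    intro y
    rw [rkernel_eq_inner, rkernel_eq_inner, rkernel_eq_inner, real_inner_self_eq_norm_sq,
      real_inner_self_eq_norm_sq, ← norm_sub_sq_real]
    exact (Real.sqrt_sq (norm_nonneg _)).symm
  have h3 : Continuous fun y => √(rkernel H y y - 2 * rkernel H y x + rkernel H x x) :=
    Real.continuous_sqrt.comp ((a1.sub (continuous_const.mul a2)).add continuous_const)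
  have h4 := h3.tendsto x
  have h5 : rkernel H x x - 2 * rkernel H x x + rkernel H x x = 0 := by ring
  rw [h5, Real.sqrt_zero] at h4
  exact h4.congr fun y => (h2 y).symm

/-- The function `x ↦ (f₁(x), …, f_d(x))` of an element `f` of `H^d`. -/
def vecFun (f : PiLp 2 fun _ : Fin d => H) (x : EuclideanSpace ℝ (Fin d)) :
    EuclideanSpace ℝ (Fin d) :=
  WithLp.toLp 2 fun i => f i x

theorem norm_vecFun_sq_le (f : PiLp 2 fun _ : Fin d => H) (x : EuclideanSpace ℝ (Fin d)) :
    ‖vecFun f x‖ ^ 2 ≤ ‖f‖ ^ 2 * rkernel H x x := by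
  rw [EuclideanSpace.norm_sq_eq, PiLp.norm_sq_eq_of_L2, Finset.sum_mul]
  refine Finset.sum_le_sum fun i _ => ?_
  have h := norm_inner_le_norm (𝕜 := ℝ) (RKHS.kerFun H x (1 : ℝ)) (f i)
  rw [← rkhs_apply_eq_inner] at h
  have h' : rkernel H x x = ‖RKHS.kerFun H x (1 : ℝ)‖ ^ 2 := by
    rw [rkernel_eq_inner, real_inner_self_eq_norm_sq]
  rw [h', ← mul_pow, mul_comm ‖f i‖]
  exact pow_le_pow_left₀ (norm_nonneg _) h 2

theorem memLp_vecFun {μ : Measure (EuclideanSpace ℝ (Fin d))} (h : KernelAdmissible H μ)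
    (f : PiLp 2 fun _ : Fin d => H) : MemLp (vecFun f) 2 μ := by
  have hc : Continuous (vecFun f) := by
    refine (PiLp.continuous_toLp 2 _).comp (continuous_pi fun i => ?_)
    simp_rw [rkhs_apply_eq_inner]
    exact (continuous_kerFun h.1).inner continuous_const
  rw [memLp_two_iff_integrable_sq_norm hc.aestronglyMeasurable]
  refine (h.2.const_mul (‖f‖ ^ 2)).mono' (hc.norm.pow 2).aestronglyMeasurable
    (Eventually.of_forall fun x => ?_)
  rw [Real.norm_of_nonneg (by positivity)]
  exact norm_vecFun_sq_le f x

theorem norm_toLp_vecFun_le {μ : Measure (EuclideanSpace ℝ (Fin d))} (h : KernelAdmissible H μ)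
    (f : PiLp 2 fun _ : Fin d => H) :
    ‖(memLp_vecFun h f).toLp (vecFun f)‖ ≤ √(∫ x, rkernel H x x ∂μ) * ‖f‖ := by
  have h1 : ‖(memLp_vecFun h f).toLp (vecFun f)‖ ^ 2 ≤ (∫ x, rkernel H x x ∂μ) * ‖f‖ ^ 2 := by
    rw [← real_inner_self_eq_norm_sq, L2.inner_def, mul_comm, ← integral_const_mul]
    have h2 : (fun x => inner ℝ ((memLp_vecFun h f).toLp (vecFun f) x)
        ((memLp_vecFun h f).toLp (vecFun f) x)) =ᵐ[μ] fun x => ‖vecFun f x‖ ^ 2 := by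
      filter_upwards [(memLp_vecFun h f).coeFn_toLp] with x hx
      rw [hx, real_inner_self_eq_norm_sq]
    rw [integral_congr_ae h2]
    refine integral_mono_of_nonneg (Eventually.of_forall fun x => by positivity)
      (h.2.const_mul _) (Eventually.of_forall fun x => norm_vecFun_sq_le f x)
  calc _ = √(‖(memLp_vecFun h f).toLp (vecFun f)‖ ^ 2) := (Real.sqrt_sq (norm_nonneg _)).symm
    _ ≤ √((∫ x, rkernel H x x ∂μ) * ‖f‖ ^ 2) := Real.sqrt_le_sqrt h1
    _ = _ := by rw [Real.sqrt_mul' _ (by positivity), Real.sqrt_sq (norm_nonneg _)]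

variable (H) in
open Classical in
/-- The inclusion `ι_{k,μ} : H^d → L²(μ; ℝ^d)`, `f ↦ f`. It is meant for kernels and measures
satisfying `KernelAdmissible`, and set to `0` otherwise. -/
def inclusionCLM (μ : Measure (EuclideanSpace ℝ (Fin d))) :
    (PiLp 2 fun _ : Fin d => H) →L[ℝ] Lp (EuclideanSpace ℝ (Fin d)) 2 μ :=
  if h : KernelAdmissible H μ then
    LinearMap.mkContinuous
      { toFun := fun f => (memLp_vecFun h f).toLp (vecFun f)
        map_add' := fun f g => by
          rw [← MemLp.toLp_add]
          congr 1
          ext x i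
          simp [vecFun]
        map_smul' := fun c f => by
          rw [RingHom.id_apply, ← MemLp.toLp_const_smul]
          congr 1
          ext x i
          simp [vecFun] }
      (√(∫ x, rkernel H x x ∂μ)) (norm_toLp_vecFun_le h)
  else 0

variable (H) in
/-- The integral operator `ι_{k,μ} ι_{k,μ}^*` on `L²(μ; ℝ^d)`. -/
def kernelOp (μ : Measure (EuclideanSpace ℝ (Fin d))) :
    Lp (EuclideanSpace ℝ (Fin d)) 2 μ →L[ℝ] Lp (EuclideanSpace ℝ (Fin d)) 2 μ :=
  inclusionCLM H μ ∘L (inclusionCLM H μ).adjoint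

variable (H) in
/-- The regularized operator `ι ((1 - ν) ι^* ι + ν I)⁻¹ ι^*` on `L²(μ; ℝ^d)`, `ι = ι_{k,μ}`. -/
def regularizedOp (ν : ℝ) (μ : Measure (EuclideanSpace ℝ (Fin d))) :
    Lp (EuclideanSpace ℝ (Fin d)) 2 μ →L[ℝ] Lp (EuclideanSpace ℝ (Fin d)) 2 μ :=
  inclusionCLM H μ ∘L
    (((1 - ν) • ((inclusionCLM H μ).adjoint ∘L inclusionCLM H μ)
      + ν • ContinuousLinearMap.id ℝ (PiLp 2 fun _ : Fin d => H)).inverse ∘L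
      (inclusionCLM H μ).adjoint)

end RKHSInclusion

/-! ### Spectral calculus of positive compact operators -/

instance completeSpace_eigenspace {F : Type*} [NormedAddCommGroup F] [InnerProductSpace ℝ F]
    [CompleteSpace F] (T : F →L[ℝ] F) (r : ℝ) :
    CompleteSpace (Module.End.eigenspace (T : Module.End ℝ F) r) := by
  have h : Module.End.eigenspace (T : Module.End ℝ F) r
      = LinearMap.ker (T - r • ContinuousLinearMap.id ℝ F).toLinearMap := by
    ext v
    simp [sub_eq_zero]
  rw [h]
  exact ContinuousLinearMap.completeSpace_ker _

/-- The largest eigenvalue of an operator. -/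
def largestEigenvalue {F : Type*} [NormedAddCommGroup F] [InnerProductSpace ℝ F]
    (T : F →L[ℝ] F) : ℝ :=
  sSup {r : ℝ | Module.End.HasEigenvalue (T : Module.End ℝ F) r}

/-- The fractional power `T^a f = ∑_r r^a P_r f` of a positive compact self-adjoint operator,
where `r` runs through the eigenvalues of `T` and `P_r` is the orthogonal projection onto the
eigenspace of `r`. -/
def fracPow {F : Type*} [NormedAddCommGroup F] [InnerProductSpace ℝ F] [CompleteSpace F]
    (T : F →L[ℝ] F) (a : ℝ) (f : F) : F :=
  ∑' r : {r : ℝ // Module.End.HasEigenvalue (T : Module.End ℝ F) r},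
    ((r : ℝ) ^ a) • (Module.End.eigenspace (T : Module.End ℝ F) (r : ℝ)).starProjection f

/-- The norm in `L²(ρ; ℝ^d)` of the pre-image of `∇ log (ρ / π)` under `(ι ι^*)^γ`, `ι = ι_{k,ρ}`:
the smallest norm of a pre-image, and `∞` if `∇ log (ρ / π)` is not in the range of `(ι ι^*)^γ`. -/
def preimageNorm {d : ℕ} (H : Type*) [NormedAddCommGroup H] [InnerProductSpace ℝ H]
    [CompleteSpace H] [RKHS ℝ H (EuclideanSpace ℝ (Fin d)) ℝ]
    (ρ π : EuclideanSpace ℝ (Fin d) → ℝ) (γ : ℝ) : ℝ≥0∞ :=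
  ⨅ h : {h : Lp (EuclideanSpace ℝ (Fin d)) 2 (densMeasure ρ) //
      ⇑(fracPow (kernelOp H (densMeasure ρ)) γ h) =ᵐ[densMeasure ρ] relScore ρ π}, ‖h.1‖ₑ

/-! ### The flows -/

/-- `∇ · F = g` on `ℝ^d`, in the sense of distributions. -/
def HasWeakDivergence {d : ℕ} (F : EuclideanSpace ℝ (Fin d) → EuclideanSpace ℝ (Fin d))
    (g : EuclideanSpace ℝ (Fin d) → ℝ) : Prop :=
  ∀ η : EuclideanSpace ℝ (Fin d) → ℝ, ContDiff ℝ (⊤ : ℕ∞) η → HasCompactSupport η →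
    ∫ x, η x * g x = - ∫ x, inner ℝ (gradient η x) (F x)

/-- A curve `(ρ_t)_{t ≥ 0}` of densities which is continuous on `[0, ∞) × ℝ^d` and has a
continuous time derivative on `(0, ∞) × ℝ^d`. -/
structure IsDensityCurve {d : ℕ} (ρ : ℝ → EuclideanSpace ℝ (Fin d) → ℝ) : Prop where
  isDensity : ∀ t, 0 ≤ t → IsDensity (ρ t)
  continuousOn : ContinuousOn (fun p : ℝ × EuclideanSpace ℝ (Fin d) => ρ p.1 p.2)
    (Ici 0 ×ˢ univ)
  differentiableAt : ∀ t, 0 < t → ∀ x, DifferentiableAt ℝ (fun s => ρ s x) t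
  continuousOn_deriv : ContinuousOn
    (fun p : ℝ × EuclideanSpace ℝ (Fin d) => deriv (fun s => ρ s p.2) p.1) (Ioi 0 ×ˢ univ)

/-- Solutions of the Wasserstein gradient flow `∂_t μ_t = ∇ · (μ_t ∇ log (μ_t / π))`. -/
structure IsWGF {d : ℕ} (π : EuclideanSpace ℝ (Fin d) → ℝ)
    (μ : ℝ → EuclideanSpace ℝ (Fin d) → ℝ) : Prop where
  curve : IsDensityCurve μ
  pde : ∀ t, 0 < t → HasWeakDivergence (fun x => μ t x • relScore (μ t) π x)
    (fun x => deriv (fun s => μ s x) t)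

/-- Solutions of the regularized Stein variational gradient flow
`∂_t ρ_t = ∇ · (ρ_t ι ((1 - ν) ι^* ι + ν I)⁻¹ ι^* ∇ log (ρ_t / π))`, `ι = ι_{k,ρ_t}`. For the right
hand side to be defined, `∫ k(x, x) ρ_t(x) dx` is finite and `∇ log (ρ_t / π)` is (the class of) an
element `v` of `L²(ρ_t; ℝ^d)`. -/
structure IsRSVGF {d : ℕ} (H : Type*) [NormedAddCommGroup H] [InnerProductSpace ℝ H]
    [CompleteSpace H] [RKHS ℝ H (EuclideanSpace ℝ (Fin d)) ℝ] (ν : ℝ)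
    (π : EuclideanSpace ℝ (Fin d) → ℝ) (ρ : ℝ → EuclideanSpace ℝ (Fin d) → ℝ) : Prop where
  curve : IsDensityCurve ρ
  kernel_integrable : ∀ t, 0 < t → Integrable (fun x => rkernel H x x) (densMeasure (ρ t))
  pde : ∀ t, 0 < t → ∃ v : Lp (EuclideanSpace ℝ (Fin d)) 2 (densMeasure (ρ t)),
    ⇑v =ᵐ[densMeasure (ρ t)] relScore (ρ t) π ∧
    HasWeakDivergence (fun x => ρ t x • regularizedOp H ν (densMeasure (ρ t)) v x)
      (fun x => deriv (fun s => ρ s x) t)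

end

/-!
The regularized Stein variational gradient flow `ρ_t` solves the Wasserstein gradient flow towards
`π`, perturbed by the forcing field `u_t = ∇ log (ρ_t / π) - D_ν ∇ log (ρ_t / π)`, where `D_ν` is
`regularizedOp`. The theorem follows from three facts.

* The forcing is small in `L²(ρ_t)` (`enorm_sub_regularizedOp_sq_le`). On an eigenvector of `ι ι^*`
  with eigenvalue `r`, the operator `1 - D_ν` multiplies by `ν (1 - r) / ((1 - ν) r + ν)`. After
  multiplication by `r ^ γ` this is at most `max λ₁ 1 * ν ^ γ * (1 - ν) ^ (-γ)` by the weighted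
  inequality between the arithmetic and the geometric mean.
* Entropy is dissipated (`IsForcedFlowPair.entropy_dissipation`): for `0 ≤ s < t`,
  `KL (ρ_t | μ_t) + (3/4) ∫_s^t I (ρ_τ | μ_τ) dτ ≤ KL (ρ_s | μ_s) + ∫_s^t ‖u_τ‖² dτ`.
  Formally the time derivative of `KL (ρ_t | μ_t)` is `-I (ρ_t | μ_t)` plus the pairing of
  `∇ log (ρ_t / μ_t)` with `u_t`, which Young's inequality splits as `I / 4 + ‖u_t‖²`.
* Since `μ_t` satisfies a log-Sobolev inequality, `(3/4) I ≥ (3 λ / 2) KL`, and Gronwall's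
  inequality (`ENNReal.gronwall`) concludes.

The formal computation has to be justified without decay of the densities or of their time
derivatives at infinity. The entropy density `r log (r / m)` is replaced by
`r log (r / (m + ε r))`. It is homogeneous of degree one in the densities, so that it may be
evaluated at the densities `μ_t / π` and `ρ_t / π` relative to `π`, and up to a multiple of `m + r`
it is the negative of a concave function `Q`, `entGap`, that is comparable with `m + r`. The
space integral is localized by a cutoff `θ(w)`, where `w ≥ 0` equals `1` near infinity. Both flows
have the drift-diffusion generator `Δ_π` associated with the Dirichlet form of `π`, so the
localization costs the term `∫ ⟨∇ w, ∇ (-θ'(w) Q)⟩ dπ` together with terms in `|∇ w|²` that the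
convexity of `θ` controls. If `w` is a supersolution, `w - Δ_π w ≥ 0`, this term is at least
`-∫ w (-θ'(w)) Q dπ`. For the logarithmic profile `cutoff K`, both `v |θ'(v)|` and the ratio of
`θ'(v)²` to `θ''(v)` are of order `1 / log K`, so that the errors vanish as `K → ∞`.

Supersolutions are produced variationally: a minimizing sequence of the norm of `H¹(π)` among the
functions `w ≥ 0` of class `C¹` with `w = 1` off a ball consists of approximate supersolutions
(`exists_isSupersolutionLimit`). As `π` is a finite measure, the minimal norm tends to `0` when the
radius of the ball tends to infinity (`exists_seq_isSupersolutionLimit`), so the cutoffs tend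
to `1`. The cutoff is removed first, then `K → ∞`, then `ε → 0`, each time with Fatou's lemma on the
side of the dissipation.
-/

/-! ### The spectral estimate for the regularization error -/

section Spectral

variable {F G : Type*} [NormedAddCommGroup F] [InnerProductSpace ℝ F] [CompleteSpace F]
  [NormedAddCommGroup G] [InnerProductSpace ℝ G] [CompleteSpace G]

/-- The regularized operator is coercive. Without invertibility, `ContinuousLinearMap.inverse` would
be the junk value `0`. -/
theorem isInvertible_regularization {ν : ℝ} (hν : ν ∈ Set.Ioc (0 : ℝ) 1) (J : G →L[ℝ] F) :
    ((1 - ν) • (J.adjoint ∘L J) + ν • ContinuousLinearMap.id ℝ G).IsInvertible := by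
  set M := (1 - ν) • (J.adjoint ∘L J) + ν • ContinuousLinearMap.id ℝ G with hM
  have hc : IsCoercive ((innerSL ℝ : G →L[ℝ] G →L[ℝ] ℝ) ∘L M) := by
    refine ⟨ν, hν.1, fun u => ?_⟩
    have h1 : ((innerSL ℝ : G →L[ℝ] G →L[ℝ] ℝ) ∘L M) u u
        = (1 - ν) * (‖J u‖ * ‖J u‖) + ν * (‖u‖ * ‖u‖) := by
      have h0 : ((innerSL ℝ : G →L[ℝ] G →L[ℝ] ℝ) ∘L M) u u = inner ℝ (M u) u := rfl
      have h1 : M u = (1 - ν) • J.adjoint (J u) + ν • u := rfl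
      rw [h0, h1, inner_add_left, real_inner_smul_left, real_inner_smul_left,
        ContinuousLinearMap.adjoint_inner_left, real_inner_self_eq_norm_mul_norm,
        real_inner_self_eq_norm_mul_norm]
    rw [h1]
    have h2 : 0 ≤ (1 - ν) * (‖J u‖ * ‖J u‖) :=
      mul_nonneg (by linarith [hν.2]) (by positivity)
    linarith
  refine ⟨hc.continuousLinearEquivOfBilin, ?_⟩
  ext v
  refine ext_inner_right ℝ fun w => ?_
  exact hc.continuousLinearEquivOfBilin_apply v w

/-- On an eigenvector of `J J^*` with eigenvalue `r`, the regularized operator acts as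
multiplication by `r / ((1 - ν) r + ν)`. -/
theorem regularization_apply_eigenvector {ν : ℝ} (hν : ν ∈ Set.Ioc (0 : ℝ) 1) (J : G →L[ℝ] F)
    {r : ℝ} (hr : 0 ≤ r) {x : F} (hx : J (J.adjoint x) = r • x) :
    (J ∘L (((1 - ν) • (J.adjoint ∘L J) + ν • ContinuousLinearMap.id ℝ G).inverse ∘L J.adjoint)) x
      = (r / ((1 - ν) * r + ν)) • x := by
  have hpos : 0 < (1 - ν) * r + ν :=
    add_pos_of_nonneg_of_pos (mul_nonneg (by linarith [hν.2]) hr) hν.1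
  have hi := isInvertible_regularization hν J
  set M := (1 - ν) • (J.adjoint ∘L J) + ν • ContinuousLinearMap.id ℝ G with hM
  have h1 : M (J.adjoint x) = ((1 - ν) * r + ν) • J.adjoint x := by
    have h0 : M (J.adjoint x) = (1 - ν) • J.adjoint (J (J.adjoint x)) + ν • J.adjoint x := rfl
    rw [h0, hx, map_smul, smul_smul, add_smul]
  have h2 : M.inverse (J.adjoint x) = ((1 - ν) * r + ν)⁻¹ • J.adjoint x := by
    have h3 : J.adjoint x = M (((1 - ν) * r + ν)⁻¹ • J.adjoint x) := by
      rw [map_smul, h1, smul_smul, inv_mul_cancel₀ hpos.ne', one_smul]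
    conv_lhs => rw [h3]
    exact hi.inverse_apply_self _
  simp only [ContinuousLinearMap.comp_apply, h2, map_smul, hx, smul_smul]
  congr 1
  field_simp

/-- The eigenvalues of `J J^*` are bounded by its norm, so that the supremum in `largestEigenvalue`
is an upper bound for them. -/
theorem eigenvalue_nonneg_of_comp_adjoint (J : G →L[ℝ] F) {r : ℝ}
    (hr : Module.End.HasEigenvalue ((J ∘L J.adjoint : F →L[ℝ] F) : Module.End ℝ F) r) :
    0 ≤ r ∧ r ≤ largestEigenvalue (J ∘L J.adjoint) := by
  have key : ∀ s : ℝ,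
      Module.End.HasEigenvalue ((J ∘L J.adjoint : F →L[ℝ] F) : Module.End ℝ F) s →
      0 ≤ s ∧ s ≤ ‖J ∘L J.adjoint‖ := by
    intro s hs
    obtain ⟨x, hx⟩ := hs.exists_hasEigenvector
    have hx0 : 0 < ‖x‖ := norm_pos_iff.2 hx.2
    have h1 : (J ∘L J.adjoint) x = s • x := hx.apply_eq_smul
    constructor
    · have h2 : inner ℝ ((J ∘L J.adjoint) x) x = ‖J.adjoint x‖ * ‖J.adjoint x‖ := by
        rw [ContinuousLinearMap.comp_apply, ← ContinuousLinearMap.adjoint_inner_right,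
          real_inner_self_eq_norm_mul_norm]
      rw [h1, real_inner_smul_left, real_inner_self_eq_norm_mul_norm] at h2
      by_contra! h3
      have := mul_neg_of_neg_of_pos h3 (mul_pos hx0 hx0)
      nlinarith [mul_self_nonneg ‖J.adjoint x‖]
    · have h2 := (J ∘L J.adjoint).le_opNorm x
      rw [h1, norm_smul] at h2
      exact (le_abs_self s).trans (le_of_mul_le_mul_right h2 hx0)
  exact ⟨(key r hr).1, le_csSup ⟨_, fun s hs => (key s hs).2⟩ hr⟩

/-- The scalar form of the regularization error: by the weighted inequality between the arithmetic
and geometric means, `(1 - ν) r + ν ≥ ((1 - ν) r) ^ γ * ν ^ (1 - γ)`. -/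
theorem regularization_multiplier_le {ν γ r L : ℝ} (hν : 0 < ν) (hν1 : ν < 1) (hγ : 0 < γ)
    (hγ1 : γ ≤ 1) (hr : 0 ≤ r) (hrL : r ≤ L) :
    |(1 - r / ((1 - ν) * r + ν)) * r ^ γ| ≤ max L 1 * (ν ^ γ * (1 - ν) ^ (-γ)) := by
  have h1ν : 0 < 1 - ν := by linarith
  have hpos : 0 < (1 - ν) * r + ν := by positivity
  have e1 : (1 - r / ((1 - ν) * r + ν)) * r ^ γ
      = (1 - r) * (ν * r ^ γ / ((1 - ν) * r + ν)) := by
    field_simp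
    ring
  have h2 : |1 - r| ≤ max L 1 := by
    rw [abs_le]
    constructor
    · linarith [le_max_left L 1, le_max_right L 1]
    · linarith [le_max_right L 1]
  have h3 : ν * r ^ γ / ((1 - ν) * r + ν) ≤ ν ^ γ * (1 - ν) ^ (-γ) := by
    rw [div_le_iff₀ hpos]
    have h4 := Real.geom_mean_le_arith_mean2_weighted hγ.le (by linarith : 0 ≤ 1 - γ)
      (by positivity : 0 ≤ (1 - ν) * r) hν.le (by ring)
    have h5 : γ * ((1 - ν) * r) + (1 - γ) * ν ≤ (1 - ν) * r + ν := by
      have : 0 ≤ (1 - ν) * r := by positivity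
      nlinarith
    have h6 : ν ^ γ * (1 - ν) ^ (-γ) * (((1 - ν) * r) ^ γ * ν ^ (1 - γ)) = ν * r ^ γ := by
      rw [Real.mul_rpow h1ν.le hr, Real.rpow_neg h1ν.le]
      have h7 : ν ^ γ * ν ^ (1 - γ) = ν := by
        rw [← Real.rpow_add hν]; simp
      have h8 : (1 - ν) ^ γ ≠ 0 := (Real.rpow_pos_of_pos h1ν γ).ne'
      calc _ = (ν ^ γ * ν ^ (1 - γ)) * (((1 - ν) ^ γ)⁻¹ * (1 - ν) ^ γ) * r ^ γ := by ring
        _ = _ := by rw [h7, inv_mul_cancel₀ h8]; ring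
    rw [← h6]
    exact mul_le_mul_of_nonneg_left (h4.trans h5) (by positivity)
  rw [e1, abs_mul, abs_of_nonneg (by positivity : 0 ≤ ν * r ^ γ / ((1 - ν) * r + ν))]
  exact mul_le_mul h2 h3 (by positivity) (le_max_of_le_right zero_le_one)

/-- Bessel's inequality for combinations of the spectral components of `h`. -/
theorem norm_sum_smul_eigenspace_proj_le (T : F →L[ℝ] F)
    (hT : (T : Module.End ℝ F).IsSymmetric) (h : F)
    (s : Finset {r : ℝ // Module.End.HasEigenvalue (T : Module.End ℝ F) r})
    (c : {r : ℝ // Module.End.HasEigenvalue (T : Module.End ℝ F) r} → ℝ) {K : ℝ} (hK : 0 ≤ K)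
    (hc : ∀ r, |c r| ≤ K) :
    ‖∑ r ∈ s, c r • (Module.End.eigenspace (T : Module.End ℝ F) (r : ℝ)).starProjection h‖
      ≤ K * ‖h‖ := by
  have hO := hT.orthogonalFamily_eigenspaces.comp
    (f := fun r : {r : ℝ // Module.End.HasEigenvalue (T : Module.End ℝ F) r} => (r : ℝ))
    Subtype.coe_injective
  set P := fun r : {r : ℝ // Module.End.HasEigenvalue (T : Module.End ℝ F) r} =>
    (Module.End.eigenspace (T : Module.End ℝ F) (r : ℝ)).orthogonalProjectionOnto h with hP
  have key : ∀ d : {r : ℝ // Module.End.HasEigenvalue (T : Module.End ℝ F) r} → ℝ,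
      ‖∑ r ∈ s, d r • (Module.End.eigenspace (T : Module.End ℝ F) (r : ℝ)).starProjection h‖ ^ 2
        = ∑ r ∈ s, d r ^ 2 * ‖P r‖ ^ 2 := by
    intro d
    have := hO.norm_sum (fun r => d r • P r) s
    simp only [norm_smul, mul_pow, Real.norm_eq_abs, sq_abs] at this
    rw [← this]
    rfl
  have hb : ∑ r ∈ s, ‖P r‖ ^ 2 ≤ ‖h‖ ^ 2 := by
    have h1 := key fun _ => 1
    simp only [one_smul, one_pow, one_mul] at h1
    set g := ∑ r ∈ s, (Module.End.eigenspace (T : Module.End ℝ F) (r : ℝ)).starProjection h with hg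
    have h2 : inner ℝ g h = ∑ r ∈ s, ‖P r‖ ^ 2 := by
      rw [hg, sum_inner]
      refine Finset.sum_congr rfl fun r _ => ?_
      have := (Module.End.eigenspace (T : Module.End ℝ F) (r : ℝ)).inner_starProjection_left_eq_right
        ((Module.End.eigenspace (T : Module.End ℝ F) (r : ℝ)).starProjection h) h
      have hs : (Module.End.eigenspace (T : Module.End ℝ F) (r : ℝ)).starProjection
          ((Module.End.eigenspace (T : Module.End ℝ F) (r : ℝ)).starProjection h)
          = (Module.End.eigenspace (T : Module.End ℝ F) (r : ℝ)).starProjection h :=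
        Submodule.starProjection_eq_self_iff.2 (Subtype.coe_prop (P r))
      rw [hs] at this
      rw [this, real_inner_self_eq_norm_sq]
      rfl
    rw [← h1] at h2 ⊢
    have h3 : ‖g‖ * ‖g‖ ≤ ‖g‖ * ‖h‖ := by
      rw [← sq, ← h2]
      exact real_inner_le_norm _ _
    rcases (norm_nonneg g).eq_or_lt with h4 | h4
    · rw [← h4]; simp
    · exact pow_le_pow_left₀ h4.le (le_of_mul_le_mul_left h3 h4) 2
  refine (sq_le_sq₀ (norm_nonneg _) (by positivity)).1 ?_
  rw [key, mul_pow]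
  refine le_trans ?_ (mul_le_mul_of_nonneg_left hb (sq_nonneg K))
  rw [Finset.mul_sum]
  refine Finset.sum_le_sum fun r _ => mul_le_mul_of_nonneg_right ?_ (by positivity)
  rw [← sq_abs]
  exact pow_le_pow_left₀ (abs_nonneg _) (hc r) 2

theorem isSymmetric_comp_adjoint (J : G →L[ℝ] F) :
    ((J ∘L J.adjoint : F →L[ℝ] F) : Module.End ℝ F).IsSymmetric := by
  intro x y
  change inner ℝ (J (J.adjoint x)) y = inner ℝ x (J (J.adjoint y))
  rw [← ContinuousLinearMap.adjoint_inner_right, ContinuousLinearMap.adjoint_inner_left]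

/-- An operator `S` acting by the scalars `c r` on the eigenspaces of `T` is bounded by the supremum
of `c r * r ^ a` after `T ^ a`. If the spectral series of `T ^ a h` does not converge, the junk value `0` of the sum makes the
estimate trivial, so that compactness of `T` is not needed. -/
theorem norm_apply_fracPow_le (T S : F →L[ℝ] F) (hT : (T : Module.End ℝ F).IsSymmetric) {a : ℝ}
    (c : {r : ℝ // Module.End.HasEigenvalue (T : Module.End ℝ F) r} → ℝ)
    (hS : ∀ (r : {r : ℝ // Module.End.HasEigenvalue (T : Module.End ℝ F) r}) (x : F),
      T x = (r : ℝ) • x → S x = c r • x) {K : ℝ} (hK : 0 ≤ K)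
    (hc : ∀ r, |c r * (r : ℝ) ^ a| ≤ K) (h : F) :
    ‖S (fracPow T a h)‖ ≤ K * ‖h‖ := by
  by_cases hs : Summable fun r : {r : ℝ // Module.End.HasEigenvalue (T : Module.End ℝ F) r} =>
    ((r : ℝ) ^ a) • (Module.End.eigenspace (T : Module.End ℝ F) (r : ℝ)).starProjection h
  · have h1 := (hs.hasSum.mapL S).norm
    have h2 : ∀ r : {r : ℝ // Module.End.HasEigenvalue (T : Module.End ℝ F) r},
        S (((r : ℝ) ^ a) • (Module.End.eigenspace (T : Module.End ℝ F) (r : ℝ)).starProjection h)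
          = (c r * (r : ℝ) ^ a) •
            (Module.End.eigenspace (T : Module.End ℝ F) (r : ℝ)).starProjection h := by
      intro r
      rw [map_smul, hS r _ (Module.End.mem_eigenspace_iff.1
        ((Module.End.eigenspace (T : Module.End ℝ F) (r : ℝ)).starProjection_apply_mem h)),
        smul_smul, mul_comm]
    simp_rw [h2] at h1
    exact le_of_tendsto h1 (Eventually.of_forall fun s =>
      norm_sum_smul_eigenspace_proj_le T hT h s _ hK hc)
  · rw [fracPow, tsum_eq_zero_of_not_summable hs, map_zero, norm_zero]
    positivity

theorem norm_fracPow_le (J : G →L[ℝ] F) {γ : ℝ} (hγ : 0 ≤ γ) (h : F) :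
    ‖fracPow (J ∘L J.adjoint) γ h‖ ≤ (max (largestEigenvalue (J ∘L J.adjoint)) 1) ^ γ * ‖h‖ := by
  refine norm_apply_fracPow_le (J ∘L J.adjoint) (ContinuousLinearMap.id ℝ F)
    (isSymmetric_comp_adjoint J) (fun _ => 1) (fun r x _ => by simp)
    (by positivity) (fun r => ?_) h
  have hr := eigenvalue_nonneg_of_comp_adjoint J r.2
  rw [one_mul, abs_of_nonneg (Real.rpow_nonneg hr.1 _)]
  exact Real.rpow_le_rpow hr.1 (hr.2.trans (le_max_left _ _)) hγ

theorem norm_sub_regularization_fracPow_le {ν : ℝ} (hν : 0 < ν) (hν1 : ν < 1) (J : G →L[ℝ] F)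
    {γ : ℝ} (hγ : 0 < γ) (hγ1 : γ ≤ 1) (h : F) :
    ‖fracPow (J ∘L J.adjoint) γ h -
      (J ∘L (((1 - ν) • (J.adjoint ∘L J) + ν • ContinuousLinearMap.id ℝ G).inverse ∘L J.adjoint))
        (fracPow (J ∘L J.adjoint) γ h)‖
      ≤ max (largestEigenvalue (J ∘L J.adjoint)) 1 * (ν ^ γ * (1 - ν) ^ (-γ)) * ‖h‖ := by
  have h1ν : 0 < 1 - ν := by linarith
  refine norm_apply_fracPow_le (J ∘L J.adjoint) (ContinuousLinearMap.id ℝ F -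
    J ∘L (((1 - ν) • (J.adjoint ∘L J) + ν • ContinuousLinearMap.id ℝ G).inverse ∘L J.adjoint))
    (isSymmetric_comp_adjoint J) (fun r => 1 - r.1 / ((1 - ν) * r + ν)) (fun r x hx => ?_)
    (by positivity) (fun r => ?_) h
  · have h1 := regularization_apply_eigenvector ⟨hν, hν1.le⟩ J
      (eigenvalue_nonneg_of_comp_adjoint J r.2).1 hx
    rw [sub_apply, h1, sub_smul, one_smul]
    rfl
  · have hr := eigenvalue_nonneg_of_comp_adjoint J r.2
    exact regularization_multiplier_le hν hν1 hγ hγ1 hr.1 hr.2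

end Spectral

/-- The regularization error of the relative score, bounded by its fractional pre-image. For
`ν = 1` the constant is `∞`, and the estimate says something only when the norm of the pre-image
is `0`, in which case the score vanishes. -/
theorem enorm_sub_regularizedOp_sq_le {d : ℕ} {H : Type*} [NormedAddCommGroup H]
    [InnerProductSpace ℝ H] [CompleteSpace H] [RKHS ℝ H (EuclideanSpace ℝ (Fin d)) ℝ]
    {ν γ : ℝ} (hν : ν ∈ Set.Ioc (0 : ℝ) 1) (hγ : γ ∈ Set.Ioc (0 : ℝ) (1 / 2))
    {ρ π : EuclideanSpace ℝ (Fin d) → ℝ}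
    {v : Lp (EuclideanSpace ℝ (Fin d)) 2 (densMeasure ρ)}
    (hv : ⇑v =ᵐ[densMeasure ρ] relScore ρ π) :
    ‖v - regularizedOp H ν (densMeasure ρ) v‖ₑ ^ 2 ≤
      ENNReal.ofReal ((max (largestEigenvalue (kernelOp H (densMeasure ρ))) 1) ^ 2) *
        ENNReal.ofReal ν ^ (2 * γ) * ENNReal.ofReal (1 - ν) ^ (-(2 * γ)) *
        preimageNorm H ρ π γ ^ 2 := by
  set J := inclusionCLM H (densMeasure ρ) with hJ
  set L := max (largestEigenvalue (kernelOp H (densMeasure ρ))) 1 with hL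
  have hL0 : 0 < L := lt_of_lt_of_le one_pos (le_max_right _ _)
  have hγ1 : γ ≤ 1 := hγ.2.trans (by norm_num)
  have hpre : ∀ h : {h : Lp (EuclideanSpace ℝ (Fin d)) 2 (densMeasure ρ) //
      ⇑(fracPow (kernelOp H (densMeasure ρ)) γ h) =ᵐ[densMeasure ρ] relScore ρ π},
      fracPow (J ∘L J.adjoint) γ h = v := fun h => Lp.ext (h.2.trans hv.symm)
  rcases hν.2.eq_or_lt with h1 | h1
  -- `ν = 1`, where `0 ^ (-(2 * γ)) = ∞` and `∞ * 0 = 0`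
  · by_cases h0 : preimageNorm H ρ π γ = 0
    · have hv0 : v = 0 := by
        have h2 : ‖v‖ₑ ≤ ENNReal.ofReal (L ^ γ) * preimageNorm H ρ π γ := by
          rw [preimageNorm, ENNReal.mul_iInf_of_ne (ENNReal.ofReal_pos.2 (by positivity)).ne'
            ENNReal.ofReal_ne_top]
          refine le_iInf fun h => ?_
          have h3 := norm_fracPow_le J hγ.1.le h.1
          rw [hpre h] at h3
          rw [← ofReal_norm, ← ofReal_norm, ← ENNReal.ofReal_mul (by positivity)]
          exact ENNReal.ofReal_le_ofReal h3
        rw [h0, mul_zero, nonpos_iff_eq_zero, enorm_eq_zero] at h2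
        exact h2
      simp [hv0]
    · have h2 : ENNReal.ofReal (1 - ν) ^ (-(2 * γ)) = ∞ := by
        rw [h1, sub_self, ENNReal.ofReal_zero, ENNReal.zero_rpow_of_neg (by linarith [hγ.1])]
      have h3 : ENNReal.ofReal (L ^ 2) * ENNReal.ofReal ν ^ (2 * γ) ≠ 0 := by
        rw [h1, ENNReal.ofReal_one, ENNReal.one_rpow, mul_one]
        exact (ENNReal.ofReal_pos.2 (by positivity)).ne'
      rw [h2, ENNReal.mul_top h3, ENNReal.top_mul (pow_ne_zero 2 h0)]
      exact le_top
  · have h1ν : 0 < 1 - ν := by linarith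
    set c := L * (ν ^ γ * (1 - ν) ^ (-γ)) with hc
    have hν0 := hν.1
    have hc0 : 0 < c := by positivity
    have e1 : ENNReal.ofReal (L ^ 2) * ENNReal.ofReal ν ^ (2 * γ) *
        ENNReal.ofReal (1 - ν) ^ (-(2 * γ)) = ENNReal.ofReal c ^ 2 := by
      rw [ENNReal.ofReal_rpow_of_pos hν.1, ENNReal.ofReal_rpow_of_pos h1ν,
        ← ENNReal.ofReal_mul (by positivity), ← ENNReal.ofReal_mul (by positivity),
        ← ENNReal.ofReal_pow hc0.le]
      congr 1
      rw [hc, mul_pow, mul_pow, ← Real.rpow_natCast (ν ^ γ), ← Real.rpow_natCast ((1 - ν) ^ (-γ)),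
        ← Real.rpow_mul hν.1.le, ← Real.rpow_mul h1ν.le, mul_assoc]
      congr 3 <;> push_cast <;> ring
    rw [e1, ← mul_pow]
    refine pow_le_pow_left₀ zero_le ?_ 2
    rw [preimageNorm, ENNReal.mul_iInf_of_ne (ENNReal.ofReal_pos.2 hc0).ne' ENNReal.ofReal_ne_top]
    refine le_iInf fun h => ?_
    have h3 := norm_sub_regularization_fracPow_le hν.1 h1 J hγ.1 hγ1 h.1
    rw [hpre h] at h3
    rw [← ofReal_norm, ← ofReal_norm, ← ENNReal.ofReal_mul hc0.le]
    exact ENNReal.ofReal_le_ofReal h3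

/-! ### Test functions of class `C¹` for the weak divergence -/

/-- Approximation in `C¹` by mollification, with supports in a fixed compact set. -/
theorem ContDiff.exists_smooth_approx {d : ℕ} {η : EuclideanSpace ℝ (Fin d) → ℝ}
    (hη : ContDiff ℝ 1 η) (hc : HasCompactSupport η) {ε : ℝ} (hε : 0 < ε) :
    ∃ ψ : EuclideanSpace ℝ (Fin d) → ℝ, ContDiff ℝ (⊤ : ℕ∞) ψ ∧
      (∀ x ∉ Metric.cthickening 1 (tsupport η), ψ x = 0) ∧
      (∀ x, |ψ x - η x| ≤ ε) ∧ ∀ x, ‖fderiv ℝ ψ x - fderiv ℝ η x‖ ≤ ε := by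
  have hu := hc.uniformContinuous_of_continuous hη.continuous
  have hcf := hη.continuous_fderiv one_ne_zero
  have hu' := (hc.fderiv ℝ).uniformContinuous_of_continuous hcf
  obtain ⟨δ₁, hδ₁, h₁⟩ := Metric.uniformContinuous_iff.1 hu ε hε
  obtain ⟨δ₂, hδ₂, h₂⟩ := Metric.uniformContinuous_iff.1 hu' ε hε
  set δ := min 1 (min δ₁ δ₂) with hδ
  have hδ0 : 0 < δ := by positivity
  set φ : ContDiffBump (0 : EuclideanSpace ℝ (Fin d)) :=
    ⟨δ / 2, δ, half_pos hδ0, half_lt_self hδ0⟩ with hφ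
  have hφr : φ.rOut = δ := rfl
  have hφi : LocallyIntegrable (φ.normed volume) (volume : Measure (EuclideanSpace ℝ (Fin d))) :=
    φ.continuous_normed.locallyIntegrable
  refine ⟨convolution (φ.normed volume) η (ContinuousLinearMap.lsmul ℝ ℝ) volume,
    φ.hasCompactSupport_normed.contDiff_convolution_left _ φ.contDiff_normed
      hη.continuous.locallyIntegrable, fun x hx => ?_, fun x => ?_, fun x => ?_⟩
  · have h0 : ∀ y ∈ Metric.ball x φ.rOut, η y = 0 := by
      intro y hy
      by_contra hne
      refine hx (Metric.mem_cthickening_of_dist_le x y 1 _ (subset_tsupport _ hne) ?_)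
      rw [dist_comm]
      exact (Metric.mem_ball.1 hy).le.trans (min_le_left _ _)
    have hx0 := h0 x (Metric.mem_ball_self φ.rOut_pos)
    have h3 := φ.dist_normed_convolution_le (μ := volume) (g := η) (x₀ := x) (ε := 0)
      hη.continuous.aestronglyMeasurable (fun y hy => by rw [h0 y hy, hx0, dist_self])
    rw [hx0] at h3
    exact dist_le_zero.1 h3
  · refine φ.dist_normed_convolution_le (μ := volume) (g := η) (x₀ := x)
      hη.continuous.aestronglyMeasurable (fun y hy => (h₁ ?_).le)
    exact (Metric.mem_ball.1 hy).trans_le ((min_le_right _ _).trans (min_le_left _ _))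
  · have h3 := hc.hasFDerivAt_convolution_right (μ := volume) (ContinuousLinearMap.lsmul ℝ ℝ)
      hφi hη x
    rw [h3.fderiv]
    refine ContinuousLinearMap.opNorm_le_bound _ hε.le fun e => ?_
    rw [sub_apply, convolution_precompR_apply _ hφi (hc.fderiv ℝ) hcf]
    refine φ.dist_normed_convolution_le (μ := volume) (g := fun a => fderiv ℝ η a e) (x₀ := x)
      (hcf.clm_apply continuous_const).aestronglyMeasurable (fun y hy => ?_)
    rw [dist_eq_norm, ← sub_apply]
    refine (ContinuousLinearMap.le_opNorm _ e).trans
      (mul_le_mul_of_nonneg_right ?_ (norm_nonneg e))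
    rw [← dist_eq_norm]
    refine (h₂ ?_).le
    exact (Metric.mem_ball.1 hy).trans_le ((min_le_right _ _).trans (min_le_right _ _))

theorem inner_gradient_eq_fderiv {d : ℕ} (η : EuclideanSpace ℝ (Fin d) → ℝ)
    (x e : EuclideanSpace ℝ (Fin d)) : inner ℝ (gradient η x) e = fderiv ℝ η x e := by
  rw [gradient, InnerProductSpace.toDual_symm_apply]

/-- The distributional divergence may be tested with compactly supported functions of class `C¹`:
the test functions here are built from densities that are only twice differentiable. -/
theorem HasWeakDivergence.integral_mul_eq {d : ℕ}
    {V : EuclideanSpace ℝ (Fin d) → EuclideanSpace ℝ (Fin d)} {g : EuclideanSpace ℝ (Fin d) → ℝ}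
    (h : HasWeakDivergence V g) (hV : LocallyIntegrable V) (hg : LocallyIntegrable g)
    {η : EuclideanSpace ℝ (Fin d) → ℝ} (hη : ContDiff ℝ 1 η) (hc : HasCompactSupport η) :
    ∫ x, η x * g x = - ∫ x, fderiv ℝ η x (V x) := by
  set k := Metric.cthickening 1 (tsupport η) with hk
  have hkc : IsCompact k := hc.isCompact.cthickening
  have hηk : ∀ x ∉ k, η x = 0 := fun x hx =>
    image_eq_zero_of_notMem_tsupport fun h' => hx (Metric.self_subset_cthickening _ h')
  have hηk' : ∀ x ∉ k, fderiv ℝ η x = 0 := fun x hx =>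
    image_eq_zero_of_notMem_tsupport fun h' =>
      hx (Metric.self_subset_cthickening _ (tsupport_fderiv_subset ℝ h'))
  have hVk := hV.integrableOn_isCompact hkc
  have hgk := hg.integrableOn_isCompact hkc
  have e1 : ∀ ψ : EuclideanSpace ℝ (Fin d) → ℝ, (∀ x ∉ k, ψ x = 0) →
      ∫ x, ψ x * g x = ∫ x in k, ψ x * g x := fun ψ hψ =>
    (setIntegral_eq_integral_of_forall_compl_eq_zero fun x hx => by rw [hψ x hx, zero_mul]).symm
  have e2 : ∀ ψ : EuclideanSpace ℝ (Fin d) → ℝ, (∀ x ∉ k, fderiv ℝ ψ x = 0) →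
      ∫ x, fderiv ℝ ψ x (V x) = ∫ x in k, fderiv ℝ ψ x (V x) := fun ψ hψ =>
    (setIntegral_eq_integral_of_forall_compl_eq_zero fun x hx => by
      rw [hψ x hx, zero_apply]).symm
  have i1 : ∀ ψ : EuclideanSpace ℝ (Fin d) → ℝ, Continuous ψ →
      IntegrableOn (fun x => ψ x * g x) k := fun ψ hψ =>
    hgk.continuousOn_mul hψ.continuousOn hkc
  have i2 : ∀ ψ : EuclideanSpace ℝ (Fin d) → ℝ, Continuous (fderiv ℝ ψ) →
      IntegrableOn (fun x => fderiv ℝ ψ x (V x)) k := by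
    intro ψ hψ
    obtain ⟨C, hC⟩ := hkc.exists_bound_of_continuousOn hψ.continuousOn
    refine Integrable.mono' (hVk.norm.const_mul C) ?_ ?_
    · exact (ContinuousLinearMap.apply ℝ ℝ).flip.aestronglyMeasurable_comp₂
        (hψ.aestronglyMeasurable) hVk.aestronglyMeasurable
    · filter_upwards [ae_restrict_mem hkc.measurableSet] with x hx
      exact (ContinuousLinearMap.le_opNorm _ _).trans
        (mul_le_mul_of_nonneg_right (hC x hx) (norm_nonneg _))
  -- the defect of the identity for `η` is at most `ε` times a constant, for every `ε`
  have key : ∀ ε > 0, |(∫ x in k, η x * g x) + ∫ x in k, fderiv ℝ η x (V x)|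
      ≤ ε * ((∫ x in k, ‖g x‖) + ∫ x in k, ‖V x‖) := by
    intro ε hε
    obtain ⟨ψ, hψ, hψ0, hψ1, hψ2⟩ := hη.exists_smooth_approx hc hε
    have hψc : HasCompactSupport ψ := HasCompactSupport.intro hkc hψ0
    have hψf : ∀ x ∉ k, fderiv ℝ ψ x = 0 := fun x hx =>
      image_eq_zero_of_notMem_tsupport fun h' => hx
        ((closure_minimal (s := Function.support ψ) (fun y hy => by_contra fun hy' => hy (hψ0 y hy'))
          hkc.isClosed) (tsupport_fderiv_subset ℝ h'))
    have hψ3 := h ψ hψ hψc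
    simp_rw [inner_gradient_eq_fderiv] at hψ3
    rw [e1 ψ hψ0, e2 ψ hψf] at hψ3
    have hcψ : Continuous (fderiv ℝ ψ) := hψ.continuous_fderiv (by simp)
    have hcη := hη.continuous_fderiv one_ne_zero
    have e3 : (∫ x in k, η x * g x) + ∫ x in k, fderiv ℝ η x (V x)
        = (∫ x in k, (η x * g x - ψ x * g x))
          + ∫ x in k, (fderiv ℝ η x (V x) - fderiv ℝ ψ x (V x)) := by
      rw [integral_sub (i1 _ hη.continuous) (i1 _ hψ.continuous), integral_sub (i2 _ hcη)
        (i2 _ hcψ), hψ3]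
      ring
    rw [e3, mul_add, ← integral_const_mul, ← integral_const_mul]
    refine (abs_add_le _ _).trans (add_le_add ?_ ?_)
    · rw [← Real.norm_eq_abs]
      refine norm_integral_le_of_norm_le (hgk.norm.const_mul ε) (Eventually.of_forall fun x => ?_)
      rw [← sub_mul, norm_mul, norm_sub_rev]
      exact mul_le_mul_of_nonneg_right (hψ1 x) (norm_nonneg _)
    · rw [← Real.norm_eq_abs]
      refine norm_integral_le_of_norm_le (hVk.norm.const_mul ε) (Eventually.of_forall fun x => ?_)
      rw [← sub_apply]
      refine (ContinuousLinearMap.le_opNorm _ _).trans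
        (mul_le_mul_of_nonneg_right ?_ (norm_nonneg _))
      rw [norm_sub_rev]
      exact hψ2 x
  rw [e1 η hηk, e2 η hηk', ← sub_eq_zero, sub_neg_eq_add, ← abs_nonpos_iff]
  set c := (∫ x in k, ‖g x‖) + ∫ x in k, ‖V x‖ with hcdef
  have hc0 : 0 ≤ c := add_nonneg (integral_nonneg fun _ => norm_nonneg _)
    (integral_nonneg fun _ => norm_nonneg _)
  refine le_of_forall_pos_le_add fun ε hε => ?_
  refine (key (ε / (c + 1)) (by positivity)).trans ?_
  rw [div_mul_eq_mul_div, zero_add, div_le_iff₀ (by positivity)]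
  nlinarith

/-! ### Cutoff functions adapted to a finite measure -/

/-- A minimizing sequence for the norm on a convex set satisfies the variational inequality of the
minimizer up to a vanishing error. -/
theorem Convex.exists_seq_inner_ge {X : Type*} [NormedAddCommGroup X] [InnerProductSpace ℝ X]
    [CompleteSpace X] {K : Set X} (hK : Convex ℝ K) (hne : K.Nonempty) :
    ∃ (x : X) (u : ℕ → X), (∀ j, u j ∈ K) ∧ Tendsto u atTop (𝓝 x) ∧ (∀ y ∈ K, ‖x‖ ≤ ‖y‖) ∧
      ∀ j z, u j + z ∈ K → -(‖u j - x‖ * (‖x‖ + ‖z‖)) ≤ inner ℝ (u j) z := by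
  obtain ⟨x, hx, hmin⟩ := exists_norm_eq_iInf_of_complete_convex hne.closure
    isClosed_closure.isComplete hK.closure 0
  have hvar := (norm_eq_iInf_iff_real_inner_le_zero hK.closure hx).1 hmin
  simp only [zero_sub, inner_neg_left, Left.neg_nonpos_iff] at hvar
  obtain ⟨u, hu, hux⟩ := mem_closure_iff_seq_limit.1 hx
  refine ⟨x, u, hu, hux, fun y hy => ?_, fun j z hz => ?_⟩
  · have h1 := hvar y (subset_closure hy)
    rw [inner_sub_right, real_inner_self_eq_norm_mul_norm] at h1
    have h2 := real_inner_le_norm x y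
    by_contra! h3
    nlinarith [norm_nonneg x, norm_nonneg y]
  · have h1 := hvar _ (subset_closure hz)
    have h2 : inner ℝ x (u j + z - x) = inner ℝ x (u j - x) + inner ℝ x z := by
      rw [← inner_add_right]; congr 1; abel
    have h3 : inner ℝ (u j) z = inner ℝ x z + inner ℝ (u j - x) z := by
      rw [← inner_add_left]; congr 1; abel
    have h4 := abs_le.1 (abs_real_inner_le_norm x (u j - x))
    have h5 := abs_le.1 (abs_real_inner_le_norm (u j - x) z)
    rw [h2] at h1
    rw [h3]
    nlinarith [h4.2, h5.1]

section Barrier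

variable {d : ℕ}

/-- Nonnegative functions of class `C¹` that are equal to `1` outside the ball of radius `R`. -/
structure IsBarrier (R : ℝ) (w : EuclideanSpace ℝ (Fin d) → ℝ) : Prop where
  contDiff : ContDiff ℝ 1 w
  nonneg : ∀ x, 0 ≤ w x
  eq_one : ∀ x ∉ Metric.closedBall (0 : EuclideanSpace ℝ (Fin d)) R, w x = 1

theorem ContDiff.continuous_gradient {w : EuclideanSpace ℝ (Fin d) → ℝ} (hw : ContDiff ℝ 1 w) :
    Continuous (gradient w) :=
  (InnerProductSpace.toDual ℝ (EuclideanSpace ℝ (Fin d))).symm.continuous.comp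
    (hw.continuous_fderiv one_ne_zero)

theorem gradient_eq_zero_of_eqOn_compl {R c : ℝ} {w : EuclideanSpace ℝ (Fin d) → ℝ}
    (h : ∀ x ∉ Metric.closedBall (0 : EuclideanSpace ℝ (Fin d)) R, w x = c) :
    ∀ x ∉ Metric.closedBall (0 : EuclideanSpace ℝ (Fin d)) R, gradient w x = 0 := by
  intro x hx
  have h1 : w =ᶠ[𝓝 x] fun _ => c := by
    filter_upwards [Metric.isClosed_closedBall.isOpen_compl.mem_nhds hx] with y hy using h y hy
  rw [gradient, h1.fderiv_eq]
  simp

theorem IsBarrier.memLp {R : ℝ} {w : EuclideanSpace ℝ (Fin d) → ℝ} (hw : IsBarrier R w)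
    (P : Measure (EuclideanSpace ℝ (Fin d))) [IsFiniteMeasure P] : MemLp w 2 P := by
  have h1 : HasCompactSupport fun x => w x - 1 :=
    HasCompactSupport.intro (isCompact_closedBall 0 R) fun x hx => by rw [hw.eq_one x hx, sub_self]
  have h2 : MemLp (fun x => w x - 1) 2 P :=
    (hw.contDiff.continuous.sub continuous_const).memLp_of_hasCompactSupport h1
  have h3 : w = (fun x => w x - 1) + fun _ => (1 : ℝ) := by ext x; simp
  rw [h3]
  exact h2.add (memLp_const (1 : ℝ))

theorem memLp_gradient_of_eqOn_compl {R c : ℝ} {w : EuclideanSpace ℝ (Fin d) → ℝ}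
    (hw : ContDiff ℝ 1 w)
    (h : ∀ x ∉ Metric.closedBall (0 : EuclideanSpace ℝ (Fin d)) R, w x = c)
    (P : Measure (EuclideanSpace ℝ (Fin d))) [IsFiniteMeasure P] : MemLp (gradient w) 2 P :=
  hw.continuous_gradient.memLp_of_hasCompactSupport
    (HasCompactSupport.intro (isCompact_closedBall 0 R) (gradient_eq_zero_of_eqOn_compl h))

theorem gradient_add_of_contDiff {w z : EuclideanSpace ℝ (Fin d) → ℝ} (hw : ContDiff ℝ 1 w)
    (hz : ContDiff ℝ 1 z) : gradient (w + z) = gradient w + gradient z := by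
  ext1 x
  have h1 := (hw.differentiable one_ne_zero) x
  have h2 := (hz.differentiable one_ne_zero) x
  rw [Pi.add_apply, gradient, gradient, gradient, fderiv_add h1 h2, map_add]

theorem gradient_const_smul_of_contDiff {w : EuclideanSpace ℝ (Fin d) → ℝ} (hw : ContDiff ℝ 1 w)
    (c : ℝ) : gradient (c • w) = c • gradient w := by
  ext1 x
  have h1 := (hw.differentiable one_ne_zero) x
  rw [Pi.smul_apply, gradient, gradient, fderiv_const_smul h1, map_smul]

/-- The element `(f, g)` of the Hilbert space `L²(P) × L²(P; ℝ^d)`, to be used for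
`g = gradient f`, which realizes the Sobolev space `H¹(P)`. -/
noncomputable def toSobolev {P : Measure (EuclideanSpace ℝ (Fin d))} {f : EuclideanSpace ℝ (Fin d) → ℝ}
    {g : EuclideanSpace ℝ (Fin d) → EuclideanSpace ℝ (Fin d)} (hf : MemLp f 2 P)
    (hg : MemLp g 2 P) : WithLp 2 (Lp ℝ 2 P × Lp (EuclideanSpace ℝ (Fin d)) 2 P) :=
  WithLp.toLp 2 (hf.toLp f, hg.toLp g)

theorem inner_toSobolev {P : Measure (EuclideanSpace ℝ (Fin d))}
    {f f' : EuclideanSpace ℝ (Fin d) → ℝ}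
    {g g' : EuclideanSpace ℝ (Fin d) → EuclideanSpace ℝ (Fin d)} (hf : MemLp f 2 P)
    (hg : MemLp g 2 P) (hf' : MemLp f' 2 P) (hg' : MemLp g' 2 P) :
    inner ℝ (toSobolev hf hg) (toSobolev hf' hg')
      = (∫ x, f x * f' x ∂P) + ∫ x, inner ℝ (g x) (g' x) ∂P := by
  rw [WithLp.prod_inner_apply]
  congr 1
  · rw [L2.inner_def]
    refine integral_congr_ae ?_
    filter_upwards [hf.coeFn_toLp, hf'.coeFn_toLp] with x h1 h2
    simp only [toSobolev]
    rw [h1, h2]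
    simp [mul_comm]
  · rw [L2.inner_def]
    refine integral_congr_ae ?_
    filter_upwards [hg.coeFn_toLp, hg'.coeFn_toLp] with x h1 h2
    simp only [toSobolev]
    rw [h1, h2]

theorem norm_toSobolev_sq {P : Measure (EuclideanSpace ℝ (Fin d))}
    {f : EuclideanSpace ℝ (Fin d) → ℝ}
    {g : EuclideanSpace ℝ (Fin d) → EuclideanSpace ℝ (Fin d)} (hf : MemLp f 2 P)
    (hg : MemLp g 2 P) :
    ‖toSobolev hf hg‖ ^ 2 = (∫ x, f x ^ 2 ∂P) + ∫ x, ‖g x‖ ^ 2 ∂P := by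
  rw [← real_inner_self_eq_norm_sq, inner_toSobolev]
  simp_rw [real_inner_self_eq_norm_sq, sq]

/-- `v` is the almost everywhere limit of barriers `w j` of bounded energy that are asymptotically
weak supersolutions, `w j - Δ_P (w j) ≥ 0`, where `-Δ_P` is the operator of the Dirichlet form
`∫ ⟨∇ f, ∇ g⟩ dP`. -/
def IsSupersolutionLimit (P : Measure (EuclideanSpace ℝ (Fin d))) (R : ℝ)
    (v : EuclideanSpace ℝ (Fin d) → ℝ) : Prop :=
  Measurable v ∧ (∀ x, 0 ≤ v x) ∧
    (∀ x ∉ Metric.closedBall (0 : EuclideanSpace ℝ (Fin d)) R, v x = 1) ∧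
    ∃ (w : ℕ → EuclideanSpace ℝ (Fin d) → ℝ) (δ : ℕ → ℝ) (B : ℝ), (∀ j, IsBarrier R (w j)) ∧
      (∀ᵐ x ∂P, Tendsto (fun j => w j x) atTop (𝓝 (v x))) ∧ Tendsto δ atTop (𝓝 0) ∧
      (∀ j, 0 ≤ δ j) ∧ (∀ j, ∫ x, ‖gradient (w j) x‖ ^ 2 ∂P ≤ B) ∧
      ∀ (j : ℕ) (ζ : EuclideanSpace ℝ (Fin d) → ℝ), ContDiff ℝ 1 ζ → (∀ x, 0 ≤ ζ x) →
        (∀ x ∉ Metric.closedBall (0 : EuclideanSpace ℝ (Fin d)) R, ζ x = 0) →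
        -(δ j * (1 + ((∫ x, ζ x ^ 2 ∂P) + ∫ x, ‖gradient ζ x‖ ^ 2 ∂P))) ≤
          (∫ x, w j x * ζ x ∂P) + ∫ x, inner ℝ (gradient (w j) x) (gradient ζ x) ∂P

/-- A minimizing sequence of the norm of `H¹(P)` among the barriers is a sequence of asymptotic
supersolutions, because `w + ζ` is again a barrier for `ζ ≥ 0` vanishing outside the ball. The norm
of the limit is at most that of any barrier `w₀`. -/
theorem exists_isSupersolutionLimit (P : Measure (EuclideanSpace ℝ (Fin d))) [IsFiniteMeasure P]
    {R : ℝ} {w₀ : EuclideanSpace ℝ (Fin d) → ℝ} (hw₀ : IsBarrier R w₀) :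
    ∃ v, IsSupersolutionLimit P R v ∧ MemLp v 2 P ∧
      ∫ x, v x ^ 2 ∂P ≤ (∫ x, w₀ x ^ 2 ∂P) + ∫ x, ‖gradient w₀ x‖ ^ 2 ∂P := by
  set K : Set (WithLp 2 (Lp ℝ 2 P × Lp (EuclideanSpace ℝ (Fin d)) 2 P)) :=
    {y | ∃ (w : EuclideanSpace ℝ (Fin d) → ℝ) (hw : IsBarrier R w),
      y = toSobolev (hw.memLp P) (memLp_gradient_of_eqOn_compl hw.contDiff hw.eq_one P)} with hK
  have hconv : Convex ℝ K := by
    rintro _ ⟨w, hw, rfl⟩ _ ⟨z, hz, rfl⟩ a b ha hb hab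
    have h1 : IsBarrier R (a • w + b • z) :=
      ⟨(hw.contDiff.const_smul a).add (hz.contDiff.const_smul b),
        fun x => add_nonneg (mul_nonneg ha (hw.nonneg x)) (mul_nonneg hb (hz.nonneg x)),
        fun x hx => by simp [hw.eq_one x hx, hz.eq_one x hx, hab]⟩
    refine ⟨_, h1, ?_⟩
    have h2 : gradient (a • w + b • z) = a • gradient w + b • gradient z := by
      have hwa : ContDiff ℝ 1 (a • w) := hw.contDiff.const_smul a
      have hzb : ContDiff ℝ 1 (b • z) := hz.contDiff.const_smul b
      rw [gradient_add_of_contDiff hwa hzb, gradient_const_smul_of_contDiff hw.contDiff,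
        gradient_const_smul_of_contDiff hz.contDiff]
    simp only [toSobolev, h2]
    rfl
  obtain ⟨y, u, huK, huy, hmin, hvar⟩ := hconv.exists_seq_inner_ge ⟨_, w₀, hw₀, rfl⟩
  choose w hw hwu using huK
  have hfst : Tendsto (fun j => (u j).fst) atTop (𝓝 y.fst) :=
    ((WithLp.prod_continuous_ofLp 2 _ _).fst.tendsto y).comp huy
  obtain ⟨φ, hφ, hae⟩ := (tendstoInMeasure_of_tendsto_Lp hfst).exists_seq_tendsto_ae
  have hmeas : Measurable (y.fst : EuclideanSpace ℝ (Fin d) → ℝ) :=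
    (Lp.stronglyMeasurable y.fst).measurable
  have hae' : ∀ᵐ x ∂P, Tendsto (fun j => w (φ j) x) atTop (𝓝 (y.fst x)) := by
    have h1 : ∀ᵐ x ∂P, ∀ j, (u (φ j)).fst x = w (φ j) x := by
      refine ae_all_iff.2 fun j => ?_
      rw [hwu]
      exact ((hw (φ j)).memLp P).coeFn_toLp
    filter_upwards [hae, h1] with x h2 h3
    simpa only [h3] using h2
  -- the limit, modified on a null set to be nonnegative and `1` outside the ball everywhere
  classical
  set v : EuclideanSpace ℝ (Fin d) → ℝ := (Metric.closedBall 0 R).piecewise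
    (fun x => max (y.fst x) 0) (fun _ => 1) with hv
  have hvae : ∀ᵐ x ∂P, y.fst x = v x := by
    filter_upwards [hae'] with x hx
    by_cases hxR : x ∈ Metric.closedBall (0 : EuclideanSpace ℝ (Fin d)) R
    · rw [hv, piecewise_eq_of_mem _ _ _ hxR, max_eq_left]
      exact ge_of_tendsto hx (Eventually.of_forall fun j => (hw _).nonneg x)
    · rw [hv, piecewise_eq_of_notMem _ _ _ hxR]
      refine tendsto_nhds_unique hx ?_
      simp only [(hw _).eq_one x hxR, tendsto_const_nhds]
  have hubd : ∃ B, ∀ j, ‖u j‖ ≤ B := by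
    obtain ⟨B, hB⟩ := (Metric.isBounded_range_of_tendsto u huy).exists_norm_le
    exact ⟨B, fun j => hB _ ⟨j, rfl⟩⟩
  obtain ⟨B, hB⟩ := hubd
  refine ⟨v, ⟨?_, fun x => ?_, fun x hx => piecewise_eq_of_notMem _ _ _ hx,
    fun j => w (φ j), fun j => ‖u (φ j) - y‖ * (‖y‖ + 1), B ^ 2, fun j => hw _, ?_, ?_, ?_, ?_, ?_⟩,
    (memLp_congr_ae hvae).1 (Lp.memLp y.fst), ?_⟩
  · exact Measurable.piecewise Metric.isClosed_closedBall.measurableSet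
      (hmeas.max measurable_const) measurable_const
  · by_cases hxR : x ∈ Metric.closedBall (0 : EuclideanSpace ℝ (Fin d)) R
    · rw [hv, piecewise_eq_of_mem _ _ _ hxR]
      exact le_max_right _ _
    · rw [hv, piecewise_eq_of_notMem _ _ _ hxR]
      exact zero_le_one
  · filter_upwards [hae', hvae] with x h1 h2
    rwa [← h2]
  · have h1 := (tendsto_iff_norm_sub_tendsto_zero.1 (huy.comp hφ.tendsto_atTop)).mul_const (‖y‖ + 1)
    simpa using h1
  · intro j; positivity
  · intro j
    have h1 := pow_le_pow_left₀ (norm_nonneg _) (hB (φ j)) 2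
    rw [hwu, norm_toSobolev_sq] at h1
    have h2 : 0 ≤ ∫ x, w (φ j) x ^ 2 ∂P := integral_nonneg fun x => sq_nonneg _
    linarith
  · intro j ζ hζ hζ0 hζR
    have hζm : MemLp ζ 2 P := hζ.continuous.memLp_of_hasCompactSupport
      (HasCompactSupport.intro (isCompact_closedBall 0 R) hζR)
    have hζg := memLp_gradient_of_eqOn_compl hζ hζR P
    have hz : u (φ j) + toSobolev hζm hζg ∈ K := by
      have h1 : IsBarrier R (w (φ j) + ζ) := ⟨(hw _).contDiff.add hζ,
        fun x => add_nonneg ((hw _).nonneg x) (hζ0 x),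
        fun x hx => by simp [(hw _).eq_one x hx, hζR x hx]⟩
      refine ⟨_, h1, ?_⟩
      rw [hwu]
      simp only [toSobolev, gradient_add_of_contDiff (hw (φ j)).contDiff hζ]
      rfl
    have h1 := hvar (φ j) _ hz
    have h4 := norm_toSobolev_sq hζm hζg
    set z := toSobolev hζm hζg with hzdef
    have h3 : inner ℝ (u (φ j)) z = (∫ x, w (φ j) x * ζ x ∂P)
        + ∫ x, inner ℝ (gradient (w (φ j)) x) (gradient ζ x) ∂P := by
      rw [hwu, hzdef, inner_toSobolev]
    rw [← h3, ← h4]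
    refine le_trans ?_ h1
    rw [neg_le_neg_iff, mul_assoc]
    -- `‖y‖ + ‖z‖ ≤ (‖y‖ + 1) * (1 + ‖z‖ ^ 2)`
    refine mul_le_mul_of_nonneg_left ?_ (norm_nonneg _)
    nlinarith [norm_nonneg z, norm_nonneg y, sq_nonneg (‖z‖ - 1), sq_nonneg ‖z‖,
      mul_nonneg (norm_nonneg y) (sq_nonneg ‖z‖)]
  · have h1 : ∫ x, v x ^ 2 ∂P = ‖y.fst‖ ^ 2 := by
      rw [← real_inner_self_eq_norm_sq, L2.inner_def]
      refine integral_congr_ae ?_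
      filter_upwards [hvae] with x hx
      rw [hx, real_inner_self_eq_norm_sq, Real.norm_eq_abs, sq_abs]
    have h2 := pow_le_pow_left₀ (norm_nonneg _) (hmin _ ⟨w₀, hw₀, rfl⟩) 2
    rw [norm_toSobolev_sq, WithLp.prod_norm_sq_eq_of_L2] at h2
    rw [h1]
    nlinarith [sq_nonneg ‖y.snd‖]

/-- Since `P` is finite, barriers with transition on a large scale have small energy, and the
supersolution limits below them tend to `0`: the diffusion with invariant measure `P` does not
explode. -/
theorem exists_seq_isSupersolutionLimit (P : Measure (EuclideanSpace ℝ (Fin d)))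
    [IsFiniteMeasure P] :
    ∃ (R : ℕ → ℝ) (v : ℕ → EuclideanSpace ℝ (Fin d) → ℝ),
      (∀ n, IsSupersolutionLimit P (R n) (v n)) ∧
        ∀ᵐ x ∂P, Tendsto (fun n => v n x) atTop (𝓝 0) := by
  -- the barriers `1 - f (x / (n + 1))` for a bump function `f`
  set f : ContDiffBump (0 : EuclideanSpace ℝ (Fin d)) := ⟨1, 2, one_pos, one_lt_two⟩ with hf
  have hfc : ContDiff ℝ 1 f := f.contDiff
  have hfg : ∀ x ∉ Metric.closedBall (0 : EuclideanSpace ℝ (Fin d)) 2, f x = 0 := fun x hx =>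
    f.zero_of_le_dist (not_le.1 (fun h => hx (Metric.mem_closedBall.2 h))).le
  obtain ⟨M, hM⟩ : ∃ M, ∀ x, ‖fderiv ℝ f x‖ ≤ M :=
    (hfc.continuous_fderiv one_ne_zero).bounded_above_of_compact_support
      (f.hasCompactSupport.fderiv ℝ)
  set w : ℕ → EuclideanSpace ℝ (Fin d) → ℝ := fun n x => 1 - f (((n : ℝ) + 1)⁻¹ • x) with hw
  have hn : ∀ n : ℕ, 0 < (n : ℝ) + 1 := fun n => by positivity
  have hwb : ∀ n : ℕ, IsBarrier (2 * ((n : ℝ) + 1)) (w n) := by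
    intro n
    refine ⟨contDiff_const.sub (hfc.comp (contDiff_const_smul _)),
      fun x => sub_nonneg.2 f.le_one, fun x hx => ?_⟩
    have h1 : f (((n : ℝ) + 1)⁻¹ • x) = 0 := by
      refine hfg _ fun h => hx ?_
      rw [mem_closedBall_zero_iff, norm_smul, norm_inv, Real.norm_of_nonneg (hn n).le,
        inv_mul_le_iff₀ (hn n)] at h
      rw [mem_closedBall_zero_iff]
      linarith
    rw [hw]
    simp [h1]
  have hgrad : ∀ (n : ℕ) x, ‖gradient (w n) x‖ ≤ ((n : ℝ) + 1)⁻¹ * M := by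
    intro n x
    have h1 : HasFDerivAt (w n) (-((fderiv ℝ f (((n : ℝ) + 1)⁻¹ • x)).comp
        (((n : ℝ) + 1)⁻¹ • ContinuousLinearMap.id ℝ (EuclideanSpace ℝ (Fin d))))) x := by
      have h2 := (hfc.differentiable one_ne_zero (((n : ℝ) + 1)⁻¹ • x)).hasFDerivAt
      have h3 : HasFDerivAt (fun y : EuclideanSpace ℝ (Fin d) => ((n : ℝ) + 1)⁻¹ • y)
          (((n : ℝ) + 1)⁻¹ • ContinuousLinearMap.id ℝ (EuclideanSpace ℝ (Fin d))) x :=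
        (((n : ℝ) + 1)⁻¹ • ContinuousLinearMap.id ℝ (EuclideanSpace ℝ (Fin d))).hasFDerivAt
      exact (h2.comp x h3).const_sub 1
    rw [gradient, h1.fderiv, LinearIsometryEquiv.norm_map, norm_neg]
    refine ContinuousLinearMap.opNorm_le_bound _
      (mul_nonneg (inv_nonneg.2 (hn n).le) ((norm_nonneg _).trans (hM 0))) fun e => ?_
    have h3 : (fderiv ℝ f (((n : ℝ) + 1)⁻¹ • x)).comp
        (((n : ℝ) + 1)⁻¹ • ContinuousLinearMap.id ℝ (EuclideanSpace ℝ (Fin d))) e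
        = ((n : ℝ) + 1)⁻¹ * fderiv ℝ f (((n : ℝ) + 1)⁻¹ • x) e := by simp
    rw [h3, norm_mul, Real.norm_of_nonneg (inv_nonneg.2 (hn n).le), mul_assoc]
    refine mul_le_mul_of_nonneg_left ?_ (inv_nonneg.2 (hn n).le)
    exact (ContinuousLinearMap.le_opNorm _ _).trans
      (mul_le_mul_of_nonneg_right (hM _) (norm_nonneg _))
  have hinv : Tendsto (fun n : ℕ => ((n : ℝ) + 1)⁻¹) atTop (𝓝 0) :=
    tendsto_inv_atTop_zero.comp (tendsto_atTop_add_const_right _ _ tendsto_natCast_atTop_atTop)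
  have hE1 : Tendsto (fun n => ∫ x, w n x ^ 2 ∂P) atTop (𝓝 0) := by
    have h0 : (0 : ℝ) = ∫ _ : EuclideanSpace ℝ (Fin d), 0 ∂P := by simp
    rw [h0]
    refine tendsto_integral_of_dominated_convergence (fun _ => 1)
      (fun n => ((hwb n).contDiff.continuous.pow 2).aestronglyMeasurable) (integrable_const 1)
      (fun n => Eventually.of_forall fun x => ?_) (Eventually.of_forall fun x => ?_)
    · have h1 : w n x ≤ 1 := sub_le_self _ f.nonneg
      have h2 := (hwb n).nonneg x
      rw [Real.norm_of_nonneg (by positivity)]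
      exact pow_le_one₀ h2 h1
    · have h1 : Tendsto (fun n : ℕ => ((n : ℝ) + 1)⁻¹ • x) atTop (𝓝 0) := by
        simpa using hinv.smul_const x
      have h2 := f.eventuallyEq_one
      refine tendsto_const_nhds.congr' ?_
      filter_upwards [h1.eventually h2] with n hn
      simp [hw, hn]
  have hE2 : Tendsto (fun n => ∫ x, ‖gradient (w n) x‖ ^ 2 ∂P) atTop (𝓝 0) := by
    have h1 : Tendsto (fun n : ℕ => (((n : ℝ) + 1)⁻¹ * M) ^ 2 * P.real univ) atTop (𝓝 0) := by
      simpa using ((hinv.mul_const M).pow 2).mul_const (P.real univ)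
    refine squeeze_zero (fun n => integral_nonneg fun x => sq_nonneg _) (fun n => ?_) h1
    have h2 : ∫ _ : EuclideanSpace ℝ (Fin d), (((n : ℝ) + 1)⁻¹ * M) ^ 2 ∂P
        = (((n : ℝ) + 1)⁻¹ * M) ^ 2 * P.real univ := by
      rw [integral_const, smul_eq_mul, mul_comm]
    rw [← h2]
    exact integral_mono_of_nonneg (Eventually.of_forall fun x => sq_nonneg _)
      (integrable_const _)
      (Eventually.of_forall fun x => pow_le_pow_left₀ (norm_nonneg _) (hgrad n x) 2)
  choose v hv hvm hvE using fun n => exists_isSupersolutionLimit P (hwb n)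
  have hv0 : Tendsto (fun n => ∫ x, v n x ^ 2 ∂P) atTop (𝓝 0) := by
    refine squeeze_zero (fun n => integral_nonneg fun x => sq_nonneg _) hvE ?_
    simpa using hE1.add hE2
  -- a subsequence of an `L²` null sequence converges almost everywhere
  have hm : TendstoInMeasure P (fun n x => v n x ^ 2) atTop (fun _ => 0) := by
    refine tendstoInMeasure_of_tendsto_eLpNorm one_ne_zero
      (fun n => ((hv n).1.pow_const 2).aestronglyMeasurable) aestronglyMeasurable_const ?_
    have h1 : ∀ n, eLpNorm ((fun x => v n x ^ 2) - fun _ => (0 : ℝ)) 1 P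
        = ENNReal.ofReal (∫ x, v n x ^ 2 ∂P) := by
      intro n
      have h2 : ((fun x => v n x ^ 2) - fun _ => (0 : ℝ)) = fun x => v n x ^ 2 := by ext x; simp
      rw [h2, eLpNorm_one_eq_lintegral_enorm, ofReal_integral_eq_lintegral_ofReal
        (hvm n).integrable_sq (Eventually.of_forall fun x => sq_nonneg _)]
      refine lintegral_congr fun x => ?_
      rw [Real.enorm_eq_ofReal (sq_nonneg _)]
    simp_rw [h1]
    simpa using ENNReal.tendsto_ofReal hv0
  obtain ⟨φ, -, hae⟩ := hm.exists_seq_tendsto_ae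
  refine ⟨fun n => 2 * ((φ n : ℝ) + 1), fun n => v (φ n), fun n => hv (φ n), ?_⟩
  filter_upwards [hae] with x hx
  have h1 := (Real.continuous_sqrt.tendsto 0).comp hx
  rw [Real.sqrt_zero] at h1
  refine h1.congr fun n => ?_
  exact Real.sqrt_sq ((hv _).2.1 x)

end Barrier

/-! ### The regularized entropy density -/

/-- The constant making `entGap ε` positive. -/
noncomputable def entConst (ε : ℝ) : ℝ := 1 - Real.log ε

/-- A multiple of `m + r` minus the regularized entropy density `r log (r / (m + ε r))`. It is
homogeneous of degree one, concave, and comparable with `m + r`. -/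
noncomputable def entGap (ε m r : ℝ) : ℝ := entConst ε * (m + r) - r * Real.log (r / (m + ε * r))

/-- The partial derivative of `entGap ε m r` in `m`. -/
noncomputable def entGapL (ε m r : ℝ) : ℝ := entConst ε + r / (m + ε * r)

/-- The partial derivative of `entGap ε m r` in `r`. -/
noncomputable def entGapR (ε m r : ℝ) : ℝ :=
  entConst ε - Real.log (r / (m + ε * r)) - m / (m + ε * r)

/-- The factor by which the regularization reduces the Fisher information density. -/
noncomputable def entWeight (ε m r : ℝ) : ℝ := (m / (m + ε * r)) ^ 2

theorem HasFDerivAt.div_real {X : Type*} [NormedAddCommGroup X] [NormedSpace ℝ X] {f g : X → ℝ}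
    {f' g' : X →L[ℝ] ℝ} {x : X} (hf : HasFDerivAt f f' x) (hg : HasFDerivAt g g' x)
    (h0 : g x ≠ 0) :
    HasFDerivAt (fun y => f y / g y) ((1 / g x) • f' - (f x / g x ^ 2) • g') x := by
  have h := hf.fun_mul ((hasDerivAt_inv h0).comp_hasFDerivAt x hg)
  simp only [div_eq_mul_inv]
  refine h.congr_fderiv ?_
  ext e
  simp
  field_simp
  ring

section EntGap

variable {ε m r : ℝ}

theorem hasFDerivAt_entGap (hε : 0 < ε) (hm : 0 < m) (hr : 0 < r) :
    HasFDerivAt (fun p : ℝ × ℝ => entGap ε p.1 p.2)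
      (entGapL ε m r • ContinuousLinearMap.fst ℝ ℝ ℝ
        + entGapR ε m r • ContinuousLinearMap.snd ℝ ℝ ℝ) (m, r) := by
  have h1 : HasFDerivAt (fun p : ℝ × ℝ => p.1) (ContinuousLinearMap.fst ℝ ℝ ℝ) (m, r) :=
    hasFDerivAt_fst
  have h2 : HasFDerivAt (fun p : ℝ × ℝ => p.2) (ContinuousLinearMap.snd ℝ ℝ ℝ) (m, r) :=
    hasFDerivAt_snd
  have hd : 0 < m + ε * r := by positivity
  have h3 := h1.fun_add (h2.const_mul ε)
  have h4 := h2.div_real h3 hd.ne'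
  have h5 := h4.log (div_pos hr hd).ne'
  have h6 := ((h1.fun_add h2).const_mul (entConst ε)).fun_sub (h2.fun_mul h5)
  refine h6.congr_fderiv ?_
  ext <;> simp [entGapL, entGapR] <;> field_simp <;> ring

theorem hasFDerivAt_entGapL (hε : 0 < ε) (hm : 0 < m) (hr : 0 < r) :
    HasFDerivAt (fun p : ℝ × ℝ => entGapL ε p.1 p.2)
      ((-(r / (m + ε * r) ^ 2)) • ContinuousLinearMap.fst ℝ ℝ ℝ
        + (m / (m + ε * r) ^ 2) • ContinuousLinearMap.snd ℝ ℝ ℝ) (m, r) := by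
  have h1 : HasFDerivAt (fun p : ℝ × ℝ => p.1) (ContinuousLinearMap.fst ℝ ℝ ℝ) (m, r) :=
    hasFDerivAt_fst
  have h2 : HasFDerivAt (fun p : ℝ × ℝ => p.2) (ContinuousLinearMap.snd ℝ ℝ ℝ) (m, r) :=
    hasFDerivAt_snd
  have hd : 0 < m + ε * r := by positivity
  have h4 := h2.div_real (h1.fun_add (h2.const_mul ε)) hd.ne'
  refine (h4.const_add (entConst ε)).congr_fderiv ?_
  ext <;> simp <;> field_simp <;> ring

theorem hasFDerivAt_entGapR (hε : 0 < ε) (hm : 0 < m) (hr : 0 < r) :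
    HasFDerivAt (fun p : ℝ × ℝ => entGapR ε p.1 p.2)
      ((m / (m + ε * r) ^ 2) • ContinuousLinearMap.fst ℝ ℝ ℝ
        + (-(m ^ 2 / (r * (m + ε * r) ^ 2))) • ContinuousLinearMap.snd ℝ ℝ ℝ) (m, r) := by
  have h1 : HasFDerivAt (fun p : ℝ × ℝ => p.1) (ContinuousLinearMap.fst ℝ ℝ ℝ) (m, r) :=
    hasFDerivAt_fst
  have h2 : HasFDerivAt (fun p : ℝ × ℝ => p.2) (ContinuousLinearMap.snd ℝ ℝ ℝ) (m, r) :=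
    hasFDerivAt_snd
  have hd : 0 < m + ε * r := by positivity
  have h3 := h1.fun_add (h2.const_mul ε)
  have h4 := h2.div_real h3 hd.ne'
  have h5 := h4.log (div_pos hr hd).ne'
  have h6 := (h5.const_sub (entConst ε)).fun_sub (h1.div_real h3 hd.ne')
  refine h6.congr_fderiv ?_
  ext <;> simp <;> field_simp <;> ring

theorem entWeight_nonneg : 0 ≤ entWeight ε m r := sq_nonneg _

theorem entWeight_le_one (hε : 0 < ε) (hm : 0 < m) (hr : 0 < r) : entWeight ε m r ≤ 1 := by
  have hd : 0 < m + ε * r := by positivity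
  refine pow_le_one₀ (by positivity) ((div_le_one hd).2 ?_)
  nlinarith [mul_pos hε hr]

theorem log_div_le (hε : 0 < ε) (hm : 0 < m) (hr : 0 < r) :
    Real.log (r / (m + ε * r)) ≤ -Real.log ε := by
  have hd : 0 < m + ε * r := by positivity
  rw [← Real.log_inv]
  refine Real.log_le_log (by positivity) ?_
  rw [div_le_iff₀ hd, mul_add, inv_mul_cancel_left₀ hε.ne']
  have : 0 < ε⁻¹ * m := by positivity
  linarith

theorem neg_mul_log_div_le (hε : 0 < ε) (hm : 0 < m) (hr : 0 < r) :
    -(r * Real.log (r / (m + ε * r))) ≤ m - r + ε * r := by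
  have hd : 0 < m + ε * r := by positivity
  have h1 := Real.log_le_sub_one_of_pos (div_pos hd hr)
  have h2 : Real.log (r / (m + ε * r)) = -Real.log ((m + ε * r) / r) := by
    rw [← Real.log_inv, inv_div]
  have h3 : r * ((m + ε * r) / r - 1) = m - r + ε * r := by field_simp; ring
  rw [h2, ← h3]
  nlinarith

theorem add_le_entGap (hε : 0 < ε) (hε1 : ε ≤ 1) (hm : 0 < m) (hr : 0 < r) :
    m + r ≤ entGap ε m r := by
  have h1 := mul_le_mul_of_nonneg_left (log_div_le hε hm hr) hr.le
  have h2 := Real.log_nonpos hε.le hε1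
  rw [entGap, entConst]
  nlinarith

theorem entGap_le (hε : 0 < ε) (hε1 : ε ≤ 1) (hm : 0 < m) (hr : 0 < r) :
    entGap ε m r ≤ (entConst ε + 1) * (m + r) := by
  have h1 := neg_mul_log_div_le hε hm hr
  rw [entGap]
  nlinarith

theorem entConst_pos (hε : 0 < ε) (hε1 : ε ≤ 1) : 0 < entConst ε := by
  have h2 := Real.log_nonpos hε.le hε1
  rw [entConst]
  linarith

/-- The bound that lets the product of the forcing with the gradient of the cutoff be absorbed. It
holds because `entGapR ε m r ≤ 1 + log y ≤ 2 √y` with `y = (m + ε r) / (ε r)`. -/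
theorem entGapR_sq_mul_le (hε : 0 < ε) (hε1 : ε ≤ 1) (hm : 0 < m) (hr : 0 < r) :
    entGapR ε m r ^ 2 * r ≤ 4 / ε * entGap ε m r := by
  have hd : 0 < m + ε * r := by positivity
  set y := (m + ε * r) / (ε * r) with hy
  have hy0 : 0 < y := by positivity
  have h0 : 0 ≤ entGapR ε m r := by
    have h1 := log_div_le hε hm hr
    have h2 : m / (m + ε * r) ≤ 1 := (div_le_one hd).2 (by nlinarith [mul_pos hε hr])
    rw [entGapR, entConst]
    linarith
  have h1 : entGapR ε m r ≤ 2 * √y := by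
    have h2 : entConst ε - Real.log (r / (m + ε * r)) = 1 + Real.log y := by
      rw [hy, entConst, Real.log_div hr.ne' hd.ne', Real.log_div hd.ne' (by positivity),
        Real.log_mul hε.ne' hr.ne']
      ring
    have h3 := Real.log_le_sub_one_of_pos (Real.sqrt_pos.2 hy0)
    rw [Real.log_sqrt hy0.le] at h3
    have h4 : 0 ≤ m / (m + ε * r) := by positivity
    rw [entGapR, h2]
    linarith
  have h2 : entGapR ε m r ^ 2 ≤ 4 * y := by
    have := pow_le_pow_left₀ h0 h1 2
    rw [mul_pow, Real.sq_sqrt hy0.le] at this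
    linarith
  calc entGapR ε m r ^ 2 * r ≤ 4 * y * r := mul_le_mul_of_nonneg_right h2 hr.le
    _ = 4 / ε * (m + ε * r) := by rw [hy]; field_simp
    _ ≤ 4 / ε * entGap ε m r := by
      refine mul_le_mul_of_nonneg_left ?_ (by positivity)
      have := add_le_entGap hε hε1 hm hr
      nlinarith

end EntGap

/-! ### The logarithmic cutoff profile -/

/-- The cube of the positive part is of class `C²`, which makes `cutoff K` twice differentiable at
the end of its support. -/
theorem hasDerivAt_max_zero_pow (n : ℕ) (x : ℝ) :
    HasDerivAt (fun x : ℝ => max x 0 ^ (n + 2)) (((n : ℝ) + 2) * max x 0 ^ (n + 1)) x := by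
  rcases lt_trichotomy x 0 with hx | rfl | hx
  · rw [max_eq_right hx.le, zero_pow (by omega), mul_zero]
    refine (hasDerivAt_const x (0 : ℝ)).congr_of_eventuallyEq ?_
    filter_upwards [Iio_mem_nhds hx] with y hy
    rw [max_eq_right (le_of_lt hy), zero_pow (by omega)]
  · rw [max_self, zero_pow (by omega), mul_zero, hasDerivAt_iff_tendsto_slope]
    have h1 : Tendsto (fun y : ℝ => max y 0 ^ (n + 1)) (𝓝[≠] 0) (𝓝 0) := by
      have : Continuous fun y : ℝ => max y 0 ^ (n + 1) := by fun_prop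
      have h := this.tendsto 0
      rw [max_self, zero_pow (by omega)] at h
      exact h.mono_left nhdsWithin_le_nhds
    refine h1.congr' ?_
    filter_upwards [self_mem_nhdsWithin] with y hy
    have hy' : y ≠ 0 := hy
    rw [slope_def_field, max_self, zero_pow (by omega : n + 2 ≠ 0), sub_zero, sub_zero]
    rcases le_total y 0 with h | h
    · rw [max_eq_right h, zero_pow (by omega), zero_pow (by omega), zero_div]
    · rw [max_eq_left h]
      field_simp
      ring
  · rw [max_eq_left hx.le]
    have h := hasDerivAt_pow (n + 2) x
    have e : ((n + 2 : ℕ) : ℝ) = (n : ℝ) + 2 := by push_cast; ring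
    rw [e] at h
    refine h.congr_of_eventuallyEq ?_
    filter_upwards [Ioi_mem_nhds hx] with y hy
    rw [max_eq_left (le_of_lt hy)]

/-- The positive part of `1 - log (1 + K v) / log (1 + K)`. -/
noncomputable def logRamp (K v : ℝ) : ℝ := max (1 - Real.log (1 + K * v) / Real.log (1 + K)) 0

/-- The cutoff profile: convex and decreasing from `1` at `v = 0` to `0` at `v = 1`. The logarithm
makes `θ'' ≥ (log (1 + K) / 3) θ'²` and `v |θ'| ≤ 3 / log (1 + K)`, so that both error terms of the
localization vanish as `K → ∞`. -/
noncomputable def cutoff (K v : ℝ) : ℝ := logRamp K v ^ 3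

/-- The derivative of `cutoff K`. -/
noncomputable def cutoffD (K v : ℝ) : ℝ :=
  -(3 * logRamp K v ^ 2 * (K / (1 + K * v) / Real.log (1 + K)))

/-- The second derivative of `cutoff K`. -/
noncomputable def cutoffDD (K v : ℝ) : ℝ :=
  6 * logRamp K v * (K / (1 + K * v) / Real.log (1 + K)) ^ 2
    + 3 * logRamp K v ^ 2 * ((K / (1 + K * v)) ^ 2 / Real.log (1 + K))

section Cutoff

variable {K v : ℝ}

theorem log_one_add_pos (hK : 0 < K) : 0 < Real.log (1 + K) := Real.log_pos (by linarith)

theorem logRamp_nonneg : 0 ≤ logRamp K v := le_max_right _ _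

theorem logRamp_le_one (hK : 0 < K) (hv : 0 ≤ v) : logRamp K v ≤ 1 := by
  refine max_le ?_ zero_le_one
  have h1 : 0 ≤ Real.log (1 + K * v) := Real.log_nonneg (by nlinarith)
  have h2 : 0 ≤ Real.log (1 + K * v) / Real.log (1 + K) := div_nonneg h1 (log_one_add_pos hK).le
  linarith

theorem logRamp_one (hK : 0 < K) : logRamp K 1 = 0 := by
  rw [logRamp, mul_one, div_self (log_one_add_pos hK).ne', sub_self, max_self]

theorem hasDerivAt_cutoff (hK : 0 < K) (hv : 0 ≤ v) :
    HasDerivAt (cutoff K) (cutoffD K v) v := by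
  have hd : 0 < 1 + K * v := by positivity
  have h1 : HasDerivAt (fun v => 1 + K * v) K v := by
    simpa using ((hasDerivAt_id v).const_mul K).const_add 1
  have h2 := ((h1.log hd.ne').div_const (Real.log (1 + K))).const_sub 1
  have h3 := (hasDerivAt_max_zero_pow 1 _).comp v h2
  refine h3.congr_deriv ?_
  rw [cutoffD, logRamp]
  push_cast
  ring

theorem hasDerivAt_cutoffD (hK : 0 < K) (hv : 0 ≤ v) :
    HasDerivAt (cutoffD K) (cutoffDD K v) v := by
  have hd : 0 < 1 + K * v := by positivity
  have hS := log_one_add_pos hK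
  have h1 : HasDerivAt (fun v => 1 + K * v) K v := by
    simpa using ((hasDerivAt_id v).const_mul K).const_add 1
  have h2 := ((h1.log hd.ne').div_const (Real.log (1 + K))).const_sub 1
  have h3 := (hasDerivAt_max_zero_pow 0 _).comp v h2
  have h4 := (((hasDerivAt_const v K).fun_div h1 hd.ne').div_const (Real.log (1 + K)))
  have h5 := ((h3.const_mul 3).fun_mul h4).fun_neg
  refine h5.congr_deriv ?_
  simp only [cutoffDD, logRamp, Function.comp_apply]
  field_simp
  push_cast
  ring

theorem cutoff_nonneg : 0 ≤ cutoff K v := pow_nonneg logRamp_nonneg 3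

theorem cutoff_le_one (hK : 0 < K) (hv : 0 ≤ v) : cutoff K v ≤ 1 :=
  pow_le_one₀ logRamp_nonneg (logRamp_le_one hK hv)

theorem cutoff_one (hK : 0 < K) : cutoff K 1 = 0 := by simp [cutoff, logRamp_one hK]

theorem cutoffD_one (hK : 0 < K) : cutoffD K 1 = 0 := by simp [cutoffD, logRamp_one hK]

theorem cutoff_zero : cutoff K 0 = 1 := by simp [cutoff, logRamp]

theorem cutoffD_nonpos (hK : 0 < K) (hv : 0 ≤ v) : cutoffD K v ≤ 0 := by
  have hd : 0 < 1 + K * v := by positivity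
  have := log_one_add_pos hK
  rw [cutoffD, Left.neg_nonpos_iff]
  positivity

theorem cutoffDD_ge (hK : 0 < K) (hv : 0 ≤ v) :
    Real.log (1 + K) / 3 * cutoffD K v ^ 2 ≤ cutoffDD K v := by
  have hd : 0 < 1 + K * v := by positivity
  have hS := log_one_add_pos hK
  have h0 : 0 ≤ logRamp K v := logRamp_nonneg
  have h1 := logRamp_le_one hK hv
  have e1 : Real.log (1 + K) / 3 * cutoffD K v ^ 2
      = 3 * logRamp K v ^ 4 * ((K / (1 + K * v)) ^ 2 / Real.log (1 + K)) := by
    rw [cutoffD]; field_simp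
  rw [e1, cutoffDD]
  have h2 : logRamp K v ^ 4 ≤ logRamp K v ^ 2 := pow_le_pow_of_le_one h0 h1 (by norm_num)
  have h3 : 0 ≤ (K / (1 + K * v)) ^ 2 / Real.log (1 + K) := by positivity
  have h4 : 0 ≤ 6 * logRamp K v * (K / (1 + K * v) / Real.log (1 + K)) ^ 2 := by positivity
  nlinarith [mul_le_mul_of_nonneg_right h2 h3]

theorem neg_mul_cutoffD_le (hK : 0 < K) (hv : 0 ≤ v) :
    v * -cutoffD K v ≤ 3 / Real.log (1 + K) := by
  have hd : 0 < 1 + K * v := by positivity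
  have hS := log_one_add_pos hK
  have h1 : logRamp K v ^ 2 ≤ 1 := pow_le_one₀ logRamp_nonneg (logRamp_le_one hK hv)
  have h2 : K * v / (1 + K * v) ≤ 1 := (div_le_one hd).2 (by linarith)
  have e1 : v * -cutoffD K v
      = logRamp K v ^ 2 * (K * v / (1 + K * v)) * (3 / Real.log (1 + K)) := by
    rw [cutoffD]; field_simp
  rw [e1]
  have h3 : logRamp K v ^ 2 * (K * v / (1 + K * v)) ≤ 1 :=
    mul_le_one₀ h1 (by positivity) h2
  have h4 : 0 ≤ 3 / Real.log (1 + K) := by positivity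
  nlinarith

theorem abs_cutoffD_le (hK : 0 < K) (hv : 0 ≤ v) : |cutoffD K v| ≤ 3 * (K / Real.log (1 + K)) := by
  have hd : 0 < 1 + K * v := by positivity
  have hS := log_one_add_pos hK
  have h1 : logRamp K v ^ 2 ≤ 1 := pow_le_one₀ logRamp_nonneg (logRamp_le_one hK hv)
  have h2 : K / (1 + K * v) ≤ K := div_le_self hK.le (by nlinarith)
  rw [cutoffD, abs_neg, abs_of_nonneg (by positivity)]
  calc 3 * logRamp K v ^ 2 * (K / (1 + K * v) / Real.log (1 + K))
      ≤ 3 * 1 * (K / Real.log (1 + K)) := by gcongr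
    _ = _ := by ring

theorem abs_cutoffDD_le (hK : 0 < K) (hv : 0 ≤ v) :
    |cutoffDD K v| ≤ 6 * (K / Real.log (1 + K)) ^ 2 + 3 * (K ^ 2 / Real.log (1 + K)) := by
  have hd : 0 < 1 + K * v := by positivity
  have hS := log_one_add_pos hK
  have h0 : 0 ≤ logRamp K v := logRamp_nonneg
  have h1' := logRamp_le_one hK hv
  have h1 : logRamp K v ^ 2 ≤ 1 := pow_le_one₀ logRamp_nonneg (logRamp_le_one hK hv)
  have h2 : K / (1 + K * v) ≤ K := div_le_self hK.le (by nlinarith)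
  rw [cutoffDD, abs_of_nonneg (by positivity)]
  calc _ ≤ 6 * 1 * (K / Real.log (1 + K)) ^ 2 + 3 * 1 * (K ^ 2 / Real.log (1 + K)) := by gcongr
    _ = _ := by ring

theorem continuousOn_cutoffDD (hK : 0 < K) : ContinuousOn (cutoffDD K) (Ici 0) := by
  have hS := log_one_add_pos hK
  have hd : ∀ v ∈ Ici (0 : ℝ), 1 + K * v ≠ 0 := fun v hv => by
    have : (0 : ℝ) ≤ v := hv
    positivity
  have hlin : ContinuousOn (fun v : ℝ => 1 + K * v) (Ici 0) := by fun_prop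
  have hp : ContinuousOn (logRamp K) (Ici 0) :=
    ContinuousOn.sup (continuousOn_const.sub ((hlin.log hd).div_const _)) continuousOn_const
  have hq : ContinuousOn (fun v => K / (1 + K * v)) (Ici 0) := continuousOn_const.div hlin hd
  exact ((continuousOn_const.mul hp).mul ((hq.div_const _).pow 2)).add
    ((continuousOn_const.mul (hp.pow 2)).mul ((hq.pow 2).div_const _))

theorem measurable_cutoff : Measurable (cutoff K) := by
  unfold cutoff logRamp
  fun_prop

end Cutoff

/-! ### Densities and relative scores -/

section Densities

variable {d : ℕ}

theorem IsDensity.isProbabilityMeasure {ρ : EuclideanSpace ℝ (Fin d) → ℝ} (hρ : IsDensity ρ) :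
    IsProbabilityMeasure (densMeasure ρ) := by
  refine ⟨?_⟩
  rw [densMeasure, withDensity_apply _ MeasurableSet.univ, Measure.restrict_univ,
    ← ofReal_integral_eq_lintegral_ofReal hρ.integrable
      (Eventually.of_forall fun x => (hρ.pos x).le), hρ.integral_eq_one, ENNReal.ofReal_one]

theorem IsDensity.measurable {ρ : EuclideanSpace ℝ (Fin d) → ℝ} (hρ : IsDensity ρ) :
    Measurable ρ := hρ.contDiff.continuous.measurable

theorem IsDensity.integral_densMeasure {ρ : EuclideanSpace ℝ (Fin d) → ℝ} (hρ : IsDensity ρ)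
    (f : EuclideanSpace ℝ (Fin d) → ℝ) : ∫ x, f x ∂(densMeasure ρ) = ∫ x, ρ x * f x := by
  rw [densMeasure, integral_withDensity_eq_integral_toReal_smul hρ.measurable.ennreal_ofReal
    (Eventually.of_forall fun x => ENNReal.ofReal_lt_top)]
  refine integral_congr_ae (Eventually.of_forall fun x => ?_)
  simp only [ENNReal.toReal_ofReal (hρ.pos x).le, smul_eq_mul]

theorem IsDensity.integrable_densMeasure_iff {ρ : EuclideanSpace ℝ (Fin d) → ℝ}
    (hρ : IsDensity ρ) {G : Type*} [NormedAddCommGroup G] [NormedSpace ℝ G]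
    (f : EuclideanSpace ℝ (Fin d) → G) :
    Integrable f (densMeasure ρ) ↔ Integrable (fun x => ρ x • f x) := by
  rw [densMeasure, integrable_withDensity_iff_integrable_smul' hρ.measurable.ennreal_ofReal
    (Eventually.of_forall fun x => ENNReal.ofReal_lt_top)]
  refine integrable_congr (Eventually.of_forall fun x => ?_)
  simp only [ENNReal.toReal_ofReal (hρ.pos x).le]

theorem IsDensity.volume_absolutelyContinuous {ρ : EuclideanSpace ℝ (Fin d) → ℝ}
    (hρ : IsDensity ρ) : (volume : Measure (EuclideanSpace ℝ (Fin d))) ≪ densMeasure ρ :=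
  withDensity_absolutelyContinuous' hρ.measurable.ennreal_ofReal.aemeasurable
    (Eventually.of_forall fun x => (ENNReal.ofReal_pos.2 (hρ.pos x)).ne')

theorem IsDensity.contDiff_div {f g : EuclideanSpace ℝ (Fin d) → ℝ} (hf : IsDensity f)
    (hg : IsDensity g) : ContDiff ℝ 2 fun x => f x / g x :=
  hf.contDiff.div hg.contDiff fun x => (hg.pos x).ne'

theorem IsDensity.contDiff_log_div {f g : EuclideanSpace ℝ (Fin d) → ℝ} (hf : IsDensity f)
    (hg : IsDensity g) : ContDiff ℝ 2 fun x => Real.log (f x / g x) :=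
  (hf.contDiff_div hg).log fun x => (div_pos (hf.pos x) (hg.pos x)).ne'

theorem IsDensity.continuous_relScore {f g : EuclideanSpace ℝ (Fin d) → ℝ} (hf : IsDensity f)
    (hg : IsDensity g) : Continuous (relScore f g) :=
  ((hf.contDiff_log_div hg).of_le one_le_two).continuous_gradient

theorem IsDensity.hasFDerivAt_div {f g : EuclideanSpace ℝ (Fin d) → ℝ} (hf : IsDensity f)
    (hg : IsDensity g) (x : EuclideanSpace ℝ (Fin d)) :
    HasFDerivAt (fun y => f y / g y) ((f x / g x) • innerSL ℝ (relScore f g x)) x := by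
  have hq : 0 < f x / g x := div_pos (hf.pos x) (hg.pos x)
  have h1 := ((hf.contDiff_div hg).differentiable two_ne_zero x).hasFDerivAt
  have h2 : fderiv ℝ (fun y => Real.log (f y / g y)) x
      = (f x / g x)⁻¹ • fderiv ℝ (fun y => f y / g y) x := (h1.log hq.ne').fderiv
  refine h1.congr_fderiv (ContinuousLinearMap.ext fun e => ?_)
  rw [smul_apply, innerSL_apply_apply, relScore, inner_gradient_eq_fderiv, h2, smul_apply,
    smul_smul, mul_inv_cancel₀ hq.ne', one_smul]

theorem IsDensity.relScore_eq_sub {f g p : EuclideanSpace ℝ (Fin d) → ℝ} (hf : IsDensity f)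
    (hg : IsDensity g) (hp : IsDensity p) (x : EuclideanSpace ℝ (Fin d)) :
    relScore f g x = relScore f p x - relScore g p x := by
  have h1 : (fun y => Real.log (f y / g y))
      = fun y => Real.log (f y / p y) - Real.log (g y / p y) := by
    ext y
    rw [Real.log_div (hf.pos y).ne' (hg.pos y).ne', Real.log_div (hf.pos y).ne' (hp.pos y).ne',
      Real.log_div (hg.pos y).ne' (hp.pos y).ne']
    ring
  rw [relScore, relScore, relScore, h1, gradient, gradient, gradient,
    fderiv_fun_sub ((hf.contDiff_log_div hp).differentiable two_ne_zero x)
      ((hg.contDiff_log_div hp).differentiable two_ne_zero x), map_sub]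

end Densities

/-! ### Localized entropy dissipation at a fixed time -/

/-- The pointwise estimate behind the entropy dissipation inequality: the gradient of the cutoff is
absorbed by its convexity, the forcing `u` by a quarter of the Fisher information density. Here `g`
is the gradient of the barrier, `sm` and `sr` are the relative scores of the two densities `m` and
`r`, `η` is the cutoff, `Q` the value of `entGap`, and `a`, `b` are its partial derivatives. -/
theorem dissipation_pointwise {V : Type*} [NormedAddCommGroup V] [InnerProductSpace ℝ V]
    (g sm sr u : V) {η η' η'' a b Q κ m r c S ε : ℝ} (hc : c * m = κ * r) (hη0 : 0 ≤ η)
    (hη1 : η ≤ 1) (hκ0 : 0 ≤ κ) (hκ1 : κ ≤ 1) (hS : 0 < S) (hε : 0 < ε)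
    (hη'' : S / 3 * η' ^ 2 ≤ η'') (hb : b ^ 2 * r ≤ 4 / ε * Q) (hQ : 0 ≤ Q) (hr : 0 ≤ r) :
    (-(η'' * Q) * ‖g‖ ^ 2 - η' * inner ℝ g ((a * m) • sm + (b * r) • sr))
        + 3 / 4 * (η * κ * r * ‖sr - sm‖ ^ 2) - (1 + 3 / (ε * S)) * (r * ‖u‖ ^ 2) ≤
      -(a * η' * inner ℝ g (m • sm) + η * c * inner ℝ (sr - sm) (m • sm))
        - (b * η' * inner ℝ g (r • (sr - u)) - η * κ * inner ℝ (sr - sm) (r • (sr - u))) := by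
  -- Young's inequality for the pairing of the forcing with `sr - sm`
  have h1 : 0 ≤ ‖(1 / 2 : ℝ) • (sr - sm) - u‖ ^ 2 := sq_nonneg _
  rw [norm_sub_sq_real, norm_smul, mul_pow, real_inner_smul_left, Real.norm_of_nonneg
    (by norm_num : (0 : ℝ) ≤ 1 / 2)] at h1
  -- Young's inequality for the pairing of the forcing with `g`, with the factor for which the
  -- resulting term in `‖g‖ ^ 2` is at most `η'' * Q * ‖g‖ ^ 2`
  have h2 : 0 ≤ ‖(S * ε / 6 * (b * η')) • g + u‖ ^ 2 := sq_nonneg _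
  rw [norm_add_sq_real, norm_smul, mul_pow, real_inner_smul_left, Real.norm_eq_abs, sq_abs] at h2
  have h3 : inner ℝ (sr - sm) (m • sm) = m * inner ℝ (sr - sm) sm := real_inner_smul_right _ _ _
  have h4 : inner ℝ (sr - sm) (r • (sr - u))
      = r * (‖sr - sm‖ ^ 2 + inner ℝ (sr - sm) sm - inner ℝ (sr - sm) u) := by
    rw [real_inner_smul_right, inner_sub_right, ← real_inner_self_eq_norm_sq (sr - sm),
      inner_sub_right (sr - sm) sr sm]
    ring
  rw [h3, h4]
  simp only [inner_add_right, real_inner_smul_right, inner_sub_right]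
  set L := ‖sr - sm‖ ^ 2
  set l := inner ℝ (sr - sm) sm
  set lu := inner ℝ (sr - sm) u
  set gu := inner ℝ g u
  set U := ‖u‖ ^ 2
  set G := ‖g‖ ^ 2
  have hU : 0 ≤ U := sq_nonneg _
  have hG : 0 ≤ G := sq_nonneg _
  have hηκ : 0 ≤ η * κ := mul_nonneg hη0 hκ0
  have hηκ1 : η * κ ≤ 1 := mul_le_one₀ hη1 hκ0 hκ1
  have k1 : 0 ≤ η * κ * r * (1 / 4 * L - lu + U) := by
    refine mul_nonneg (mul_nonneg hηκ hr) ?_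
    nlinarith
  have k2 : η * κ * (r * U) ≤ r * U := mul_le_of_le_one_left (mul_nonneg hr hU) hηκ1
  have k3 : S * ε / 12 * (b ^ 2 * r) ≤ S / 3 * Q := by
    calc S * ε / 12 * (b ^ 2 * r) ≤ S * ε / 12 * (4 / ε * Q) :=
          mul_le_mul_of_nonneg_left hb (by positivity)
      _ = S / 3 * Q := by field_simp; ring
  have k4 : S * ε / 12 * (b ^ 2 * r) * (η' ^ 2 * G) ≤ S / 3 * Q * (η' ^ 2 * G) :=
    mul_le_mul_of_nonneg_right k3 (by positivity)
  have k5 : S / 3 * η' ^ 2 * (Q * G) ≤ η'' * (Q * G) :=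
    mul_le_mul_of_nonneg_right hη'' (mul_nonneg hQ hG)
  have k6 : 0 ≤ 3 / (ε * S) * r * ((S * ε / 6 * (b * η')) ^ 2 * G
      + 2 * (S * ε / 6 * (b * η') * gu) + U) := mul_nonneg (by positivity) h2
  have k7 : 3 / (ε * S) * r * ((S * ε / 6 * (b * η')) ^ 2 * G
      + 2 * (S * ε / 6 * (b * η') * gu) + U)
      = S * ε / 12 * (b ^ 2 * r) * (η' ^ 2 * G) + b * η' * r * gu + 3 / (ε * S) * (r * U) := by
    field_simp
    ring
  rw [k7] at k6
  have k8 : η * c * (m * l) = η * κ * (r * l) := by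
    calc η * c * (m * l) = η * (c * m) * l := by ring
      _ = _ := by rw [hc]; ring
  rw [k8]
  nlinarith

section FixedTime

variable {d : ℕ}

theorem hasFDerivAt_cutoff_comp {K : ℝ} (hK : 0 < K) {w : EuclideanSpace ℝ (Fin d) → ℝ}
    (hw : ContDiff ℝ 1 w) (hw0 : ∀ x, 0 ≤ w x) (x : EuclideanSpace ℝ (Fin d)) :
    HasFDerivAt (fun y => cutoff K (w y)) (cutoffD K (w x) • innerSL ℝ (gradient w x)) x := by
  refine ((hasDerivAt_cutoff hK (hw0 x)).comp_hasFDerivAt x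
    (hw.differentiable one_ne_zero x).hasFDerivAt).congr_fderiv
      (ContinuousLinearMap.ext fun e => ?_)
  rw [smul_apply, smul_apply, innerSL_apply_apply, inner_gradient_eq_fderiv]

theorem hasFDerivAt_cutoffD_comp {K : ℝ} (hK : 0 < K) {w : EuclideanSpace ℝ (Fin d) → ℝ}
    (hw : ContDiff ℝ 1 w) (hw0 : ∀ x, 0 ≤ w x) (x : EuclideanSpace ℝ (Fin d)) :
    HasFDerivAt (fun y => cutoffD K (w y)) (cutoffDD K (w x) • innerSL ℝ (gradient w x)) x := by
  refine ((hasDerivAt_cutoffD hK (hw0 x)).comp_hasFDerivAt x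
    (hw.differentiable one_ne_zero x).hasFDerivAt).congr_fderiv
      (ContinuousLinearMap.ext fun e => ?_)
  rw [smul_apply, smul_apply, innerSL_apply_apply, inner_gradient_eq_fderiv]

theorem continuous_cutoffD_comp {K : ℝ} (hK : 0 < K) {w : EuclideanSpace ℝ (Fin d) → ℝ}
    (hw : ContDiff ℝ 1 w) (hw0 : ∀ x, 0 ≤ w x) : Continuous fun x => cutoffD K (w x) :=
  continuous_iff_continuousAt.2 fun x => (hasFDerivAt_cutoffD_comp hK hw hw0 x).continuousAt

theorem contDiff_of_hasFDerivAt_innerSL {f : EuclideanSpace ℝ (Fin d) → ℝ}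
    {G : EuclideanSpace ℝ (Fin d) → EuclideanSpace ℝ (Fin d)} (hG : Continuous G)
    (h : ∀ x, HasFDerivAt f (innerSL ℝ (G x)) x) : ContDiff ℝ 1 f :=
  contDiff_one_iff_hasFDerivAt.2 ⟨_, (innerSL ℝ).continuous.comp hG, h⟩

variable {π μ ρ : EuclideanSpace ℝ (Fin d) → ℝ} {ε : ℝ}

theorem hasFDerivAt_entGap_div (hπ : IsDensity π) (hμ : IsDensity μ) (hρ : IsDensity ρ)
    (hε : 0 < ε) (x : EuclideanSpace ℝ (Fin d)) :
    HasFDerivAt (fun y => entGap ε (μ y / π y) (ρ y / π y))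
      (innerSL ℝ ((entGapL ε (μ x / π x) (ρ x / π x) * (μ x / π x)) • relScore μ π x
        + (entGapR ε (μ x / π x) (ρ x / π x) * (ρ x / π x)) • relScore ρ π x)) x := by
  have h := (hasFDerivAt_entGap hε (div_pos (hμ.pos x) (hπ.pos x))
    (div_pos (hρ.pos x) (hπ.pos x))).comp x
      ((hμ.hasFDerivAt_div hπ x).prodMk (hρ.hasFDerivAt_div hπ x))
  refine h.congr_fderiv (ContinuousLinearMap.ext fun e => ?_)
  simp [innerSL_apply_apply, mul_assoc]

theorem hasFDerivAt_entGapL_div (hπ : IsDensity π) (hμ : IsDensity μ) (hρ : IsDensity ρ)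
    (hε : 0 < ε) (x : EuclideanSpace ℝ (Fin d)) :
    HasFDerivAt (fun y => entGapL ε (μ y / π y) (ρ y / π y))
      (innerSL ℝ (((μ x / π x) * (ρ x / π x) / (μ x / π x + ε * (ρ x / π x)) ^ 2) •
        (relScore ρ π x - relScore μ π x))) x := by
  have h := (hasFDerivAt_entGapL hε (div_pos (hμ.pos x) (hπ.pos x))
    (div_pos (hρ.pos x) (hπ.pos x))).comp x
      ((hμ.hasFDerivAt_div hπ x).prodMk (hρ.hasFDerivAt_div hπ x))
  refine h.congr_fderiv (ContinuousLinearMap.ext fun e => ?_)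
  simp [innerSL_apply_apply]
  ring

theorem hasFDerivAt_entGapR_div (hπ : IsDensity π) (hμ : IsDensity μ) (hρ : IsDensity ρ)
    (hε : 0 < ε) (x : EuclideanSpace ℝ (Fin d)) :
    HasFDerivAt (fun y => entGapR ε (μ y / π y) (ρ y / π y))
      (innerSL ℝ ((-entWeight ε (μ x / π x) (ρ x / π x)) •
        (relScore ρ π x - relScore μ π x))) x := by
  have hm := div_pos (hμ.pos x) (hπ.pos x)
  have hr := div_pos (hρ.pos x) (hπ.pos x)
  have h := (hasFDerivAt_entGapR hε hm hr).comp x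
      ((hμ.hasFDerivAt_div hπ x).prodMk (hρ.hasFDerivAt_div hπ x))
  refine h.congr_fderiv (ContinuousLinearMap.ext fun e => ?_)
  have hρ0 := hρ.pos x
  simp [innerSL_apply_apply, entWeight]
  field_simp
  ring

theorem continuous_entWeight_div (hπ : IsDensity π) (hμ : IsDensity μ) (hρ : IsDensity ρ)
    (hε : 0 < ε) : Continuous fun x => entWeight ε (μ x / π x) (ρ x / π x) := by
  have hm := (hμ.contDiff_div hπ).continuous
  have hr := (hρ.contDiff_div hπ).continuous
  refine (hm.div (hm.add (continuous_const.mul hr)) fun x => ?_).pow 2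
  have h1 := div_pos (hμ.pos x) (hπ.pos x)
  have h2 := div_pos (hρ.pos x) (hπ.pos x)
  exact (by positivity : 0 < μ x / π x + ε * (ρ x / π x)).ne'

theorem continuous_gradCoeff_div (hπ : IsDensity π) (hμ : IsDensity μ) (hρ : IsDensity ρ)
    (hε : 0 < ε) : Continuous fun x =>
      (μ x / π x) * (ρ x / π x) / (μ x / π x + ε * (ρ x / π x)) ^ 2 := by
  have hm := (hμ.contDiff_div hπ).continuous
  have hr := (hρ.contDiff_div hπ).continuous
  refine (hm.mul hr).div ((hm.add (continuous_const.mul hr)).pow 2) fun x => ?_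
  have h1 := div_pos (hμ.pos x) (hπ.pos x)
  have h2 := div_pos (hρ.pos x) (hπ.pos x)
  exact (by positivity : 0 < (μ x / π x + ε * (ρ x / π x)) ^ 2).ne'

theorem integrable_fderiv_apply {η : EuclideanSpace ℝ (Fin d) → ℝ} (hη : ContDiff ℝ 1 η)
    (hc : HasCompactSupport η) {V : EuclideanSpace ℝ (Fin d) → EuclideanSpace ℝ (Fin d)}
    (hV : LocallyIntegrable V) : Integrable fun x => fderiv ℝ η x (V x) := by
  have hcf := hη.continuous_fderiv one_ne_zero
  have hk : IsCompact (tsupport (fderiv ℝ η)) := hc.fderiv ℝ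
  have hVk := hV.integrableOn_isCompact hk
  obtain ⟨C, hC⟩ := hcf.bounded_above_of_compact_support (hc.fderiv ℝ)
  have h0 : ∀ x ∉ tsupport (fderiv ℝ η), fderiv ℝ η x (V x) = 0 := fun x hx => by
    rw [image_eq_zero_of_notMem_tsupport hx, zero_apply]
  refine (integrableOn_iff_integrable_of_support_subset fun x hx => ?_).1
    (Integrable.mono' (hVk.norm.const_mul C) ?_ (Eventually.of_forall fun x => ?_))
  · by_contra hx'
    exact hx (h0 x hx')
  · exact (ContinuousLinearMap.apply ℝ ℝ).flip.aestronglyMeasurable_comp₂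
      hcf.aestronglyMeasurable hVk.aestronglyMeasurable
  · exact (ContinuousLinearMap.le_opNorm _ _).trans
      (mul_le_mul_of_nonneg_right (hC x) (norm_nonneg _))

end FixedTime

section LocalizedDissipation

variable {d : ℕ}

theorem gradient_eq_of_hasFDerivAt_innerSL {f : EuclideanSpace ℝ (Fin d) → ℝ}
    {G x : EuclideanSpace ℝ (Fin d)} (h : HasFDerivAt f (innerSL ℝ G) x) : gradient f x = G :=
  ext_inner_right ℝ fun e => by
    rw [inner_gradient_eq_fderiv, h.fderiv, innerSL_apply_apply]

/-- The state of a pair of evolutions at one time: `μ'` and `ρ'` are the time derivatives of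
densities `μ` and `ρ` that follow the Wasserstein gradient flow towards `π`, the second one up to
the forcing field `u`. -/
structure IsEvolutionPair (π μ ρ μ' ρ' : EuclideanSpace ℝ (Fin d) → ℝ)
    (u : EuclideanSpace ℝ (Fin d) → EuclideanSpace ℝ (Fin d)) : Prop where
  isDensity_target : IsDensity π
  isDensity_left : IsDensity μ
  isDensity_right : IsDensity ρ
  continuous_left : Continuous μ'
  continuous_right : Continuous ρ'
  pde_left : HasWeakDivergence (fun x => μ x • relScore μ π x) μ'
  pde_right : HasWeakDivergence (fun x => ρ x • (relScore ρ π x - u x)) ρ'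
  memLp : MemLp u 2 (densMeasure ρ)

variable {π μ ρ μ' ρ' : EuclideanSpace ℝ (Fin d) → ℝ}
  {u : EuclideanSpace ℝ (Fin d) → EuclideanSpace ℝ (Fin d)} {ε K R : ℝ}
  {w : EuclideanSpace ℝ (Fin d) → ℝ}

/-- The function `-θ'(w) Q`, `θ = cutoff K` and `Q = entGap ε (μ / π) (ρ / π)`, with which the
supersolution property of the barrier `w` is tested. -/
noncomputable def barrierTest (π μ ρ : EuclideanSpace ℝ (Fin d) → ℝ) (ε K : ℝ)
    (w : EuclideanSpace ℝ (Fin d) → ℝ) (x : EuclideanSpace ℝ (Fin d)) : ℝ :=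
  -(cutoffD K (w x) * entGap ε (μ x / π x) (ρ x / π x))

theorem hasFDerivAt_barrierTest (hπ : IsDensity π) (hμ : IsDensity μ) (hρ : IsDensity ρ)
    (hε : 0 < ε) (hK : 0 < K) (hw : IsBarrier R w) (x : EuclideanSpace ℝ (Fin d)) :
    HasFDerivAt (barrierTest π μ ρ ε K w)
      (innerSL ℝ (-(cutoffDD K (w x) * entGap ε (μ x / π x) (ρ x / π x)) • gradient w x
        - cutoffD K (w x) • ((entGapL ε (μ x / π x) (ρ x / π x) * (μ x / π x)) • relScore μ π x
        + (entGapR ε (μ x / π x) (ρ x / π x) * (ρ x / π x)) • relScore ρ π x))) x := by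
  have h := ((hasFDerivAt_cutoffD_comp hK hw.contDiff hw.nonneg x).fun_mul
    (hasFDerivAt_entGap_div hπ hμ hρ hε x)).fun_neg
  refine h.congr_fderiv (ContinuousLinearMap.ext fun e => ?_)
  simp [innerSL_apply_apply]
  ring

theorem gradient_barrierTest (hπ : IsDensity π) (hμ : IsDensity μ) (hρ : IsDensity ρ)
    (hε : 0 < ε) (hK : 0 < K) (hw : IsBarrier R w) (x : EuclideanSpace ℝ (Fin d)) :
    gradient (barrierTest π μ ρ ε K w) x =
      -(cutoffDD K (w x) * entGap ε (μ x / π x) (ρ x / π x)) • gradient w x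
        - cutoffD K (w x) • ((entGapL ε (μ x / π x) (ρ x / π x) * (μ x / π x)) • relScore μ π x
        + (entGapR ε (μ x / π x) (ρ x / π x) * (ρ x / π x)) • relScore ρ π x) :=
  gradient_eq_of_hasFDerivAt_innerSL (hasFDerivAt_barrierTest hπ hμ hρ hε hK hw x)

theorem continuous_entGapL_div (hπ : IsDensity π) (hμ : IsDensity μ) (hρ : IsDensity ρ)
    (hε : 0 < ε) : Continuous fun x => entGapL ε (μ x / π x) (ρ x / π x) :=
  continuous_iff_continuousAt.2 fun x => (hasFDerivAt_entGapL_div hπ hμ hρ hε x).continuousAt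

theorem continuous_entGapR_div (hπ : IsDensity π) (hμ : IsDensity μ) (hρ : IsDensity ρ)
    (hε : 0 < ε) : Continuous fun x => entGapR ε (μ x / π x) (ρ x / π x) :=
  continuous_iff_continuousAt.2 fun x => (hasFDerivAt_entGapR_div hπ hμ hρ hε x).continuousAt

theorem continuous_entGap_div (hπ : IsDensity π) (hμ : IsDensity μ) (hρ : IsDensity ρ)
    (hε : 0 < ε) : Continuous fun x => entGap ε (μ x / π x) (ρ x / π x) :=
  continuous_iff_continuousAt.2 fun x => (hasFDerivAt_entGap_div hπ hμ hρ hε x).continuousAt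

theorem continuous_gradient_entGap_div (hπ : IsDensity π) (hμ : IsDensity μ) (hρ : IsDensity ρ)
    (hε : 0 < ε) : Continuous fun x =>
      (entGapL ε (μ x / π x) (ρ x / π x) * (μ x / π x)) • relScore μ π x
        + (entGapR ε (μ x / π x) (ρ x / π x) * (ρ x / π x)) • relScore ρ π x :=
  (((continuous_entGapL_div hπ hμ hρ hε).mul (hμ.contDiff_div hπ).continuous).smul
    (hμ.continuous_relScore hπ)).add
  (((continuous_entGapR_div hπ hμ hρ hε).mul (hρ.contDiff_div hπ).continuous).smul
    (hρ.continuous_relScore hπ))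

theorem contDiff_barrierTest (hπ : IsDensity π) (hμ : IsDensity μ) (hρ : IsDensity ρ)
    (hε : 0 < ε) (hK : 0 < K) (hw : IsBarrier R w) : ContDiff ℝ 1 (barrierTest π μ ρ ε K w) := by
  refine contDiff_of_hasFDerivAt_innerSL ?_ (hasFDerivAt_barrierTest hπ hμ hρ hε hK hw)
  have h1 : Continuous fun x => cutoffDD K (w x) :=
    (continuousOn_cutoffDD hK).comp_continuous hw.contDiff.continuous hw.nonneg
  have h2 := continuous_cutoffD_comp hK hw.contDiff hw.nonneg
  exact ((h1.mul (continuous_entGap_div hπ hμ hρ hε)).neg.smul hw.contDiff.continuous_gradient).sub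
    (h2.smul (continuous_gradient_entGap_div hπ hμ hρ hε))

/-- The localized dissipation inequality with the cutoff `cutoff K ∘ w`, for a barrier `w`. The
first term is the part of the localization error that the supersolution property controls. -/
theorem IsEvolutionPair.dissipation_barrier (h : IsEvolutionPair π μ ρ μ' ρ' u) (hε : 0 < ε)
    (hε1 : ε ≤ 1) (hK : 0 < K) (hw : IsBarrier R w) :
    (∫ x, inner ℝ (gradient w x) (gradient (barrierTest π μ ρ ε K w) x) ∂(densMeasure π))
        + 3 / 4 * (∫ x, cutoff K (w x) *
          (entWeight ε (μ x / π x) (ρ x / π x) * (ρ x * ‖relScore ρ μ x‖ ^ 2)))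
        - (1 + 3 / (ε * Real.log (1 + K))) * ∫ x, ‖u x‖ ^ 2 ∂(densMeasure ρ) ≤
      ∫ x, cutoff K (w x) * (entGapL ε (μ x / π x) (ρ x / π x) * μ' x
        + entGapR ε (μ x / π x) (ρ x / π x) * ρ' x) := by
  have hπ := h.isDensity_target
  have hμ := h.isDensity_left
  have hρ := h.isDensity_right
  have := hρ.isProbabilityMeasure
  set η : EuclideanSpace ℝ (Fin d) → ℝ := fun x => cutoff K (w x) with hη
  set a : EuclideanSpace ℝ (Fin d) → ℝ := fun x => entGapL ε (μ x / π x) (ρ x / π x) with ha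
  set b : EuclideanSpace ℝ (Fin d) → ℝ := fun x => entGapR ε (μ x / π x) (ρ x / π x) with hb
  have hηd := hasFDerivAt_cutoff_comp hK hw.contDiff hw.nonneg
  have hη1 : ContDiff ℝ 1 η := by
    refine contDiff_of_hasFDerivAt_innerSL (G := fun x => cutoffD K (w x) • gradient w x)
      ((continuous_cutoffD_comp hK hw.contDiff hw.nonneg).smul
        hw.contDiff.continuous_gradient) fun x => ?_
    rw [map_smul]
    exact hηd x
  have ha1 : ContDiff ℝ 1 a := contDiff_of_hasFDerivAt_innerSL
    ((continuous_gradCoeff_div hπ hμ hρ hε).smul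
      ((hρ.continuous_relScore hπ).sub (hμ.continuous_relScore hπ)))
    (hasFDerivAt_entGapL_div hπ hμ hρ hε)
  have hb1 : ContDiff ℝ 1 b := contDiff_of_hasFDerivAt_innerSL
    ((continuous_entWeight_div hπ hμ hρ hε).neg.smul
      ((hρ.continuous_relScore hπ).sub (hμ.continuous_relScore hπ)))
    (hasFDerivAt_entGapR_div hπ hμ hρ hε)
  have hηc : ∀ x ∉ Metric.closedBall (0 : EuclideanSpace ℝ (Fin d)) R, η x = 0 := fun x hx => by
    rw [hη]
    simp only [hw.eq_one x hx, cutoff_one hK]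
  have hcpt : ∀ f : EuclideanSpace ℝ (Fin d) → ℝ, HasCompactSupport fun x => η x * f x :=
    fun f => HasCompactSupport.intro (isCompact_closedBall 0 R) fun x hx => by
      rw [hηc x hx, zero_mul]
  have hVμ : Continuous fun x => μ x • relScore μ π x :=
    hμ.contDiff.continuous.smul (hμ.continuous_relScore hπ)
  have hVρ : LocallyIntegrable fun x => ρ x • (relScore ρ π x - u x) := by
    have h1 : Integrable (fun x => ρ x • u x) :=
      (hρ.integrable_densMeasure_iff u).1 (h.memLp.integrable one_le_two)
    have h2 : Continuous fun x => ρ x • relScore ρ π x :=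
      hρ.contDiff.continuous.smul (hρ.continuous_relScore hπ)
    have h3 := h2.locallyIntegrable (μ := volume) |>.sub h1.locallyIntegrable
    refine h3.congr (Eventually.of_forall fun x => ?_)
    simp only [Pi.sub_apply, smul_sub]
  -- the two equations, tested with the cutoff times the partial derivatives of `entGap`
  have e1 := h.pde_left.integral_mul_eq hVμ.locallyIntegrable
    h.continuous_left.locallyIntegrable (hη1.mul ha1) (hcpt a)
  have e2 := h.pde_right.integral_mul_eq hVρ
    h.continuous_right.locallyIntegrable (hη1.mul hb1) (hcpt b)
  have i1 := integrable_fderiv_apply (hη1.mul ha1) (hcpt a) hVμ.locallyIntegrable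
  have i2 := integrable_fderiv_apply (hη1.mul hb1) (hcpt b) hVρ
  have i3 : Integrable fun x => η x * a x * μ' x :=
    ((hη1.continuous.mul ha1.continuous).mul h.continuous_left).integrable_of_hasCompactSupport
      (hcpt a).mul_right
  have i4 : Integrable fun x => η x * b x * ρ' x :=
    ((hη1.continuous.mul hb1.continuous).mul h.continuous_right).integrable_of_hasCompactSupport
      (hcpt b).mul_right
  have e3 : ∫ x, η x * (a x * μ' x + b x * ρ' x)
      = ∫ x, (-(fderiv ℝ (fun x => η x * a x) x (μ x • relScore μ π x))
        - fderiv ℝ (fun x => η x * b x) x (ρ x • (relScore ρ π x - u x))) := by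
    have i1' : Integrable fun x => -(fderiv ℝ (fun x => η x * a x) x (μ x • relScore μ π x)) :=
      i1.neg
    rw [integral_sub i1' i2, integral_neg, ← e1, sub_eq_add_neg, ← e2, ← integral_add i3 i4]
    refine integral_congr_ae (Eventually.of_forall fun x => ?_)
    simp only
    ring
  have hζc : HasCompactSupport fun x =>
      inner ℝ (gradient w x) (gradient (barrierTest π μ ρ ε K w) x) :=
    HasCompactSupport.intro (isCompact_closedBall 0 R) fun x hx => by
      rw [gradient_eq_zero_of_eqOn_compl hw.eq_one x hx, inner_zero_left]
  have j1 : Integrable fun x =>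
      π x * inner ℝ (gradient w x) (gradient (barrierTest π μ ρ ε K w) x) :=
    (hπ.contDiff.continuous.mul (hw.contDiff.continuous_gradient.inner
      (contDiff_barrierTest hπ hμ hρ hε hK hw).continuous_gradient)).integrable_of_hasCompactSupport
        hζc.mul_left
  have j2 : Integrable fun x => η x *
      (entWeight ε (μ x / π x) (ρ x / π x) * (ρ x * ‖relScore ρ μ x‖ ^ 2)) :=
    (hη1.continuous.mul ((continuous_entWeight_div hπ hμ hρ hε).mul
      (hρ.contDiff.continuous.mul ((hρ.continuous_relScore
        hμ).norm.pow 2)))).integrable_of_hasCompactSupport (hcpt _)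
  have j3 : Integrable fun x => ρ x * ‖u x‖ ^ 2 := by
    have h1 := (memLp_two_iff_integrable_sq_norm h.memLp.1).1 h.memLp
    exact (hρ.integrable_densMeasure_iff _).1 h1
  have j4 : Integrable fun x =>
      π x * inner ℝ (gradient w x) (gradient (barrierTest π μ ρ ε K w) x)
        + 3 / 4 * (η x * (entWeight ε (μ x / π x) (ρ x / π x) * (ρ x * ‖relScore ρ μ x‖ ^ 2))) :=
    j1.add (j2.const_mul _)
  rw [hπ.integral_densMeasure, hρ.integral_densMeasure, e3, ← integral_const_mul,
    ← integral_const_mul, ← integral_add j1 (j2.const_mul _),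
    ← integral_sub j4 (j3.const_mul _)]
  refine integral_mono (j4.sub (j3.const_mul _)) (i1.neg.sub i2) fun x => ?_
  -- both integrands are `π x` times the two sides of the pointwise estimate at the densities
  -- relative to `π`
  have hm := div_pos (hμ.pos x) (hπ.pos x)
  have hr := div_pos (hρ.pos x) (hπ.pos x)
  have hπ0 := hπ.pos x
  have f1 := ((hηd x).fun_mul (hasFDerivAt_entGapL_div hπ hμ hρ hε x)).fderiv
  have f2 := ((hηd x).fun_mul (hasFDerivAt_entGapR_div hπ hμ hρ hε x)).fderiv
  have hd : 0 < μ x / π x + ε * (ρ x / π x) := by positivity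
  have key := dissipation_pointwise (gradient w x) (relScore μ π x) (relScore ρ π x) (u x)
    (η := cutoff K (w x)) (η' := cutoffD K (w x)) (η'' := cutoffDD K (w x))
    (a := a x) (b := b x) (Q := entGap ε (μ x / π x) (ρ x / π x))
    (κ := entWeight ε (μ x / π x) (ρ x / π x)) (m := μ x / π x) (r := ρ x / π x)
    (c := (μ x / π x) * (ρ x / π x) / (μ x / π x + ε * (ρ x / π x)) ^ 2)
    (S := Real.log (1 + K)) (ε := ε) (by rw [entWeight, div_pow]; ring) cutoff_nonneg
    (cutoff_le_one hK (hw.nonneg x)) entWeight_nonneg (entWeight_le_one hε hm hr)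
    (log_one_add_pos hK) hε (cutoffDD_ge hK (hw.nonneg x)) (entGapR_sq_mul_le hε hε1 hm hr)
    ((add_pos hm hr).le.trans (add_le_entGap hε hε1 hm hr)) hr.le
  have key' := mul_le_mul_of_nonneg_left key hπ0.le
  rw [hρ.relScore_eq_sub hμ hπ]
  have eμ : μ x = π x * (μ x / π x) := by field_simp
  have eρ : ρ x = π x * (ρ x / π x) := by field_simp
  refine le_trans (le_of_eq ?_) (key'.trans (le_of_eq ?_))
  · rw [gradient_barrierTest hπ hμ hρ hε hK hw]
    simp only [inner_sub_right, inner_add_right, real_inner_smul_right,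
      real_inner_self_eq_norm_sq, hη, ha, hb]
    generalize ρ x / π x = r at *
    rw [eρ]
    ring
  · rw [f1, f2]
    simp only [add_apply, smul_apply, innerSL_apply_apply, smul_eq_mul, real_inner_smul_left,
      real_inner_smul_right, ha, hb]
    generalize ρ x / π x = r at *
    generalize μ x / π x = m at *
    rw [eρ, eμ]
    ring

/-- The limits of barriers need not be continuous, but integrals against their cutoffs are limits of
the corresponding integrals for the barriers. -/
theorem tendsto_integral_cutoff (hK : 0 < K) {w : ℕ → EuclideanSpace ℝ (Fin d) → ℝ}
    {v f : EuclideanSpace ℝ (Fin d) → ℝ} (hw : ∀ j, IsBarrier R (w j))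
    (hv : ∀ x, 0 ≤ v x) (hwv : ∀ᵐ x, Tendsto (fun j => w j x) atTop (𝓝 (v x)))
    (hf : Continuous f) :
    Tendsto (fun j => ∫ x, cutoff K (w j x) * f x) atTop (𝓝 (∫ x, cutoff K (v x) * f x)) := by
  have hball := isCompact_closedBall (0 : EuclideanSpace ℝ (Fin d)) R
  refine tendsto_integral_of_dominated_convergence
    ((Metric.closedBall (0 : EuclideanSpace ℝ (Fin d)) R).indicator fun x => ‖f x‖)
    (fun j => (measurable_cutoff.comp (hw j).contDiff.continuous.measurable).aestronglyMeasurable.mul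
      hf.aestronglyMeasurable)
    ((hf.norm.continuousOn.integrableOn_compact hball).integrable_indicator
      hball.measurableSet) (fun j => Eventually.of_forall fun x => ?_) ?_
  · by_cases hx : x ∈ Metric.closedBall (0 : EuclideanSpace ℝ (Fin d)) R
    · rw [indicator_of_mem hx, norm_mul, Real.norm_of_nonneg cutoff_nonneg]
      exact mul_le_of_le_one_left (norm_nonneg _) (cutoff_le_one hK ((hw j).nonneg x))
    · rw [indicator_of_notMem hx, (hw j).eq_one x hx, cutoff_one hK, zero_mul, norm_zero]
  · filter_upwards [hwv] with x hx
    exact (((hasDerivAt_cutoff hK (hv x)).continuousAt.tendsto).comp hx).mul_const _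

theorem barrierTest_nonneg (hπ : IsDensity π) (hμ : IsDensity μ) (hρ : IsDensity ρ)
    (hε : 0 < ε) (hε1 : ε ≤ 1) (hK : 0 < K) (hw : IsBarrier R w)
    (x : EuclideanSpace ℝ (Fin d)) : 0 ≤ barrierTest π μ ρ ε K w x := by
  have hm := div_pos (hμ.pos x) (hπ.pos x)
  have hr := div_pos (hρ.pos x) (hπ.pos x)
  rw [barrierTest, ← neg_mul]
  exact mul_nonneg (neg_nonneg.2 (cutoffD_nonpos hK (hw.nonneg x)))
    ((add_pos hm hr).le.trans (add_le_entGap hε hε1 hm hr))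

theorem barrierTest_eq_zero (hK : 0 < K) (hw : IsBarrier R w) :
    ∀ x ∉ Metric.closedBall (0 : EuclideanSpace ℝ (Fin d)) R, barrierTest π μ ρ ε K w x = 0 :=
  fun x hx => by rw [barrierTest, hw.eq_one x hx, cutoffD_one hK, zero_mul, neg_zero]

theorem IsDensity.integral_div_densMeasure {f g : EuclideanSpace ℝ (Fin d) → ℝ}
    (hf : IsDensity f) (hg : IsDensity g) :
    Integrable (fun x => f x / g x) (densMeasure g) ∧ ∫ x, f x / g x ∂(densMeasure g) = 1 := by
  have e : (fun x => g x * (f x / g x)) = f := by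
    ext x
    have := (hg.pos x).ne'
    field_simp
  constructor
  · rw [hg.integrable_densMeasure_iff]
    simp only [smul_eq_mul]
    rw [e]
    exact hf.integrable
  · rw [hg.integral_densMeasure, e, hf.integral_eq_one]

/-- The zeroth order term of the supersolution inequality is small as `K → ∞`. The factor `6` is
`3` times the total mass of `μ` and `ρ`. -/
theorem integral_mul_barrierTest_le (hπ : IsDensity π) (hμ : IsDensity μ) (hρ : IsDensity ρ)
    (hε : 0 < ε) (hε1 : ε ≤ 1) (hK : 0 < K) (hw : IsBarrier R w) :
    ∫ x, w x * barrierTest π μ ρ ε K w x ∂(densMeasure π)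
      ≤ 6 * (entConst ε + 1) / Real.log (1 + K) := by
  have hS := log_one_add_pos hK
  have hA := hμ.integral_div_densMeasure hπ
  have hB := hρ.integral_div_densMeasure hπ
  have hC := entConst_pos hε hε1
  have e : ∫ x, 3 / Real.log (1 + K) * ((entConst ε + 1) * (μ x / π x + ρ x / π x))
      ∂(densMeasure π) = 6 * (entConst ε + 1) / Real.log (1 + K) := by
    rw [integral_const_mul, integral_const_mul, integral_add hA.1 hB.1, hA.2, hB.2]
    ring
  rw [← e]
  refine integral_mono_of_nonneg (Eventually.of_forall fun x =>
    mul_nonneg (hw.nonneg x) (barrierTest_nonneg hπ hμ hρ hε hε1 hK hw x))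
    (((hA.1.add hB.1).const_mul _).const_mul _) (Eventually.of_forall fun x => ?_)
  have hm := div_pos (hμ.pos x) (hπ.pos x)
  have hr := div_pos (hρ.pos x) (hπ.pos x)
  have h1 := neg_mul_cutoffD_le hK (hw.nonneg x)
  have h2 := entGap_le hε hε1 hm hr
  have h3 : w x * barrierTest π μ ρ ε K w x
      = w x * -cutoffD K (w x) * entGap ε (μ x / π x) (ρ x / π x) := by
    rw [barrierTest]; ring
  simp only
  rw [h3]
  exact mul_le_mul h1 h2 ((add_pos hm hr).le.trans (add_le_entGap hε hε1 hm hr)) (by positivity)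

/-- The Sobolev norm of the test functions is controlled by the energy of the barriers. -/
theorem exists_bound_barrierTest (hπ : IsDensity π) (hμ : IsDensity μ) (hρ : IsDensity ρ)
    (hε : 0 < ε) (hK : 0 < K) (R B : ℝ) :
    ∃ M, ∀ w : EuclideanSpace ℝ (Fin d) → ℝ, IsBarrier R w →
      ∫ x, ‖gradient w x‖ ^ 2 ∂(densMeasure π) ≤ B →
      (∫ x, barrierTest π μ ρ ε K w x ^ 2 ∂(densMeasure π))
        + ∫ x, ‖gradient (barrierTest π μ ρ ε K w) x‖ ^ 2 ∂(densMeasure π) ≤ M := by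
  have := hπ.isProbabilityMeasure
  have hball := isCompact_closedBall (0 : EuclideanSpace ℝ (Fin d)) R
  obtain ⟨q₀, hq₀⟩ := hball.exists_bound_of_continuousOn
    (continuous_entGap_div hπ hμ hρ hε).continuousOn
  obtain ⟨q₁, hq₁⟩ := hball.exists_bound_of_continuousOn
    (continuous_gradient_entGap_div hπ hμ hρ hε).continuousOn
  set c₁ := 3 * (K / Real.log (1 + K)) with hc₁
  set c₂ := 6 * (K / Real.log (1 + K)) ^ 2 + 3 * (K ^ 2 / Real.log (1 + K)) with hc₂
  refine ⟨(c₁ * q₀) ^ 2 + (2 * (c₂ * q₀) ^ 2 * B + 2 * (c₁ * q₁) ^ 2), fun w hw hwB => ?_⟩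
  refine add_le_add ?_ ?_
  · have e : ∫ _ : EuclideanSpace ℝ (Fin d), (c₁ * q₀) ^ 2 ∂(densMeasure π) = (c₁ * q₀) ^ 2 := by
      simp
    rw [← e]
    refine integral_mono_of_nonneg (Eventually.of_forall fun x => sq_nonneg _)
      (integrable_const _) (Eventually.of_forall fun x => ?_)
    by_cases hx : x ∈ Metric.closedBall (0 : EuclideanSpace ℝ (Fin d)) R
    · have h1 : |barrierTest π μ ρ ε K w x| ≤ c₁ * q₀ := by
        rw [barrierTest, abs_neg, abs_mul]
        exact mul_le_mul (abs_cutoffD_le hK (hw.nonneg x)) (hq₀ x hx) (abs_nonneg _)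
          ((abs_nonneg _).trans (abs_cutoffD_le hK (hw.nonneg x)))
      simp only
      rw [← sq_abs]
      exact pow_le_pow_left₀ (abs_nonneg _) h1 2
    · simp only
      rw [barrierTest_eq_zero hK hw x hx, zero_pow two_ne_zero]
      positivity
  · have hgi : Integrable (fun x => ‖gradient w x‖ ^ 2) (densMeasure π) :=
      (memLp_gradient_of_eqOn_compl hw.contDiff hw.eq_one _).integrable_norm_pow two_ne_zero
    have e : ∫ x, (2 * (c₂ * q₀) ^ 2 * ‖gradient w x‖ ^ 2 + 2 * (c₁ * q₁) ^ 2) ∂(densMeasure π)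
        = 2 * (c₂ * q₀) ^ 2 * (∫ x, ‖gradient w x‖ ^ 2 ∂(densMeasure π))
          + 2 * (c₁ * q₁) ^ 2 := by
      rw [integral_add (hgi.const_mul _) (integrable_const _), integral_const_mul]
      simp
    refine le_trans ?_ (e.le.trans (add_le_add_left
      (mul_le_mul_of_nonneg_left hwB (by positivity)) _))
    refine integral_mono_of_nonneg (Eventually.of_forall fun x => sq_nonneg _)
      ((hgi.const_mul _).add (integrable_const _)) (Eventually.of_forall fun x => ?_)
    by_cases hx : x ∈ Metric.closedBall (0 : EuclideanSpace ℝ (Fin d)) R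
    · have h1 : ‖gradient (barrierTest π μ ρ ε K w) x‖ ≤ c₂ * q₀ * ‖gradient w x‖ + c₁ * q₁ := by
        rw [gradient_barrierTest hπ hμ hρ hε hK hw]
        refine (norm_sub_le _ _).trans (add_le_add ?_ ?_)
        · rw [norm_smul, norm_neg, norm_mul]
          exact mul_le_mul_of_nonneg_right (mul_le_mul (abs_cutoffDD_le hK (hw.nonneg x))
            (hq₀ x hx) (norm_nonneg _) ((abs_nonneg _).trans (abs_cutoffDD_le hK (hw.nonneg x))))
            (norm_nonneg _)
        · rw [norm_smul]
          exact mul_le_mul (abs_cutoffD_le hK (hw.nonneg x)) (hq₁ x hx) (norm_nonneg _)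
            ((abs_nonneg _).trans (abs_cutoffD_le hK (hw.nonneg x)))
      have h2 := pow_le_pow_left₀ (norm_nonneg _) h1 2
      simp only
      nlinarith [sq_nonneg (c₂ * q₀ * ‖gradient w x‖ - c₁ * q₁)]
    · simp only
      rw [gradient_eq_zero_of_eqOn_compl (barrierTest_eq_zero hK hw) x hx, norm_zero,
        zero_pow two_ne_zero]
      positivity

/-- The localized dissipation inequality at a fixed time, with the cutoff `cutoff K ∘ v` of a
supersolution limit. -/
theorem IsEvolutionPair.dissipation (h : IsEvolutionPair π μ ρ μ' ρ' u) (hε : 0 < ε)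
    (hε1 : ε ≤ 1) (hK : 0 < K) {v : EuclideanSpace ℝ (Fin d) → ℝ}
    (hv : IsSupersolutionLimit (densMeasure π) R v) :
    3 / 4 * (∫ x, cutoff K (v x) *
          (entWeight ε (μ x / π x) (ρ x / π x) * (ρ x * ‖relScore ρ μ x‖ ^ 2)))
        - (1 + 3 / (ε * Real.log (1 + K))) * (∫ x, ‖u x‖ ^ 2 ∂(densMeasure ρ))
        - 6 * (entConst ε + 1) / Real.log (1 + K) ≤
      ∫ x, cutoff K (v x) * (entGapL ε (μ x / π x) (ρ x / π x) * μ' x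
        + entGapR ε (μ x / π x) (ρ x / π x) * ρ' x) := by
  have hπ := h.isDensity_target
  have hμ := h.isDensity_left
  have hρ := h.isDensity_right
  obtain ⟨-, hv0, -, w, δ, B, hw, hwv, hδ, hδ0, hwB, hsuper⟩ := hv
  have hwv' : ∀ᵐ x, Tendsto (fun j => w j x) atTop (𝓝 (v x)) :=
    hπ.volume_absolutelyContinuous.ae_le hwv
  obtain ⟨M, hM⟩ := exists_bound_barrierTest hπ hμ hρ hε hK R B
  -- the inequality for the barriers, in which the defect `δ j` of the supersolution property tends
  -- to `0` against the bounded Sobolev norm of the test functions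
  have hineq : ∀ j, -(δ j * (1 + M)) + 3 / 4 * (∫ x, cutoff K (w j x) *
          (entWeight ε (μ x / π x) (ρ x / π x) * (ρ x * ‖relScore ρ μ x‖ ^ 2)))
        - (1 + 3 / (ε * Real.log (1 + K))) * (∫ x, ‖u x‖ ^ 2 ∂(densMeasure ρ))
        - 6 * (entConst ε + 1) / Real.log (1 + K) ≤
      ∫ x, cutoff K (w j x) * (entGapL ε (μ x / π x) (ρ x / π x) * μ' x
        + entGapR ε (μ x / π x) (ρ x / π x) * ρ' x) := by
    intro j
    have h1 := h.dissipation_barrier hε hε1 hK (hw j)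
    have h2 := hsuper j _ (contDiff_barrierTest hπ hμ hρ hε hK (hw j))
      (barrierTest_nonneg hπ hμ hρ hε hε1 hK (hw j)) (barrierTest_eq_zero hK (hw j))
    have h3 := mul_le_mul_of_nonneg_left
      (add_le_add_right (hM (w j) (hw j) (hwB j)) 1) (hδ0 j)
    have h4 := integral_mul_barrierTest_le hπ hμ hρ hε hε1 hK (hw j)
    linarith
  have hc1 : Continuous fun x =>
      entWeight ε (μ x / π x) (ρ x / π x) * (ρ x * ‖relScore ρ μ x‖ ^ 2) :=
    (continuous_entWeight_div hπ hμ hρ hε).mul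
      (hρ.contDiff.continuous.mul ((hρ.continuous_relScore hμ).norm.pow 2))
  have hc2 : Continuous fun x => entGapL ε (μ x / π x) (ρ x / π x) * μ' x
        + entGapR ε (μ x / π x) (ρ x / π x) * ρ' x :=
    ((continuous_entGapL_div hπ hμ hρ hε).mul h.continuous_left).add
      ((continuous_entGapR_div hπ hμ hρ hε).mul h.continuous_right)
  have t1 := tendsto_integral_cutoff hK hw hv0 hwv' hc1
  have t2 := tendsto_integral_cutoff hK hw hv0 hwv' hc2
  have t3 := (((hδ.mul_const (1 + M)).neg.add (t1.const_mul (3 / 4))).sub_const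
    ((1 + 3 / (ε * Real.log (1 + K))) * (∫ x, ‖u x‖ ^ 2 ∂(densMeasure ρ)))).sub_const
    (6 * (entConst ε + 1) / Real.log (1 + K))
  rw [zero_mul, neg_zero, zero_add] at t3
  exact le_of_tendsto_of_tendsto' t3 t2 hineq

end LocalizedDissipation

/-! ### Parametric integrals -/

section ParametricIntegrals

variable {d : ℕ} {R : ℝ} {θ : EuclideanSpace ℝ (Fin d) → ℝ}

theorem integrable_mul_of_eqOn_compl (hθ : Measurable θ) (hθ1 : ∀ x, |θ x| ≤ 1)
    (hθ0 : ∀ x ∉ Metric.closedBall (0 : EuclideanSpace ℝ (Fin d)) R, θ x = 0)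
    {g : EuclideanSpace ℝ (Fin d) → ℝ} (hg : Continuous g) : Integrable fun x => θ x * g x := by
  have h1 : IntegrableOn g (Metric.closedBall 0 R) :=
    hg.continuousOn.integrableOn_compact (isCompact_closedBall _ _)
  have h2 : IntegrableOn (fun x => θ x * g x) (Metric.closedBall 0 R) :=
    h1.bdd_mul hθ.aestronglyMeasurable (Eventually.of_forall hθ1)
  refine (integrableOn_iff_integrable_of_support_subset fun x hx => ?_).1 h2
  by_contra hxR
  exact hx (by simp [hθ0 x hxR])

theorem continuousOn_integral_mul_of_eqOn_compl (hθ : Measurable θ) (hθ1 : ∀ x, |θ x| ≤ 1)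
    (hθ0 : ∀ x ∉ Metric.closedBall (0 : EuclideanSpace ℝ (Fin d)) R, θ x = 0) {S : Set ℝ}
    {G : ℝ → EuclideanSpace ℝ (Fin d) → ℝ}
    (hG : ContinuousOn (fun p : ℝ × EuclideanSpace ℝ (Fin d) => G p.1 p.2) (S ×ˢ univ)) :
    ContinuousOn (fun t => ∫ x, θ x * G t x) S := by
  -- a continuous compactly supported function equal to `1` where `θ` lives
  set χ : EuclideanSpace ℝ (Fin d) → ℝ := fun x => min 1 (max 0 (R + 1 - ‖x‖)) with hχ
  have hχc : Continuous χ := by fun_prop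
  have h1 := continuousOn_integral_bilinear_of_locally_integrable_of_compact_support
    (μ := volume) (ContinuousLinearMap.mul ℝ ℝ) (f := fun t x => χ x * G t x) (g := θ) (s := S)
    (isCompact_closedBall (0 : EuclideanSpace ℝ (Fin d)) (R + 1))
    ((hχc.comp continuous_snd).continuousOn.mul hG) (fun t x _ hx => by
      have : max 0 (R + 1 - ‖x‖) = 0 := max_eq_left (by simpa using (not_le.1 (by simpa using hx)).le)
      simp [hχ, this])
    (Measure.integrableOn_of_bounded (M := 1) (isCompact_closedBall _ _).measure_lt_top.ne
      hθ.aestronglyMeasurable (Eventually.of_forall hθ1))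
  refine h1.congr fun t _ => integral_congr_ae (Eventually.of_forall fun x => ?_)
  by_cases hx : x ∈ Metric.closedBall (0 : EuclideanSpace ℝ (Fin d)) R
  · have h3 : (1 : ℝ) ≤ max 0 (R + 1 - ‖x‖) := le_max_of_le_right (by
      have : ‖x‖ ≤ R := by simpa using hx
      linarith)
    simp [hχ, min_eq_left h3]
  · simp [hθ0 x hx]

theorem hasDerivAt_integral_mul_of_eqOn_compl (hθ : Measurable θ) (hθ1 : ∀ x, |θ x| ≤ 1)
    (hθ0 : ∀ x ∉ Metric.closedBall (0 : EuclideanSpace ℝ (Fin d)) R, θ x = 0)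
    {G G' : ℝ → EuclideanSpace ℝ (Fin d) → ℝ}
    (hG : ContinuousOn (fun p : ℝ × EuclideanSpace ℝ (Fin d) => G p.1 p.2) (Ioi 0 ×ˢ univ))
    (hG' : ContinuousOn (fun p : ℝ × EuclideanSpace ℝ (Fin d) => G' p.1 p.2) (Ioi 0 ×ˢ univ))
    (hd : ∀ t, 0 < t → ∀ x, HasDerivAt (fun s => G s x) (G' t x) t) {t : ℝ} (ht : 0 < t) :
    HasDerivAt (fun t => ∫ x, θ x * G t x) (∫ x, θ x * G' t x) t := by
  have hsl : ∀ {F : ℝ → EuclideanSpace ℝ (Fin d) → ℝ},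
      ContinuousOn (fun p : ℝ × EuclideanSpace ℝ (Fin d) => F p.1 p.2) (Ioi 0 ×ˢ univ) →
      ∀ s, 0 < s → Continuous (F s) := fun hF s hs =>
    hF.comp_continuous (f := fun x => (s, x)) (by fun_prop) fun x => ⟨hs, mem_univ _⟩
  have hsub : Icc (t / 2) (2 * t) ⊆ Ioi 0 := fun s hs => lt_of_lt_of_le (by positivity) hs.1
  obtain ⟨C, hC⟩ := (isCompact_Icc.prod
    (isCompact_closedBall (0 : EuclideanSpace ℝ (Fin d)) R)).exists_bound_of_continuousOn
      (hG'.mono (prod_mono hsub (subset_univ _)))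
  refine (hasDerivAt_integral_of_dominated_loc_of_deriv_le (s := Icc (t / 2) (2 * t))
    (F := fun s x => θ x * G s x) (F' := fun s x => θ x * G' s x)
    (bound := (Metric.closedBall 0 R).indicator fun _ => C)
    (Icc_mem_nhds (by linarith) (by linarith)) ?_
    (integrable_mul_of_eqOn_compl hθ hθ1 hθ0 (hsl hG t ht))
    (integrable_mul_of_eqOn_compl hθ hθ1 hθ0 (hsl hG' t ht)).aestronglyMeasurable
    (Eventually.of_forall fun x s hs => ?_) ?_
    (Eventually.of_forall fun x s hs => (hd s (hsub hs) x).const_mul (θ x))).2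
  · filter_upwards [Ioi_mem_nhds ht] with s hs
    exact (integrable_mul_of_eqOn_compl hθ hθ1 hθ0 (hsl hG s hs)).aestronglyMeasurable
  · by_cases hx : x ∈ Metric.closedBall (0 : EuclideanSpace ℝ (Fin d)) R
    · rw [indicator_of_mem hx, norm_mul]
      exact (mul_le_of_le_one_left (norm_nonneg _) (hθ1 x)).trans (hC (s, x) ⟨hs, hx⟩)
    · rw [indicator_of_notMem hx, hθ0 x hx, zero_mul, norm_zero]
  · rw [integrable_indicator_iff measurableSet_closedBall]
    exact integrableOn_const (isCompact_closedBall _ _).measure_lt_top.ne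

/-- An upper bound for the integral of a nonnegative function, in which the measurability of the
majorant `e` is not required. -/
theorem lintegral_ofReal_le_of_le_toReal_add {α : Type*} [MeasurableSpace α] {P : Measure α}
    {D f : α → ℝ} {e : α → ℝ≥0∞} (hD : AEMeasurable D P) (hD0 : 0 ≤ᵐ[P] D)
    (hf : Integrable f P) (he : ∫⁻ a, e a ∂P ≠ ∞) (h : ∀ᵐ a ∂P, D a ≤ (e a).toReal + f a) :
    0 ≤ (∫⁻ a, e a ∂P).toReal + ∫ a, f a ∂P ∧
    ∫⁻ a, ENNReal.ofReal (D a) ∂P ≤ ENNReal.ofReal ((∫⁻ a, e a ∂P).toReal + ∫ a, f a ∂P) := by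
  have h1 : ∫⁻ a, ENNReal.ofReal (D a - f a) ∂P ≤ ∫⁻ a, e a ∂P :=
    lintegral_mono_ae (h.mono fun a ha => ENNReal.ofReal_le_of_le_toReal (by linarith))
  have hDi : Integrable D P := by
    refine ⟨hD.aestronglyMeasurable, ?_⟩
    refine lt_of_le_of_lt (lintegral_mono_ae (hD0.mono fun a ha => ?_))
      ((lintegral_add_right' (fun a => ENNReal.ofReal (D a - f a))
        hf.aestronglyMeasurable.enorm).trans_lt
        (ENNReal.add_lt_top.2 ⟨h1.trans_lt he.lt_top, hf.2⟩))
    rw [Real.enorm_of_nonneg ha, ← ofReal_norm]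
    refine (ENNReal.ofReal_le_ofReal ?_).trans ENNReal.ofReal_add_le
    have := le_abs_self (f a)
    rw [Real.norm_eq_abs]
    linarith
  have h2 : ∫ a, D a ∂P ≤ (∫⁻ a, e a ∂P).toReal + ∫ a, f a ∂P := by
    have h3 : ∫ a, (D a - f a) ∂P ≤ (∫⁻ a, e a ∂P).toReal := by
      refine (integral_mono (hDi.sub hf) (hDi.sub hf).pos_part fun a => le_max_left _ _).trans ?_
      refine (integral_eq_lintegral_of_nonneg_ae (Eventually.of_forall fun a => le_max_right _ _)
        (hDi.sub hf).pos_part.aestronglyMeasurable).trans_le ?_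
      refine ENNReal.toReal_mono he ((lintegral_mono fun a => ?_).trans h1)
      simp
    rw [integral_sub hDi hf] at h3
    linarith
  refine ⟨(integral_nonneg_of_ae hD0).trans h2, ?_⟩
  rw [← ofReal_integral_eq_lintegral_ofReal hDi hD0]
  exact ENNReal.ofReal_le_ofReal h2

/-- Passage to the left end point of a time interval. -/
theorem setLIntegral_Ioc_le_of_tendsto {F : ℝ → ℝ≥0∞} {A : ℝ → ℝ≥0∞} {B : ℝ≥0∞} {s t : ℝ}
    (hst : s < t) (h : ∀ s' ∈ Ioo s t, ∫⁻ τ in Ioc s' t, F τ ≤ A s')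
    (hA : Tendsto A (𝓝[>] s) (𝓝 B)) : ∫⁻ τ in Ioc s t, F τ ≤ B := by
  obtain ⟨r, hr, hrm, hrt⟩ := exists_seq_strictAnti_tendsto' hst
  have hU : Ioc s t = ⋃ n, Ioc (r n) t := by
    ext τ
    simp only [mem_Ioc, mem_iUnion]
    refine ⟨fun hτ => ?_, fun ⟨n, hn⟩ => ⟨(hrm n).1.trans hn.1, hn.2⟩⟩
    obtain ⟨n, hn⟩ := (hrt.eventually (gt_mem_nhds hτ.1)).exists
    exact ⟨n, hn, hτ.2⟩
  have hmono : Monotone fun n => Ioc (r n) t := fun i j hij => Ioc_subset_Ioc_left (hr.antitone hij)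
  rw [hU, setLIntegral_iUnion_of_directed _ hmono.directed_le]
  refine le_of_tendsto_of_tendsto
    (tendsto_atTop_iSup fun i j hij => lintegral_mono_set (hmono hij)) (hA.comp
    (tendsto_nhdsWithin_iff.2 ⟨hrt, Eventually.of_forall fun n => (hrm n).1⟩))
    (Eventually.of_forall fun n => h _ (hrm n))

end ParametricIntegrals

/-! ### Integration in time of the localized inequality -/

section Homogeneity

variable {ε m r c : ℝ}

theorem div_add_mul_div_div (hc : 0 < c) : m / c + ε * (r / c) = (m + ε * r) / c := by
  field_simp

theorem entGapL_div_div (hc : 0 < c) : entGapL ε (m / c) (r / c) = entGapL ε m r := by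
  rw [entGapL, entGapL, div_add_mul_div_div hc, div_div_div_cancel_right₀ hc.ne']

theorem entGapR_div_div (hc : 0 < c) : entGapR ε (m / c) (r / c) = entGapR ε m r := by
  rw [entGapR, entGapR, div_add_mul_div_div hc, div_div_div_cancel_right₀ hc.ne',
    div_div_div_cancel_right₀ hc.ne']

theorem entWeight_div_div (hc : 0 < c) : entWeight ε (m / c) (r / c) = entWeight ε m r := by
  rw [entWeight, entWeight, div_add_mul_div_div hc, div_div_div_cancel_right₀ hc.ne']

end Homogeneity

section LocalizedEntropy

variable {d : ℕ} {π : EuclideanSpace ℝ (Fin d) → ℝ} {μ ρ : ℝ → EuclideanSpace ℝ (Fin d) → ℝ}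
  {u : ℝ → EuclideanSpace ℝ (Fin d) → EuclideanSpace ℝ (Fin d)} {ε K R : ℝ}
  {v : EuclideanSpace ℝ (Fin d) → ℝ}

/-- Freezing a curve before time `0` makes it continuous on the whole line. -/
theorem IsDensityCurve.continuous_max (hρ : IsDensityCurve ρ) :
    Continuous fun p : ℝ × EuclideanSpace ℝ (Fin d) => ρ (max p.1 0) p.2 :=
  hρ.continuousOn.comp_continuous 
    (f := fun p : ℝ × EuclideanSpace ℝ (Fin d) => (max p.1 0, p.2)) (by fun_prop)
    fun p => ⟨mem_Ici.2 (le_max_right _ _), mem_univ _⟩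

theorem norm_relScore (ρ π : EuclideanSpace ℝ (Fin d) → ℝ) (x : EuclideanSpace ℝ (Fin d)) :
    ‖relScore ρ π x‖ = ‖fderiv ℝ (fun y => Real.log (ρ y / π y)) x‖ := by
  rw [relScore, gradient, LinearIsometryEquiv.norm_map]

theorem IsDensityCurve.measurable_norm_relScore (hρ : IsDensityCurve ρ) (hμ : IsDensityCurve μ) :
    Measurable fun p : ℝ × EuclideanSpace ℝ (Fin d) =>
      ‖relScore (ρ (max p.1 0)) (μ (max p.1 0)) p.2‖ := by
  simp_rw [norm_relScore]
  refine (measurable_fderiv_with_param ℝ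
    (f := fun t y => Real.log (ρ (max t 0) y / μ (max t 0) y)) ?_).norm
  refine Continuous.log (hρ.continuous_max.div hμ.continuous_max fun p => ?_) fun p => ?_
  · exact ((hμ.isDensity _ (le_max_right _ _)).pos _).ne'
  · exact (div_pos ((hρ.isDensity _ (le_max_right _ _)).pos _)
      ((hμ.isDensity _ (le_max_right _ _)).pos _)).ne'

theorem IsDensityCurve.measurable_weighted_score (hρ : IsDensityCurve ρ) (hμ : IsDensityCurve μ) :
    Measurable fun p : ℝ × EuclideanSpace ℝ (Fin d) =>
      entWeight ε (μ (max p.1 0) p.2) (ρ (max p.1 0) p.2) *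
        (ρ (max p.1 0) p.2 * ‖relScore (ρ (max p.1 0)) (μ (max p.1 0)) p.2‖ ^ 2) := by
  have h1 := hρ.continuous_max.measurable
  have h2 := hμ.continuous_max.measurable
  have h3 := hρ.measurable_norm_relScore hμ
  exact ((h2.div (h2.add (h1.const_mul ε))).pow_const 2).mul (h1.mul (h3.pow_const 2))

/-- A pair of curves of densities following the Wasserstein gradient flow towards `π`, the second
one up to the forcing field `u`. -/
structure IsForcedFlowPair (π : EuclideanSpace ℝ (Fin d) → ℝ)
    (μ ρ : ℝ → EuclideanSpace ℝ (Fin d) → ℝ)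
    (u : ℝ → EuclideanSpace ℝ (Fin d) → EuclideanSpace ℝ (Fin d)) : Prop where
  curve_left : IsDensityCurve μ
  curve_right : IsDensityCurve ρ
  isEvolutionPair : ∀ t, 0 < t → IsEvolutionPair π (μ t) (ρ t)
    (fun x => deriv (fun s => μ s x) t) (fun x => deriv (fun s => ρ s x) t) (u t)

theorem IsDensityCurve.continuousOn_entGap (hμ : IsDensityCurve μ) (hρ : IsDensityCurve ρ)
    (hε : 0 < ε) : ContinuousOn (fun p : ℝ × EuclideanSpace ℝ (Fin d) =>
      entGap ε (μ p.1 p.2) (ρ p.1 p.2)) (Ici 0 ×ˢ univ) := fun p hp =>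
  (hasFDerivAt_entGap hε ((hμ.isDensity _ hp.1).pos _)
    ((hρ.isDensity _ hp.1).pos _)).continuousAt.comp_continuousWithinAt
    (f := fun p : ℝ × EuclideanSpace ℝ (Fin d) => (μ p.1 p.2, ρ p.1 p.2))
    ((hμ.continuousOn p hp).prodMk (hρ.continuousOn p hp))

theorem IsDensityCurve.continuousOn_entGap_deriv (hμ : IsDensityCurve μ) (hρ : IsDensityCurve ρ)
    (hε : 0 < ε) : ContinuousOn (fun p : ℝ × EuclideanSpace ℝ (Fin d) =>
      entGapL ε (μ p.1 p.2) (ρ p.1 p.2) * deriv (fun s => μ s p.2) p.1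
      + entGapR ε (μ p.1 p.2) (ρ p.1 p.2) * deriv (fun s => ρ s p.2) p.1) (Ioi 0 ×ˢ univ) := by
  intro p hp
  have hp0 : (0 : ℝ) ≤ p.1 := le_of_lt hp.1
  have hm := (hμ.isDensity _ hp0).pos p.2
  have hr := (hρ.isDensity _ hp0).pos p.2
  have hsub : Ioi (0 : ℝ) ×ˢ (univ : Set (EuclideanSpace ℝ (Fin d))) ⊆ Ici 0 ×ˢ univ :=
    prod_mono Ioi_subset_Ici_self subset_rfl
  have h1 := ((hμ.continuousOn.mono hsub) p hp).prodMk ((hρ.continuousOn.mono hsub) p hp)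
  exact (((hasFDerivAt_entGapL hε hm hr).continuousAt.comp_continuousWithinAt
    (f := fun p : ℝ × EuclideanSpace ℝ (Fin d) => (μ p.1 p.2, ρ p.1 p.2)) h1).mul
      (hμ.continuousOn_deriv p hp)).add
    (((hasFDerivAt_entGapR hε hm hr).continuousAt.comp_continuousWithinAt
    (f := fun p : ℝ × EuclideanSpace ℝ (Fin d) => (μ p.1 p.2, ρ p.1 p.2)) h1).mul
      (hρ.continuousOn_deriv p hp))

theorem IsDensityCurve.hasDerivAt_entGap (hμ : IsDensityCurve μ) (hρ : IsDensityCurve ρ)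
    (hε : 0 < ε) (t : ℝ) (ht : 0 < t) (x : EuclideanSpace ℝ (Fin d)) :
    HasDerivAt (fun s => entGap ε (μ s x) (ρ s x))
      (entGapL ε (μ t x) (ρ t x) * deriv (fun s => μ s x) t
        + entGapR ε (μ t x) (ρ t x) * deriv (fun s => ρ s x) t) t := by
  have h := (hasFDerivAt_entGap hε ((hμ.isDensity _ ht.le).pos x)
    ((hρ.isDensity _ ht.le).pos x)).comp_hasDerivAt t
    ((hμ.differentiableAt t ht x).hasDerivAt.prodMk (hρ.differentiableAt t ht x).hasDerivAt)
  simpa [Function.comp_def] using h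

theorem measurable_cutoff_comp (hv : Measurable v) : Measurable fun x => cutoff K (v x) :=
  measurable_cutoff.comp hv

theorem abs_cutoff_le_one (hK : 0 < K) {y : ℝ} (hy : 0 ≤ y) : |cutoff K y| ≤ 1 := by
  rw [abs_of_nonneg cutoff_nonneg]
  exact cutoff_le_one hK hy

theorem IsDensityCurve.aemeasurable_localized_dissipation (hρ : IsDensityCurve ρ)
    (hμ : IsDensityCurve μ) (hv : Measurable v) {s t : ℝ} (hs : 0 ≤ s) :
    AEMeasurable (fun τ => 3 / 4 * ∫ x, cutoff K (v x) *
      (entWeight ε (μ τ x) (ρ τ x) * (ρ τ x * ‖relScore (ρ τ) (μ τ) x‖ ^ 2)))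
      (volume.restrict (Ioc s t)) := by
  have h1 : StronglyMeasurable fun p : ℝ × EuclideanSpace ℝ (Fin d) => cutoff K (v p.2) *
      (entWeight ε (μ (max p.1 0) p.2) (ρ (max p.1 0) p.2) *
      (ρ (max p.1 0) p.2 * ‖relScore (ρ (max p.1 0)) (μ (max p.1 0)) p.2‖ ^ 2)) :=
    (((measurable_cutoff_comp hv).comp measurable_snd).mul
      (hρ.measurable_weighted_score hμ)).stronglyMeasurable
  refine ⟨_, (StronglyMeasurable.integral_prod_right (f := fun τ x => cutoff K (v x) *
    (entWeight ε (μ (max τ 0) x) (ρ (max τ 0) x) * (ρ (max τ 0) x *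
    ‖relScore (ρ (max τ 0)) (μ (max τ 0)) x‖ ^ 2))) h1
    (ν := volume)).measurable.const_mul (3 / 4), ?_⟩
  filter_upwards [ae_restrict_mem measurableSet_Ioc] with τ hτ
  rw [max_eq_left (hs.trans hτ.1.le)]

/-- The time-integrated form of `IsEvolutionPair.dissipation`, away from time `0`. That the bound
`b` is nonnegative is stated as well, because `ENNReal.ofReal b` loses this information. -/
theorem IsForcedFlowPair.localized_entropy_pos (h : IsForcedFlowPair π μ ρ u) (hε : 0 < ε)
    (hε1 : ε ≤ 1) (hK : 0 < K) (hv : IsSupersolutionLimit (densMeasure π) R v) {s t : ℝ}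
    (hs : 0 < s) (hst : s < t)
    (he : ∫⁻ τ in Ioc s t, ∫⁻ x, ‖u τ x‖ₑ ^ 2 ∂(densMeasure (ρ τ)) ≠ ∞) {b : ℝ}
    (hb : b = (1 + 3 / (ε * Real.log (1 + K))) *
        (∫⁻ τ in Ioc s t, ∫⁻ x, ‖u τ x‖ₑ ^ 2 ∂(densMeasure (ρ τ))).toReal
        + (6 * (entConst ε + 1) / Real.log (1 + K) * (t - s)
        + ((∫ x, cutoff K (v x) * entGap ε (μ t x) (ρ t x))
          - ∫ x, cutoff K (v x) * entGap ε (μ s x) (ρ s x)))) :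
    0 ≤ b ∧ ∫⁻ τ in Ioc s t, ENNReal.ofReal (3 / 4 * ∫ x, cutoff K (v x) *
        (entWeight ε (μ τ x) (ρ τ x) * (ρ τ x * ‖relScore (ρ τ) (μ τ) x‖ ^ 2))) ≤
      ENNReal.ofReal b := by
  have hμ := h.curve_left
  have hρ := h.curve_right
  have hlog := log_one_add_pos hK
  set c₁ := 1 + 3 / (ε * Real.log (1 + K)) with hc₁
  have hc₁0 : 0 ≤ c₁ := by positivity
  set c₂ := 6 * (entConst ε + 1) / Real.log (1 + K) with hc₂
  obtain ⟨hvm, hv0, hv1, -⟩ := id hv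
  have hθ := measurable_cutoff_comp (K := K) hvm
  have hθ1 : ∀ x, |cutoff K (v x)| ≤ 1 := fun x => abs_cutoff_le_one hK (hv0 x)
  have hθ0 : ∀ x ∉ Metric.closedBall (0 : EuclideanSpace ℝ (Fin d)) R, cutoff K (v x) = 0 :=
    fun x hx => by rw [hv1 x hx, cutoff_one hK]
  set m' : ℝ → ℝ := fun τ => ∫ x, cutoff K (v x) *
    (entGapL ε (μ τ x) (ρ τ x) * deriv (fun s => μ s x) τ
      + entGapR ε (μ τ x) (ρ τ x) * deriv (fun s => ρ s x) τ) with hm'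
  have hpos : Icc s t ⊆ Ioi 0 := fun τ hτ => hs.trans_le hτ.1
  have hm'c : ContinuousOn m' (Icc s t) :=
    (continuousOn_integral_mul_of_eqOn_compl hθ hθ1 hθ0
      (hμ.continuousOn_entGap_deriv hρ hε)).mono hpos
  have hm'i : IntegrableOn m' (Ioc s t) :=
    (hm'c.integrableOn_compact isCompact_Icc).mono_set Ioc_subset_Icc_self
  have hftc : ∫ τ in Ioc s t, m' τ = (∫ x, cutoff K (v x) * entGap ε (μ t x) (ρ t x))
      - ∫ x, cutoff K (v x) * entGap ε (μ s x) (ρ s x) := by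
    rw [← intervalIntegral.integral_of_le hst.le]
    refine intervalIntegral.integral_eq_sub_of_hasDerivAt
      (f := fun τ => ∫ x, cutoff K (v x) * entGap ε (μ τ x) (ρ τ x)) (fun τ hτ => ?_)
      ((intervalIntegrable_iff_integrableOn_Ioc_of_le hst.le).2 hm'i)
    rw [uIcc_of_le hst.le] at hτ
    exact hasDerivAt_integral_mul_of_eqOn_compl hθ hθ1 hθ0
      ((hμ.continuousOn_entGap hρ hε).mono (prod_mono Ioi_subset_Ici_self subset_rfl))
      (hμ.continuousOn_entGap_deriv hρ hε) (hμ.hasDerivAt_entGap hρ hε) (hpos hτ)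
  have hDm := hρ.aemeasurable_localized_dissipation hμ hvm hs.le (ε := ε) (K := K) (t := t)
  have hD0 : 0 ≤ᵐ[volume.restrict (Ioc s t)] fun τ => 3 / 4 * ∫ x, cutoff K (v x) *
      (entWeight ε (μ τ x) (ρ τ x) * (ρ τ x * ‖relScore (ρ τ) (μ τ) x‖ ^ 2)) := by
    filter_upwards [ae_restrict_mem measurableSet_Ioc] with τ hτ
    refine mul_nonneg (by norm_num) (integral_nonneg fun x => ?_)
    have := (hρ.isDensity τ (hs.trans hτ.1).le).pos x
    exact mul_nonneg cutoff_nonneg (mul_nonneg entWeight_nonneg (by positivity))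
  have hconst : ∫⁻ τ in Ioc s t, ENNReal.ofReal c₁ * ∫⁻ x, ‖u τ x‖ₑ ^ 2 ∂(densMeasure (ρ τ))
      = ENNReal.ofReal c₁ * ∫⁻ τ in Ioc s t, ∫⁻ x, ‖u τ x‖ₑ ^ 2 ∂(densMeasure (ρ τ)) :=
    lintegral_const_mul' _ _ ENNReal.ofReal_ne_top
  have hci : Integrable (fun _ => c₂) (volume.restrict (Ioc s t)) := integrable_const _
  have key := lintegral_ofReal_le_of_le_toReal_add hDm hD0
    (f := fun τ => c₂ + m' τ) (hci.add hm'i)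
    (e := fun τ => ENNReal.ofReal c₁ * ∫⁻ x, ‖u τ x‖ₑ ^ 2 ∂(densMeasure (ρ τ)))
    (by rw [hconst]; exact ENNReal.mul_ne_top ENNReal.ofReal_ne_top he) (by
      filter_upwards [ae_restrict_mem measurableSet_Ioc] with τ hτ
      have hτ0 := hs.trans hτ.1
      have hp := h.isEvolutionPair τ hτ0
      have h1 := hp.dissipation hε hε1 hK hv
      have h2 : ∫ x, ‖u τ x‖ ^ 2 ∂(densMeasure (ρ τ))
          = (∫⁻ x, ‖u τ x‖ₑ ^ 2 ∂(densMeasure (ρ τ))).toReal := by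
        refine (integral_eq_lintegral_of_nonneg_ae (Eventually.of_forall fun x => sq_nonneg _)
          (hp.memLp.1.norm.pow 2)).trans ?_
        congr 2 with x
        rw [ENNReal.ofReal_pow (norm_nonneg _), ofReal_norm]
      simp only [entGapL_div_div (hp.isDensity_target.pos _),
        entGapR_div_div (hp.isDensity_target.pos _),
        entWeight_div_div (hp.isDensity_target.pos _)] at h1
      rw [ENNReal.toReal_mul, ENNReal.toReal_ofReal hc₁0, ← h2]
      linarith)
  rw [hconst, ENNReal.toReal_mul, ENNReal.toReal_ofReal hc₁0,
    integral_add (f := fun _ => c₂) hci hm'i, hftc] at key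
  rw [hb]
  simpa [mul_comm c₂, hst.le] using key

/-- The initial time `0` is reached by the continuity of the localized entropy on `[0, ∞)`, although
the time derivatives exist for positive times only. -/
theorem IsForcedFlowPair.localized_entropy (h : IsForcedFlowPair π μ ρ u) (hε : 0 < ε)
    (hε1 : ε ≤ 1) (hK : 0 < K) (hv : IsSupersolutionLimit (densMeasure π) R v) {s t : ℝ}
    (hs : 0 ≤ s) (hst : s < t)
    (he : ∫⁻ τ in Ioc s t, ∫⁻ x, ‖u τ x‖ₑ ^ 2 ∂(densMeasure (ρ τ)) ≠ ∞) {b : ℝ}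
    (hb : b = (1 + 3 / (ε * Real.log (1 + K))) *
        (∫⁻ τ in Ioc s t, ∫⁻ x, ‖u τ x‖ₑ ^ 2 ∂(densMeasure (ρ τ))).toReal
        + (6 * (entConst ε + 1) / Real.log (1 + K) * (t - s)
        + ((∫ x, cutoff K (v x) * entGap ε (μ t x) (ρ t x))
          - ∫ x, cutoff K (v x) * entGap ε (μ s x) (ρ s x)))) :
    0 ≤ b ∧ ∫⁻ τ in Ioc s t, ENNReal.ofReal (3 / 4 * ∫ x, cutoff K (v x) *
        (entWeight ε (μ τ x) (ρ τ x) * (ρ τ x * ‖relScore (ρ τ) (μ τ) x‖ ^ 2))) ≤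
      ENNReal.ofReal b := by
  obtain ⟨hvm, hv0, hv1, -⟩ := id hv
  have hlog := log_one_add_pos hK
  have hm : ContinuousOn (fun τ => ∫ x, cutoff K (v x) * entGap ε (μ τ x) (ρ τ x)) (Ici 0) :=
    continuousOn_integral_mul_of_eqOn_compl (measurable_cutoff_comp (K := K) hvm)
      (fun x => abs_cutoff_le_one hK (hv0 x)) (fun x hx => by rw [hv1 x hx, cutoff_one hK])
      (h.curve_left.continuousOn_entGap h.curve_right hε)
  set A : ℝ → ℝ := fun s' => (1 + 3 / (ε * Real.log (1 + K))) *
        (∫⁻ τ in Ioc s t, ∫⁻ x, ‖u τ x‖ₑ ^ 2 ∂(densMeasure (ρ τ))).toReal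
        + (6 * (entConst ε + 1) / Real.log (1 + K) * (t - s')
        + ((∫ x, cutoff K (v x) * entGap ε (μ t x) (ρ t x))
          - ∫ x, cutoff K (v x) * entGap ε (μ s' x) (ρ s' x))) with hA
  have hlim : Tendsto A (𝓝[>] s) (𝓝 b) := by
    rw [hb]
    refine ContinuousWithinAt.tendsto (f := A) ?_
    have h1 : ContinuousWithinAt (fun τ => ∫ x, cutoff K (v x) * entGap ε (μ τ x) (ρ τ x))
      (Ioi s) s := (hm s hs).mono fun τ hτ => hs.trans (le_of_lt hτ)
    fun_prop
  have hstep : ∀ s' ∈ Ioo s t, 0 ≤ A s' ∧ ∫⁻ τ in Ioc s' t, ENNReal.ofReal (3 / 4 * ∫ x,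
      cutoff K (v x) * (entWeight ε (μ τ x) (ρ τ x) * (ρ τ x * ‖relScore (ρ τ) (μ τ) x‖ ^ 2))) ≤
      ENNReal.ofReal (A s') := by
    intro s' hs'
    have h1 : ∫⁻ τ in Ioc s' t, ∫⁻ x, ‖u τ x‖ₑ ^ 2 ∂(densMeasure (ρ τ)) ≤
        ∫⁻ τ in Ioc s t, ∫⁻ x, ‖u τ x‖ₑ ^ 2 ∂(densMeasure (ρ τ)) :=
      lintegral_mono_set (Ioc_subset_Ioc_left hs'.1.le)
    obtain ⟨h2, h3⟩ := h.localized_entropy_pos hε hε1 hK hv (hs.trans_lt hs'.1) hs'.2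
      (ne_top_of_le_ne_top he h1) rfl
    have h4 := mul_le_mul_of_nonneg_left (ENNReal.toReal_mono he h1)
      (show 0 ≤ 1 + 3 / (ε * Real.log (1 + K)) by positivity)
    have h5 := add_le_add_left h4 (6 * (entConst ε + 1) / Real.log (1 + K) * (t - s')
        + ((∫ x, cutoff K (v x) * entGap ε (μ t x) (ρ t x))
          - ∫ x, cutoff K (v x) * entGap ε (μ s' x) (ρ s' x)))
    exact ⟨h2.trans h5, h3.trans (ENNReal.ofReal_le_ofReal h5)⟩
  refine ⟨ge_of_tendsto hlim ?_, setLIntegral_Ioc_le_of_tendsto hst (fun s' hs' => (hstep s' hs').2)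
    (ENNReal.tendsto_ofReal hlim)⟩
  filter_upwards [Ioo_mem_nhdsGT hst] with s' hs'
  exact (hstep s' hs').1

end LocalizedEntropy

/-! ### Removal of the cutoff -/

section RegularizedEntropy

variable {d : ℕ} {π : EuclideanSpace ℝ (Fin d) → ℝ} {μ ρ : ℝ → EuclideanSpace ℝ (Fin d) → ℝ}
  {u : ℝ → EuclideanSpace ℝ (Fin d) → EuclideanSpace ℝ (Fin d)} {ε K : ℝ}

theorem IsDensityCurve.continuous_entGap (hμ : IsDensityCurve μ) (hρ : IsDensityCurve ρ)
    (hε : 0 < ε) {t : ℝ} (ht : 0 ≤ t) : Continuous fun x => entGap ε (μ t x) (ρ t x) :=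
  (hμ.continuousOn_entGap hρ hε).comp_continuous
    (f := fun x : EuclideanSpace ℝ (Fin d) => (t, x)) (by fun_prop) fun x => ⟨ht, mem_univ _⟩

theorem abs_entGap_le {m r : ℝ} (hε : 0 < ε) (hε1 : ε ≤ 1) (hm : 0 < m) (hr : 0 < r) :
    |entGap ε m r| ≤ (entConst ε + 1) * (m + r) := by
  rw [abs_of_nonneg ((add_pos hm hr).le.trans (add_le_entGap hε hε1 hm hr))]
  exact entGap_le hε hε1 hm hr

theorem tendsto_integral_cutoff_mul_entGap (hμ : IsDensityCurve μ) (hρ : IsDensityCurve ρ)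
    (hε : 0 < ε) (hε1 : ε ≤ 1) (hK : 0 < K) {v : ℕ → EuclideanSpace ℝ (Fin d) → ℝ}
    (hvm : ∀ n, Measurable (v n)) (hv0 : ∀ n x, 0 ≤ v n x)
    (hv : ∀ᵐ x, Tendsto (fun n => cutoff K (v n x)) atTop (𝓝 1)) {t : ℝ} (ht : 0 ≤ t) :
    Tendsto (fun n => ∫ x, cutoff K (v n x) * entGap ε (μ t x) (ρ t x)) atTop
      (𝓝 (∫ x, entGap ε (μ t x) (ρ t x))) := by
  have hc := hμ.continuous_entGap hρ hε ht
  refine tendsto_integral_of_dominated_convergence (fun x => (entConst ε + 1) * (μ t x + ρ t x))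
    (fun n => ((measurable_cutoff_comp (hvm n)).mul hc.measurable).aestronglyMeasurable)
    (((hμ.isDensity t ht).integrable.add (hρ.isDensity t ht).integrable).const_mul _)
    (fun n => Eventually.of_forall fun x => ?_) ?_
  · rw [norm_mul]
    exact (mul_le_of_le_one_left (norm_nonneg _) (abs_cutoff_le_one hK (hv0 n x))).trans
      (abs_entGap_le hε hε1 ((hμ.isDensity t ht).pos x) ((hρ.isDensity t ht).pos x))
  · filter_upwards [hv] with x hx
    simpa using hx.mul_const (entGap ε (μ t x) (ρ t x))

theorem IsForcedFlowPair.continuous_weighted_score (h : IsForcedFlowPair π μ ρ u) (hε : 0 < ε)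
    {t : ℝ} (ht : 0 < t) : Continuous fun x =>
      entWeight ε (μ t x) (ρ t x) * (ρ t x * ‖relScore (ρ t) (μ t) x‖ ^ 2) := by
  have hp := h.isEvolutionPair t ht
  have h1 := continuous_entWeight_div hp.isDensity_target hp.isDensity_left hp.isDensity_right hε
  simp only [entWeight_div_div (hp.isDensity_target.pos _)] at h1
  exact h1.mul (hp.isDensity_right.contDiff.continuous.mul
    ((hp.isDensity_right.continuous_relScore hp.isDensity_left).norm.pow 2))

/-- Removal of the spatial cutoff, by Fatou's lemma for the dissipation and by dominated convergence
for the regularized entropy. -/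
theorem IsForcedFlowPair.entropy_cutoff (h : IsForcedFlowPair π μ ρ u) (hπ : IsDensity π)
    (hε : 0 < ε) (hε1 : ε ≤ 1) (hK : 0 < K) {s t : ℝ} (hs : 0 ≤ s) (hst : s < t)
    (he : ∫⁻ τ in Ioc s t, ∫⁻ x, ‖u τ x‖ₑ ^ 2 ∂(densMeasure (ρ τ)) ≠ ∞) {b : ℝ}
    (hb : b = (1 + 3 / (ε * Real.log (1 + K))) *
        (∫⁻ τ in Ioc s t, ∫⁻ x, ‖u τ x‖ₑ ^ 2 ∂(densMeasure (ρ τ))).toReal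
        + (6 * (entConst ε + 1) / Real.log (1 + K) * (t - s)
        + ((∫ x, entGap ε (μ t x) (ρ t x)) - ∫ x, entGap ε (μ s x) (ρ s x)))) :
    0 ≤ b ∧ ∫⁻ τ in Ioc s t, ∫⁻ x, ENNReal.ofReal (3 / 4 *
        (entWeight ε (μ τ x) (ρ τ x) * (ρ τ x * ‖relScore (ρ τ) (μ τ) x‖ ^ 2))) ≤
      ENNReal.ofReal b := by
  have hμ := h.curve_left
  have hρ := h.curve_right
  have := hπ.isProbabilityMeasure
  obtain ⟨R, v, hv, hv0⟩ := exists_seq_isSupersolutionLimit (densMeasure π)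
  have hθ : ∀ᵐ x, Tendsto (fun n => cutoff K (v n x)) atTop (𝓝 1) := by
    filter_upwards [hπ.volume_absolutelyContinuous.ae_le hv0] with x hx
    rw [← cutoff_zero (K := K)]
    exact (hasDerivAt_cutoff hK le_rfl).continuousAt.tendsto.comp hx
  have hlim := fun τ (hτ : 0 ≤ τ) => tendsto_integral_cutoff_mul_entGap hμ hρ hε hε1 hK
    (fun n => (hv n).1) (fun n => (hv n).2.1) hθ hτ
  have hstep := fun n => h.localized_entropy hε hε1 hK (hv n) hs hst he rfl
  have hlim' := ((((hlim t (hs.trans hst.le)).sub (hlim s hs)).const_add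
    (6 * (entConst ε + 1) / Real.log (1 + K) * (t - s))).const_add
    ((1 + 3 / (ε * Real.log (1 + K))) *
        (∫⁻ τ in Ioc s t, ∫⁻ x, ‖u τ x‖ₑ ^ 2 ∂(densMeasure (ρ τ))).toReal))
  rw [← hb] at hlim'
  refine ⟨ge_of_tendsto' hlim' fun n => (hstep n).1, ?_⟩
  calc _ ≤ ∫⁻ τ in Ioc s t, liminf (fun n => ENNReal.ofReal (3 / 4 * ∫ x, cutoff K (v n x) *
        (entWeight ε (μ τ x) (ρ τ x) * (ρ τ x * ‖relScore (ρ τ) (μ τ) x‖ ^ 2)))) atTop := by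
        refine setLIntegral_mono' measurableSet_Ioc fun τ hτ => ?_
        have hτ0 := hs.trans_lt hτ.1
        have hc := h.continuous_weighted_score hε hτ0
        have hq : ∀ x, 0 ≤ entWeight ε (μ τ x) (ρ τ x) *
            (ρ τ x * ‖relScore (ρ τ) (μ τ) x‖ ^ 2) := fun x =>
          mul_nonneg entWeight_nonneg
            (mul_nonneg ((hρ.isDensity τ hτ0.le).pos x).le (sq_nonneg _))
        have h1 : ∀ n, ENNReal.ofReal (3 / 4 * ∫ x, cutoff K (v n x) *
            (entWeight ε (μ τ x) (ρ τ x) * (ρ τ x * ‖relScore (ρ τ) (μ τ) x‖ ^ 2)))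
            = ∫⁻ x, ENNReal.ofReal (3 / 4 * (cutoff K (v n x) *
            (entWeight ε (μ τ x) (ρ τ x) * (ρ τ x * ‖relScore (ρ τ) (μ τ) x‖ ^ 2)))) := by
          intro n
          have hi := (integrable_mul_of_eqOn_compl (R := R n) (measurable_cutoff_comp (K := K)
            (hv n).1) (fun x => abs_cutoff_le_one hK ((hv n).2.1 x))
            (fun x hx => by rw [(hv n).2.2.1 x hx, cutoff_one hK]) hc).const_mul (3 / 4)
          rw [← integral_const_mul, ofReal_integral_eq_lintegral_ofReal hi
            (Eventually.of_forall fun x => mul_nonneg (by norm_num)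
              (mul_nonneg cutoff_nonneg (hq x)))]
        simp_rw [h1]
        refine le_trans (lintegral_mono_ae ?_) (lintegral_liminf_le fun n =>
          (((measurable_cutoff_comp (hv n).1).mul hc.measurable).const_mul (3 / 4)).ennreal_ofReal)
        filter_upwards [hθ] with x hx
        have h2 := ENNReal.tendsto_ofReal ((hx.mul_const (entWeight ε (μ τ x) (ρ τ x) *
            (ρ τ x * ‖relScore (ρ τ) (μ τ) x‖ ^ 2))).const_mul (3 / 4))
        rw [one_mul] at h2
        exact h2.liminf_eq.ge
    _ ≤ liminf (fun n => ∫⁻ τ in Ioc s t, ENNReal.ofReal (3 / 4 * ∫ x, cutoff K (v n x) *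
        (entWeight ε (μ τ x) (ρ τ x) * (ρ τ x * ‖relScore (ρ τ) (μ τ) x‖ ^ 2)))) atTop :=
        lintegral_liminf_le' fun n =>
          (hρ.aemeasurable_localized_dissipation hμ (hv n).1 hs).ennreal_ofReal
    _ ≤ _ := (liminf_le_liminf (Eventually.of_forall fun n => (hstep n).2)).trans
        (ENNReal.tendsto_ofReal hlim').liminf_eq.le

/-- The errors of the localization vanish in the limit `K → ∞`. -/
theorem IsForcedFlowPair.entropy_entGap (h : IsForcedFlowPair π μ ρ u) (hπ : IsDensity π)
    (hε : 0 < ε) (hε1 : ε ≤ 1) {s t : ℝ} (hs : 0 ≤ s) (hst : s < t)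
    (he : ∫⁻ τ in Ioc s t, ∫⁻ x, ‖u τ x‖ₑ ^ 2 ∂(densMeasure (ρ τ)) ≠ ∞) {b : ℝ}
    (hb : b = (∫⁻ τ in Ioc s t, ∫⁻ x, ‖u τ x‖ₑ ^ 2 ∂(densMeasure (ρ τ))).toReal
        + ((∫ x, entGap ε (μ t x) (ρ t x)) - ∫ x, entGap ε (μ s x) (ρ s x))) :
    0 ≤ b ∧ ∫⁻ τ in Ioc s t, ∫⁻ x, ENNReal.ofReal (3 / 4 *
        (entWeight ε (μ τ x) (ρ τ x) * (ρ τ x * ‖relScore (ρ τ) (μ τ) x‖ ^ 2))) ≤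
      ENNReal.ofReal b := by
  have hlog : Tendsto (fun K : ℝ => Real.log (1 + K)) atTop atTop :=
    Real.tendsto_log_atTop.comp (tendsto_atTop_add_const_left _ _ tendsto_id)
  have hlim := (((tendsto_const_nhds (x := (3 : ℝ))).div_atTop
    (hlog.const_mul_atTop hε)).const_add 1).mul_const
      (∫⁻ τ in Ioc s t, ∫⁻ x, ‖u τ x‖ₑ ^ 2 ∂(densMeasure (ρ τ))).toReal
  have hlim2 := (((tendsto_const_nhds (x := 6 * (entConst ε + 1))).div_atTop hlog).mul_const
    (t - s)).add_const ((∫ x, entGap ε (μ t x) (ρ t x)) - ∫ x, entGap ε (μ s x) (ρ s x))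
  have hlim3 := hlim.add hlim2
  rw [add_zero, one_mul, zero_mul, zero_add, ← hb] at hlim3
  have hstep := fun K (hK : 0 < K) => h.entropy_cutoff hπ hε hε1 hK hs hst he rfl
  exact ⟨ge_of_tendsto hlim3 ((eventually_gt_atTop 0).mono fun K hK => (hstep K hK).1),
    ge_of_tendsto (ENNReal.tendsto_ofReal hlim3)
      ((eventually_gt_atTop 0).mono fun K hK => (hstep K hK).2)⟩

end RegularizedEntropy

/-! ### Removal of the regularization: entropy dissipation -/

section EntropyDissipation

variable {d : ℕ} {π : EuclideanSpace ℝ (Fin d) → ℝ} {μ ρ : ℝ → EuclideanSpace ℝ (Fin d) → ℝ}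
  {u : ℝ → EuclideanSpace ℝ (Fin d) → EuclideanSpace ℝ (Fin d)} {ε : ℝ}

theorem ENNReal.liminf_add_liminf_le (f g : ℕ → ℝ≥0∞) :
    liminf f atTop + liminf g atTop ≤ liminf (fun n => f n + g n) atTop := by
  have hm : ∀ f : ℕ → ℝ≥0∞, Monotone fun n => ⨅ i ≥ n, f i := fun f i j hij =>
    le_iInf₂ fun k hk => iInf₂_le k (hij.trans hk)
  simp_rw [liminf_eq_iSup_iInf_of_nat]
  rw [ENNReal.iSup_add_iSup_of_monotone (hm f) (hm g)]
  exact iSup_mono fun n => le_iInf₂ fun k hk => add_le_add (iInf₂_le k hk) (iInf₂_le k hk)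

/-- The regularized entropy density, made nonnegative by terms whose integral does not depend on the
time. For `ε = 0` it is the density of the relative entropy. -/
noncomputable def entReg (ε m r : ℝ) : ℝ := r * Real.log (r / (m + ε * r)) + m - r + ε * r

theorem entReg_eq (ε m r : ℝ) :
    entReg ε m r = ((entConst ε + 1) * m + (entConst ε - 1 + ε) * r) - entGap ε m r := by
  rw [entReg, entGap]
  ring

theorem entReg_nonneg {m r : ℝ} (hε : 0 < ε) (hm : 0 < m) (hr : 0 < r) : 0 ≤ entReg ε m r := by
  have := neg_mul_log_div_le hε hm hr
  rw [entReg]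
  linarith

theorem entReg_zero {m : ℝ} (r : ℝ) (hm : 0 < m) :
    entReg 0 m r = m * InformationTheory.klFun (r / m) := by
  rw [entReg, InformationTheory.klFun]
  field_simp
  ring_nf

theorem entReg_le {m r : ℝ} (hε : 0 ≤ ε) (hm : 0 < m) (hr : 0 < r) :
    entReg ε m r ≤ m * InformationTheory.klFun (r / m) + ε * r := by
  rw [← entReg_zero r hm, entReg, entReg]
  have : Real.log (r / (m + ε * r)) ≤ Real.log (r / (m + 0 * r)) := by
    refine Real.log_le_log (by positivity) (div_le_div_of_nonneg_left hr.le (by simpa) ?_)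
    nlinarith
  nlinarith

theorem tendsto_entReg {m r : ℝ} (hm : 0 < m) (hr : 0 < r) :
    Tendsto (fun ε => entReg ε m r) (𝓝 0) (𝓝 (m * InformationTheory.klFun (r / m))) := by
  rw [← entReg_zero r hm]
  have h : ContinuousAt (fun ε => entReg ε m r) 0 := by
    unfold entReg
    have h0 : m + 0 * r ≠ 0 := by simpa using hm.ne'
    have h1 : r / (m + 0 * r) ≠ 0 := div_ne_zero hr.ne' h0
    fun_prop (disch := assumption)
  exact h

theorem tendsto_entWeight {m : ℝ} (r : ℝ) (hm : 0 < m) :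
    Tendsto (fun ε => entWeight ε m r) (𝓝 0) (𝓝 1) := by
  have h : ContinuousAt (fun ε => entWeight ε m r) 0 := by
    unfold entWeight
    have h0 : m + 0 * r ≠ 0 := by simpa using hm.ne'
    fun_prop (disch := assumption)
  have h1 : entWeight 0 m r = 1 := by simp [entWeight, hm.ne']
  rw [← h1]
  exact h

theorem IsDensity.KL_eq {f g : EuclideanSpace ℝ (Fin d) → ℝ} (hf : IsDensity f)
    (hg : IsDensity g) :
    KL f g = ∫⁻ x, ENNReal.ofReal (g x * InformationTheory.klFun (f x / g x)) := by
  have := hf.isProbabilityMeasure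
  have := hg.isProbabilityMeasure
  have hq : Measurable fun x => ENNReal.ofReal (f x / g x) :=
    (hf.measurable.div hg.measurable).ennreal_ofReal
  have h1 : densMeasure f = (densMeasure g).withDensity fun x => ENNReal.ofReal (f x / g x) := by
    rw [densMeasure, densMeasure, ← withDensity_mul _ hg.measurable.ennreal_ofReal hq]
    congr 1 with x
    rw [Pi.mul_apply, ← ENNReal.ofReal_mul (hg.pos x).le, mul_div_cancel₀ _ (hg.pos x).ne']
  have h2 : (densMeasure f).rnDeriv (densMeasure g) =ᵐ[densMeasure g]
      fun x => ENNReal.ofReal (f x / g x) := by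
    rw [h1]
    exact Measure.rnDeriv_withDensity _ hq
  have h3 : densMeasure f ≪ densMeasure g := by
    rw [h1]
    exact withDensity_absolutelyContinuous _ _
  have h4 : Measurable fun x => ENNReal.ofReal (InformationTheory.klFun (f x / g x)) :=
    (InformationTheory.measurable_klFun.comp (hf.measurable.div hg.measurable)).ennreal_ofReal
  calc KL f g = ∫⁻ x, ENNReal.ofReal (InformationTheory.klFun (f x / g x)) ∂(densMeasure g) := by
        rw [KL, InformationTheory.klDiv_eq_lintegral_klFun_of_ac h3]
        refine lintegral_congr_ae (h2.mono fun x hx => ?_)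
        simp only [hx]
        rw [ENNReal.toReal_ofReal (div_pos (hf.pos x) (hg.pos x)).le]
    _ = _ := by
        rw [densMeasure, lintegral_withDensity_eq_lintegral_mul _ hg.measurable.ennreal_ofReal h4]
        refine lintegral_congr fun x => ?_
        rw [Pi.mul_apply, ← ENNReal.ofReal_mul (hg.pos x).le]

theorem IsDensity.fisherInfo_eq {f g : EuclideanSpace ℝ (Fin d) → ℝ} (hf : IsDensity f)
    (hg : IsDensity g) : fisherInfo f g = ∫⁻ x, ENNReal.ofReal (f x * ‖relScore f g x‖ ^ 2) := by
  rw [fisherInfo, densMeasure, lintegral_withDensity_eq_lintegral_mul _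
    hf.measurable.ennreal_ofReal ((hf.continuous_relScore hg).measurable.enorm.pow_const 2)]
  refine lintegral_congr fun x => ?_
  rw [Pi.mul_apply, ENNReal.ofReal_mul (hf.pos x).le, ENNReal.ofReal_pow (norm_nonneg _),
    ofReal_norm]

theorem IsDensityCurve.aemeasurable_KL (hρ : IsDensityCurve ρ) (hμ : IsDensityCurve μ) {s t : ℝ}
    (hs : 0 ≤ s) : AEMeasurable (fun τ => KL (ρ τ) (μ τ)) (volume.restrict (Ioc s t)) := by
  have h1 : Measurable fun p : ℝ × EuclideanSpace ℝ (Fin d) => ENNReal.ofReal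
      (μ (max p.1 0) p.2 * InformationTheory.klFun (ρ (max p.1 0) p.2 / μ (max p.1 0) p.2)) :=
    (hμ.continuous_max.measurable.mul (InformationTheory.measurable_klFun.comp
      (hρ.continuous_max.measurable.div hμ.continuous_max.measurable))).ennreal_ofReal
  refine ⟨_, h1.lintegral_prod_right' (ν := volume), ?_⟩
  filter_upwards [ae_restrict_mem measurableSet_Ioc] with τ hτ
  have hτ0 := hs.trans hτ.1.le
  simp only [max_eq_left hτ0]
  exact (hρ.isDensity τ hτ0).KL_eq (hμ.isDensity τ hτ0)

theorem IsDensity.integrable_entGap {f g : EuclideanSpace ℝ (Fin d) → ℝ} (hf : IsDensity f)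
    (hg : IsDensity g) (hε : 0 < ε) (hε1 : ε ≤ 1) : Integrable fun x => entGap ε (g x) (f x) := by
  have hm : Measurable fun x => entGap ε (g x) (f x) := by
    have h1 := hf.measurable
    have h2 := hg.measurable
    exact ((h2.add h1).const_mul _).sub (h1.mul (h1.div (h2.add (h1.const_mul ε))).log)
  exact ((hg.integrable.add hf.integrable).const_mul (entConst ε + 1)).mono' hm.aestronglyMeasurable
    (Eventually.of_forall fun x => abs_entGap_le hε hε1 (hg.pos x) (hf.pos x))

theorem IsDensity.integrable_entReg {f g : EuclideanSpace ℝ (Fin d) → ℝ} (hf : IsDensity f)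
    (hg : IsDensity g) (hε : 0 < ε) (hε1 : ε ≤ 1) : Integrable fun x => entReg ε (g x) (f x) := by
  simp_rw [entReg_eq]
  exact ((hg.integrable.const_mul _).add (hf.integrable.const_mul _)).sub
    (hf.integrable_entGap hg hε hε1)

theorem IsDensity.integral_entGap {f g : EuclideanSpace ℝ (Fin d) → ℝ} (hf : IsDensity f)
    (hg : IsDensity g) (hε : 0 < ε) (hε1 : ε ≤ 1) :
    ∫ x, entGap ε (g x) (f x) = 2 * entConst ε + ε - ∫ x, entReg ε (g x) (f x) := by
  simp_rw [entReg_eq]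
  rw [integral_sub (f := fun x => (entConst ε + 1) * g x + (entConst ε - 1 + ε) * f x)
    ((hg.integrable.const_mul _).add (hf.integrable.const_mul _))
    (hf.integrable_entGap hg hε hε1), integral_add (hg.integrable.const_mul _)
    (hf.integrable.const_mul _), integral_const_mul, integral_const_mul, hf.integral_eq_one,
    hg.integral_eq_one]
  ring

theorem IsDensity.lintegral_entReg_le {f g : EuclideanSpace ℝ (Fin d) → ℝ} (hf : IsDensity f)
    (hg : IsDensity g) (hε : 0 ≤ ε) :
    ∫⁻ x, ENNReal.ofReal (entReg ε (g x) (f x)) ≤ KL f g + ENNReal.ofReal ε := by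
  have h1 : ∫⁻ x, ENNReal.ofReal (ε * f x) = ENNReal.ofReal ε := by
    rw [← ofReal_integral_eq_lintegral_ofReal (hf.integrable.const_mul ε)
      (Eventually.of_forall fun x => mul_nonneg hε (hf.pos x).le), integral_const_mul,
      hf.integral_eq_one, mul_one]
  rw [hf.KL_eq hg, ← h1, ← lintegral_add_right _ (hf.measurable.const_mul ε).ennreal_ofReal]
  exact lintegral_mono fun x => (ENNReal.ofReal_le_ofReal
    (entReg_le hε (hg.pos x) (hf.pos x))).trans ENNReal.ofReal_add_le

/-- As the total masses of `μ` and `ρ` are constant, the integral of `entGap` is a constant minus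
the regularized entropy. -/
theorem IsForcedFlowPair.entropy_entReg (h : IsForcedFlowPair π μ ρ u) (hπ : IsDensity π)
    (hε : 0 < ε) (hε1 : ε ≤ 1) {s t : ℝ} (hs : 0 ≤ s) (hst : s < t)
    (he : ∫⁻ τ in Ioc s t, ∫⁻ x, ‖u τ x‖ₑ ^ 2 ∂(densMeasure (ρ τ)) ≠ ∞) :
    (∫⁻ x, ENNReal.ofReal (entReg ε (μ t x) (ρ t x)))
      + ∫⁻ τ in Ioc s t, ∫⁻ x, ENNReal.ofReal (3 / 4 *
        (entWeight ε (μ τ x) (ρ τ x) * (ρ τ x * ‖relScore (ρ τ) (μ τ) x‖ ^ 2))) ≤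
      (∫⁻ x, ENNReal.ofReal (entReg ε (μ s x) (ρ s x)))
        + ∫⁻ τ in Ioc s t, ∫⁻ x, ‖u τ x‖ₑ ^ 2 ∂(densMeasure (ρ τ)) := by
  obtain ⟨h1, h2⟩ := h.entropy_entGap hπ hε hε1 hs hst he rfl
  have hμ := h.curve_left.isDensity
  have hρ := h.curve_right.isDensity
  have ht := hs.trans hst.le
  have h3 : ∀ τ, 0 ≤ τ → 0 ≤ ∫ x, entReg ε (μ τ x) (ρ τ x) ∧
      ∫⁻ x, ENNReal.ofReal (entReg ε (μ τ x) (ρ τ x))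
        = ENNReal.ofReal (∫ x, entReg ε (μ τ x) (ρ τ x)) := fun τ hτ => by
    have h4 : ∀ x, 0 ≤ entReg ε (μ τ x) (ρ τ x) := fun x =>
      entReg_nonneg hε ((hμ τ hτ).pos x) ((hρ τ hτ).pos x)
    exact ⟨integral_nonneg h4, (ofReal_integral_eq_lintegral_ofReal
      ((hρ τ hτ).integrable_entReg (hμ τ hτ) hε hε1) (Eventually.of_forall h4)).symm⟩
  rw [(hρ t ht).integral_entGap (hμ t ht) hε hε1, (hρ s hs).integral_entGap (hμ s hs) hε hε1]
    at h1 h2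
  rw [(h3 t ht).2, (h3 s hs).2]
  refine (add_le_add_right h2 _).trans ?_
  nth_rw 2 [← ENNReal.ofReal_toReal he]
  rw [← ENNReal.ofReal_add (h3 t ht).1 h1, ← ENNReal.ofReal_add (h3 s hs).1 ENNReal.toReal_nonneg]
  exact ENNReal.ofReal_le_ofReal (by linarith)

/-- The entropy dissipation inequality, obtained in the limit `ε → 0`. -/
theorem IsForcedFlowPair.entropy_dissipation (h : IsForcedFlowPair π μ ρ u) (hπ : IsDensity π)
    {s t : ℝ} (hs : 0 ≤ s) (hst : s < t) :
    KL (ρ t) (μ t) + ENNReal.ofReal (3 / 4) * ∫⁻ τ in Ioc s t, fisherInfo (ρ τ) (μ τ) ≤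
      KL (ρ s) (μ s) + ∫⁻ τ in Ioc s t, ∫⁻ x, ‖u τ x‖ₑ ^ 2 ∂(densMeasure (ρ τ)) := by
  by_cases he : ∫⁻ τ in Ioc s t, ∫⁻ x, ‖u τ x‖ₑ ^ 2 ∂(densMeasure (ρ τ)) = ∞
  · rw [he, add_top]
    exact le_top
  have hμ := h.curve_left
  have hρ := h.curve_right
  have ht := hs.trans hst.le
  set e : ℕ → ℝ := fun k => 1 / ((k : ℝ) + 1) with hedef
  have he0 : ∀ k, 0 < e k := fun k => by positivity
  have he1 : ∀ k, e k ≤ 1 := fun k => by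
    rw [hedef, div_le_one (by positivity)]
    linarith [(Nat.cast_nonneg k : (0 : ℝ) ≤ k)]
  have helim : Tendsto e atTop (𝓝 0) := tendsto_one_div_add_atTop_nhds_zero_nat
  have h1 : KL (ρ t) (μ t) ≤
      liminf (fun k => ∫⁻ x, ENNReal.ofReal (entReg (e k) (μ t x) (ρ t x))) atTop := by
    rw [(hρ.isDensity t ht).KL_eq (hμ.isDensity t ht)]
    refine le_trans (lintegral_mono fun x => ?_) (lintegral_liminf_le' fun k =>
      ((hρ.isDensity t ht).integrable_entReg (hμ.isDensity t ht) (he0 k)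
        (he1 k)).aestronglyMeasurable.aemeasurable.ennreal_ofReal)
    exact (ENNReal.tendsto_ofReal ((tendsto_entReg ((hμ.isDensity t ht).pos x)
      ((hρ.isDensity t ht).pos x)).comp helim)).liminf_eq.ge
  have h2 : ENNReal.ofReal (3 / 4) * ∫⁻ τ in Ioc s t, fisherInfo (ρ τ) (μ τ) ≤
      liminf (fun k => ∫⁻ τ in Ioc s t, ∫⁻ x, ENNReal.ofReal (3 / 4 *
        (entWeight (e k) (μ τ x) (ρ τ x) * (ρ τ x * ‖relScore (ρ τ) (μ τ) x‖ ^ 2)))) atTop := by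
    rw [← lintegral_const_mul' _ _ ENNReal.ofReal_ne_top]
    refine le_trans (setLIntegral_mono' measurableSet_Ioc fun τ hτ => ?_)
      (lintegral_liminf_le' fun k => ?_)
    · have hτ0 := hs.trans_lt hτ.1
      rw [(hρ.isDensity τ hτ0.le).fisherInfo_eq (hμ.isDensity τ hτ0.le),
        ← lintegral_const_mul' _ _ ENNReal.ofReal_ne_top]
      refine le_trans (lintegral_mono fun x => ?_) (lintegral_liminf_le fun k =>
        ((h.continuous_weighted_score (he0 k) hτ0).measurable.const_mul (3 / 4)).ennreal_ofReal)
      have h3 := ENNReal.tendsto_ofReal ((((tendsto_entWeight (ρ τ x)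
        ((hμ.isDensity τ hτ0.le).pos x)).comp helim).mul_const
        (ρ τ x * ‖relScore (ρ τ) (μ τ) x‖ ^ 2)).const_mul (3 / 4))
      rw [one_mul, ENNReal.ofReal_mul (by norm_num)] at h3
      exact h3.liminf_eq.ge
    · refine ⟨_, (((hρ.measurable_weighted_score hμ (ε := e k)).const_mul
        (3 / 4)).ennreal_ofReal).lintegral_prod_right' (ν := volume), ?_⟩
      filter_upwards [ae_restrict_mem measurableSet_Ioc] with τ hτ
      simp only [max_eq_left (hs.trans hτ.1.le)]
  have h3 : Tendsto (fun k => KL (ρ s) (μ s) + ENNReal.ofReal (e k)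
      + ∫⁻ τ in Ioc s t, ∫⁻ x, ‖u τ x‖ₑ ^ 2 ∂(densMeasure (ρ τ))) atTop
      (𝓝 (KL (ρ s) (μ s) + ∫⁻ τ in Ioc s t, ∫⁻ x, ‖u τ x‖ₑ ^ 2 ∂(densMeasure (ρ τ)))) := by
    have h4 := ((ENNReal.tendsto_ofReal helim).const_add (KL (ρ s) (μ s))).add_const
      (∫⁻ τ in Ioc s t, ∫⁻ x, ‖u τ x‖ₑ ^ 2 ∂(densMeasure (ρ τ)))
    simpa using h4
  refine (add_le_add h1 h2).trans (le_trans ?_ h3.liminf_eq.le)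
  refine le_trans (ENNReal.liminf_add_liminf_le _ _) (liminf_le_liminf (Eventually.of_forall fun k => ?_))
  exact (h.entropy_entReg hπ (he0 k) (he1 k) hs hst he).trans (add_le_add_left
    ((hρ.isDensity s hs).lintegral_entReg_le (hμ.isDensity s hs) (he0 k).le) _)

end EntropyDissipation

/-! ### Gronwall's inequality for functions with values in `[0, ∞]` -/

section Gronwall

theorem lintegral_Ioc_ofReal_exp (a : ℝ) (ha : 0 < a) {t : ℝ} (ht : 0 ≤ t) :
    ∫⁻ τ in Ioc 0 t, ENNReal.ofReal (a * Real.exp (a * τ))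
      = ENNReal.ofReal (Real.exp (a * t) - 1) := by
  have hc : Continuous fun τ => a * Real.exp (a * τ) := by fun_prop
  have h : ∀ τ, HasDerivAt (fun τ => Real.exp (a * τ)) (a * Real.exp (a * τ)) τ := fun τ => by
    simpa [mul_comm] using ((hasDerivAt_id τ).const_mul a).exp
  rw [← ofReal_integral_eq_lintegral_ofReal
    ((hc.continuousOn.integrableOn_compact isCompact_Icc).mono_set Ioc_subset_Icc_self)
    (Eventually.of_forall fun τ => by positivity), ← intervalIntegral.integral_of_le ht,
    intervalIntegral.integral_eq_sub_of_hasDerivAt (fun τ _ => h τ) (hc.intervalIntegrable _ _)]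
  simp

/-- Tonelli's theorem on the triangle `0 < s < τ ≤ t` with the weight `a e^{as}`. -/
theorem lintegral_exp_mul_lintegral_Ioc {a t : ℝ} (ha : 0 < a) {g : ℝ → ℝ≥0∞}
    (hg : Measurable g) :
    (∫⁻ s in Ioc 0 t, ENNReal.ofReal (a * Real.exp (a * s)) * ∫⁻ τ in Ioc s t, g τ)
        + ∫⁻ τ in Ioc 0 t, g τ
      = ∫⁻ τ in Ioc 0 t, ENNReal.ofReal (Real.exp (a * τ)) * g τ := by
  set w : ℝ → ℝ≥0∞ := fun s => ENNReal.ofReal (a * Real.exp (a * s)) with hw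
  have hwm : Measurable w := by fun_prop
  have h1 : ∫⁻ s in Ioc 0 t, w s * ∫⁻ τ in Ioc s t, g τ
      = ∫⁻ s in Ioc 0 t, ∫⁻ τ in Ioc 0 t,
        {p : ℝ × ℝ | p.1 < p.2}.indicator (fun p => w p.1 * g p.2) (s, τ) := by
    refine setLIntegral_congr_fun measurableSet_Ioc fun s hs => ?_
    have h2 : ∀ τ, {p : ℝ × ℝ | p.1 < p.2}.indicator (fun p => w p.1 * g p.2) (s, τ)
        = (Ioi s).indicator (fun τ => w s * g τ) τ := fun τ => by simp [indicator]
    simp_rw [h2]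
    rw [lintegral_indicator measurableSet_Ioi, Measure.restrict_restrict measurableSet_Ioi,
      lintegral_const_mul _ hg]
    congr 3
    ext τ
    simp only [mem_inter_iff, mem_Ioi, mem_Ioc]
    exact ⟨fun h => ⟨h.1, hs.1.trans h.1, h.2⟩, fun h => ⟨h.1, h.2.2⟩⟩
  have hm : Measurable (Function.uncurry fun s τ : ℝ =>
      {p : ℝ × ℝ | p.1 < p.2}.indicator (fun p => w p.1 * g p.2) (s, τ)) :=
    ((hwm.comp measurable_fst).mul (hg.comp measurable_snd)).indicator
      (measurableSet_lt measurable_fst measurable_snd)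
  rw [h1, lintegral_lintegral_swap hm.aemeasurable, ← lintegral_add_right _ hg]
  refine setLIntegral_congr_fun measurableSet_Ioc fun τ hτ => ?_
  have h2 : ∀ s, {p : ℝ × ℝ | p.1 < p.2}.indicator (fun p => w p.1 * g p.2) (s, τ)
      = (Iio τ).indicator (fun s => w s * g τ) s := fun s => by simp [indicator]
  have h3 : Iio τ ∩ Ioc 0 t = Ioo 0 τ := by
    ext s
    simp only [mem_inter_iff, mem_Iio, mem_Ioc, mem_Ioo]
    exact ⟨fun h => ⟨h.2.1, h.1⟩, fun h => ⟨h.2, h.1, h.2.le.trans hτ.2⟩⟩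
  simp_rw [h2]
  rw [lintegral_indicator measurableSet_Iio, Measure.restrict_restrict measurableSet_Iio, h3,
    lintegral_mul_const _ hwm, Measure.restrict_congr_set Ioo_ae_eq_Ioc,
    lintegral_Ioc_ofReal_exp a ha hτ.1.le]
  nth_rw 2 [← one_mul (g τ)]
  rw [← add_mul, ← ENNReal.ofReal_one, ← ENNReal.ofReal_add _ zero_le_one, sub_add_cancel]
  rw [sub_nonneg]
  exact Real.one_le_exp (mul_nonneg ha.le hτ.1.le)

/-- A function has a measurable minorant with the same integrals over the intervals `(s, t]`. -/
theorem exists_measurable_le_setLIntegral_Ioc_le {t : ℝ} {R : ℝ → ℝ≥0∞}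
    (hR : ∫⁻ τ in Ioc 0 t, R τ ≠ ∞) :
    ∃ g : ℝ → ℝ≥0∞, Measurable g ∧ g ≤ R ∧
      ∀ s, 0 ≤ s → s ≤ t → ∫⁻ τ in Ioc s t, R τ ≤ ∫⁻ τ in Ioc s t, g τ := by
  obtain ⟨g, hg, hgR, heq⟩ := exists_measurable_le_lintegral_eq (μ := volume.restrict (Ioc 0 t)) R
  refine ⟨g, hg, hgR, fun s hs hst => ?_⟩
  have hsplit : ∀ f : ℝ → ℝ≥0∞, ∫⁻ τ in Ioc 0 t, f τ
      = (∫⁻ τ in Ioc 0 s, f τ) + ∫⁻ τ in Ioc s t, f τ := fun f => by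
    rw [← lintegral_union measurableSet_Ioc (Ioc_disjoint_Ioc_of_le le_rfl),
      Ioc_union_Ioc_eq_Ioc hs hst]
  have hfin : ∫⁻ τ in Ioc 0 s, R τ ≠ ∞ :=
    ne_top_of_le_ne_top hR (lintegral_mono_set (Ioc_subset_Ioc_right hst))
  rw [hsplit R, hsplit g] at heq
  refine (ENNReal.add_le_add_iff_left hfin).1 (heq.le.trans ?_)
  exact add_le_add_left (lintegral_mono hgR) _

/-- Gronwall's inequality in integral form for functions with values in `[0, ∞]`. The forcing `R`
need not be measurable, its integrals being lower integrals. As the dissipation inequality holds from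
every initial time `s`, it can be integrated against `a e^{as} ds`; no regularity of `y` in time is
needed. -/
theorem ENNReal.gronwall {a t : ℝ} (ha : 0 < a) (ht : 0 < t) {y R : ℝ → ℝ≥0∞}
    (hy : AEMeasurable y (volume.restrict (Ioc 0 t)))
    (h : ∀ s, 0 ≤ s → s < t →
      y t + ENNReal.ofReal a * ∫⁻ τ in Ioc s t, y τ ≤ y s + ∫⁻ τ in Ioc s t, R τ) :
    y t ≤ ENNReal.ofReal (Real.exp (-(a * t))) * y 0
      + ∫⁻ τ in Ioc 0 t, ENNReal.ofReal (Real.exp (-(a * (t - τ)))) * R τ := by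
  have hexp : ∀ b, ENNReal.ofReal (Real.exp b) ≠ 0 := fun b =>
    (ENNReal.ofReal_pos.2 (Real.exp_pos b)).ne'
  by_cases hy0 : y 0 = ∞
  · rw [hy0, ENNReal.mul_top (hexp _), top_add]
    exact le_top
  by_cases hJ : ∫⁻ τ in Ioc 0 t, ENNReal.ofReal (Real.exp (-(a * (t - τ)))) * R τ = ∞
  · rw [hJ, add_top]
    exact le_top
  have hshift : ∀ τ, ENNReal.ofReal (Real.exp (a * t)) *
      (ENNReal.ofReal (Real.exp (-(a * (t - τ)))) * R τ)
      = ENNReal.ofReal (Real.exp (a * τ)) * R τ := fun τ => by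
    rw [← mul_assoc, ← ENNReal.ofReal_mul (Real.exp_pos _).le, ← Real.exp_add]
    congr 3
    ring
  have hJ' : ∫⁻ τ in Ioc 0 t, ENNReal.ofReal (Real.exp (a * τ)) * R τ ≠ ∞ := by
    simp_rw [← hshift]
    rw [lintegral_const_mul' _ _ ENNReal.ofReal_ne_top]
    exact ENNReal.mul_ne_top ENNReal.ofReal_ne_top hJ
  have hR : ∫⁻ τ in Ioc 0 t, R τ ≠ ∞ := by
    refine ne_top_of_le_ne_top hJ' (setLIntegral_mono' measurableSet_Ioc fun τ hτ => ?_)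
    refine le_mul_of_one_le_left' ?_
    rw [ENNReal.one_le_ofReal]
    exact Real.one_le_exp (mul_nonneg ha.le hτ.1.le)
  obtain ⟨g, hg, hgR, hgi⟩ := exists_measurable_le_setLIntegral_Ioc_le hR
  set z := hy.mk y with hz
  have hzm : Measurable z := hy.measurable_mk
  have hyz : ∀ s, 0 ≤ s → ∫⁻ τ in Ioc s t, y τ = ∫⁻ τ in Ioc s t, z τ := fun s hs =>
    lintegral_congr_ae (ae_restrict_of_ae_restrict_of_subset (Ioc_subset_Ioc_left hs) hy.ae_eq_mk)
  have h' : ∀ s, 0 ≤ s → s ≤ t →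
      y t + ENNReal.ofReal a * ∫⁻ τ in Ioc s t, z τ ≤ y s + ∫⁻ τ in Ioc s t, g τ := by
    intro s hs hst
    rcases hst.eq_or_lt with rfl | hst
    · simp
    · rw [← hyz s hs]
      exact (h s hs hst).trans (add_le_add_right (hgi s hs hst.le) _)
  set w : ℝ → ℝ≥0∞ := fun s => ENNReal.ofReal (a * Real.exp (a * s)) with hw
  have hwm : Measurable w := by fun_prop
  -- the inequality for `s`, integrated against `a e^{as} ds`
  have h1 : ENNReal.ofReal (Real.exp (a * t) - 1) * y t + ENNReal.ofReal a *
      (∫⁻ s in Ioc 0 t, w s * ∫⁻ τ in Ioc s t, z τ) ≤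
      (∫⁻ s in Ioc 0 t, w s * z s) + ∫⁻ s in Ioc 0 t, w s * ∫⁻ τ in Ioc s t, g τ := by
    rw [← lintegral_Ioc_ofReal_exp a ha ht.le, ← lintegral_mul_const _ hwm,
      ← lintegral_const_mul' _ _ ENNReal.ofReal_ne_top,
      ← lintegral_add_left (hwm.mul_const _), ← lintegral_add_left (f := fun s => w s * z s) (hwm.mul hzm)]
    refine lintegral_mono_ae ?_
    filter_upwards [ae_restrict_mem measurableSet_Ioc, hy.ae_eq_mk] with s hs hys
    have h2 := mul_le_mul_right (h' s hs.1.le hs.2) (w s)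
    rw [hys, mul_add, mul_add, mul_left_comm] at h2
    exact h2
  have hz0 : ∫⁻ τ in Ioc 0 t, z τ ≠ ∞ := by
    have h2 : ENNReal.ofReal a * ∫⁻ τ in Ioc 0 t, z τ ≠ ∞ := by
      refine ne_top_of_le_ne_top (ENNReal.add_ne_top.2 ⟨hy0, ?_⟩) (le_add_self.trans
        (h' 0 le_rfl ht.le))
      exact ne_top_of_le_ne_top hR (lintegral_mono hgR)
    exact fun h3 => h2 (by rw [h3, ENNReal.mul_top (ENNReal.ofReal_pos.2 ha).ne'])
  have hwz : ∫⁻ s in Ioc 0 t, w s * z s ≠ ∞ := by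
    refine ne_top_of_le_ne_top (b := ENNReal.ofReal (a * Real.exp (a * t)) *
      ∫⁻ τ in Ioc 0 t, z τ) (ENNReal.mul_ne_top ENNReal.ofReal_ne_top hz0) ?_
    rw [← lintegral_const_mul' _ _ ENNReal.ofReal_ne_top]
    refine setLIntegral_mono' measurableSet_Ioc fun s hs => ?_
    refine mul_le_mul_left (ENNReal.ofReal_le_ofReal ?_) _
    have := hs.2
    gcongr
  have hawz : ENNReal.ofReal a * (∫⁻ s in Ioc 0 t, w s * ∫⁻ τ in Ioc s t, z τ)
      + ENNReal.ofReal a * ∫⁻ τ in Ioc 0 t, z τ = ∫⁻ s in Ioc 0 t, w s * z s := by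
    rw [← mul_add, lintegral_exp_mul_lintegral_Ioc ha hzm,
      ← lintegral_const_mul' _ _ ENNReal.ofReal_ne_top]
    refine lintegral_congr fun s => ?_
    rw [← mul_assoc, ← ENNReal.ofReal_mul ha.le]
  -- adding the inequality for `s = 0`, the integrals of `y` on both sides cancel
  have h2 : ENNReal.ofReal (Real.exp (a * t)) * y t ≤
      y 0 + ∫⁻ τ in Ioc 0 t, ENNReal.ofReal (Real.exp (a * τ)) * g τ := by
    have h3 := add_le_add h1 (h' 0 le_rfl ht.le)
    have h4 : ENNReal.ofReal (Real.exp (a * t)) * y t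
        = ENNReal.ofReal (Real.exp (a * t) - 1) * y t + y t := by
      nth_rw 3 [← one_mul (y t)]
      rw [← add_mul, ← ENNReal.ofReal_one, ← ENNReal.ofReal_add _ zero_le_one, sub_add_cancel]
      rw [sub_nonneg]
      exact Real.one_le_exp (mul_nonneg ha.le ht.le)
    rw [add_add_add_comm, hawz, ← h4, add_add_add_comm, add_comm _ (y 0), add_assoc (y 0),
      add_comm (∫⁻ s in Ioc 0 t, w s * z s),
      lintegral_exp_mul_lintegral_Ioc ha hg, ← add_assoc] at h3
    exact (ENNReal.add_le_add_iff_right hwz).1 h3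
  have h5 := mul_le_mul_right h2 (ENNReal.ofReal (Real.exp (-(a * t))))
  rw [← mul_assoc, ← ENNReal.ofReal_mul (Real.exp_pos _).le, ← Real.exp_add, neg_add_cancel,
    Real.exp_zero, ENNReal.ofReal_one, one_mul, mul_add,
    ← lintegral_const_mul' _ _ ENNReal.ofReal_ne_top] at h5
  refine h5.trans (add_le_add_right (lintegral_mono fun τ => ?_) _)
  rw [← mul_assoc, ← ENNReal.ofReal_mul (Real.exp_pos _).le, ← Real.exp_add]
  refine (mul_le_mul_right (hgR τ) _).trans_eq ?_
  congr 3
  ring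

end Gronwall

/-! ### Convergence of the regularized Stein variational gradient flow -/

section Convergence

theorem MeasureTheory.Lp.enorm_sq_eq_lintegral {α E : Type*} [MeasurableSpace α] {P : Measure α}
    [NormedAddCommGroup E] (f : Lp E 2 P) : ‖f‖ₑ ^ 2 = ∫⁻ x, ‖f x‖ₑ ^ 2 ∂P := by
  have h := eLpNorm_nnreal_pow_eq_lintegral (f := f) (μ := P) (p := 2) two_ne_zero
  rw [Lp.enorm_def]
  simpa using h

variable {d : ℕ} {H : Type*} [NormedAddCommGroup H] [InnerProductSpace ℝ H]
    [CompleteSpace H] [RKHS ℝ H (EuclideanSpace ℝ (Fin d)) ℝ]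

theorem IsDensityCurve.continuous_deriv {ρ : ℝ → EuclideanSpace ℝ (Fin d) → ℝ}
    (hρ : IsDensityCurve ρ) {t : ℝ} (ht : 0 < t) :
    Continuous fun x => deriv (fun s => ρ s x) t :=
  hρ.continuousOn_deriv.comp_continuous (f := fun x : EuclideanSpace ℝ (Fin d) => (t, x))
    (by fun_prop) fun x => ⟨ht, mem_univ _⟩

/-- The regularized Stein variational gradient flow is the Wasserstein gradient flow, forced by
the part of the relative score that the regularized operator misses. -/
theorem IsRSVGF.exists_isForcedFlowPair {ν : ℝ} {π : EuclideanSpace ℝ (Fin d) → ℝ}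
    (hπ : IsDensity π) {ρ μ : ℝ → EuclideanSpace ℝ (Fin d) → ℝ} (hρ : IsRSVGF H ν π ρ)
    (hμ : IsWGF π μ) :
    ∃ u, IsForcedFlowPair π μ ρ u ∧ ∀ t, 0 < t →
      ∃ v : Lp (EuclideanSpace ℝ (Fin d)) 2 (densMeasure (ρ t)),
        ⇑v =ᵐ[densMeasure (ρ t)] relScore (ρ t) π ∧
        ∫⁻ x, ‖u t x‖ₑ ^ 2 ∂(densMeasure (ρ t))
          = ‖v - regularizedOp H ν (densMeasure (ρ t)) v‖ₑ ^ 2 := by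
  choose! v hv hpde using hρ.pde
  have hu : ∀ t, 0 < t → (fun x => relScore (ρ t) π x
      - regularizedOp H ν (densMeasure (ρ t)) (v t) x) =ᵐ[densMeasure (ρ t)]
      ⇑(v t - regularizedOp H ν (densMeasure (ρ t)) (v t)) := fun t ht => by
    filter_upwards [hv t ht, Lp.coeFn_sub (v t) (regularizedOp H ν (densMeasure (ρ t)) (v t))]
      with x h1 h2
    rw [h2, Pi.sub_apply, h1]
  refine ⟨fun t x => relScore (ρ t) π x - regularizedOp H ν (densMeasure (ρ t)) (v t) x,
    ⟨hμ.curve, hρ.curve, fun t ht => ?_⟩, fun t ht => ⟨v t, hv t ht, ?_⟩⟩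
  · refine ⟨hπ, hμ.curve.isDensity t ht.le, hρ.curve.isDensity t ht.le,
      hμ.curve.continuous_deriv ht, hρ.curve.continuous_deriv ht, hμ.pde t ht, ?_,
      (memLp_congr_ae (hu t ht)).2 (Lp.memLp _)⟩
    simp only [sub_sub_cancel]
    exact hpde t ht
  · rw [Lp.enorm_sq_eq_lintegral]
    exact lintegral_congr_ae ((hu t ht).mono fun x hx => by simp only [hx])

/-- The log-Sobolev inequality turns entropy dissipation into decay. -/
theorem SatisfiesLSI.mul_KL_le {μ : EuclideanSpace ℝ (Fin d) → ℝ} {lam : ℝ} (hlam : 0 < lam)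
    (h : SatisfiesLSI μ lam) {ρ : EuclideanSpace ℝ (Fin d) → ℝ} (hρ : IsDensity ρ) :
    ENNReal.ofReal (3 * lam / 2) * KL ρ μ ≤ ENNReal.ofReal (3 / 4) * fisherInfo ρ μ := by
  refine (mul_le_mul_right (h ρ hρ) _).trans_eq ?_
  rw [← mul_assoc, ← ENNReal.ofReal_mul (by positivity)]
  congr 2
  field_simp
  norm_num

end Convergence

theorem mainTheorem7 {d : ℕ} {H : Type*} [NormedAddCommGroup H] [InnerProductSpace ℝ H]
    [CompleteSpace H] [RKHS ℝ H (EuclideanSpace ℝ (Fin d)) ℝ]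
    (hk : Continuous fun p : EuclideanSpace ℝ (Fin d) × EuclideanSpace ℝ (Fin d) =>
      rkernel H p.1 p.2)
    {ν : ℝ} (hν : ν ∈ Set.Ioc (0 : ℝ) 1) {lam : ℝ} (hlam : 0 < lam)
    {π : EuclideanSpace ℝ (Fin d) → ℝ} (hπ : IsDensity π) (hπLSI : SatisfiesLSI π lam)
    {ρ : ℝ → EuclideanSpace ℝ (Fin d) → ℝ} (hρ : IsRSVGF H ν π ρ)
    {μ : ℝ → EuclideanSpace ℝ (Fin d) → ℝ} (hμ : IsWGF π μ)
    (hμLSI : ∀ t, 0 < t → SatisfiesLSI (μ t) lam)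
    {γ : ℝ → ℝ} (hγ : ∀ t, 0 < t →
      γ t ∈ Set.Ioc (0 : ℝ) (1 / 2) ∧ preimageNorm H (ρ t) π (γ t) < ∞)
    {T : ℝ} (hT : 0 < T) :
    KL (ρ T) (μ T) ≤
      ENNReal.ofReal (Real.exp (-(3 * lam * T / 2))) * KL (ρ 0) (μ 0) +
        ∫⁻ t in Set.Ioc 0 T,
          ENNReal.ofReal ((max (largestEigenvalue (kernelOp H (densMeasure (ρ t)))) 1) ^ 2) *
            ENNReal.ofReal ν ^ (2 * γ t) * ENNReal.ofReal (1 - ν) ^ (-(2 * γ t)) *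
            ENNReal.ofReal (Real.exp (-(3 * lam * (T - t) / 2))) *
            preimageNorm H (ρ t) π (γ t) ^ 2 := by
  obtain ⟨u, hu, hv⟩ := hρ.exists_isForcedFlowPair hπ hμ
  have ha : 0 < 3 * lam / 2 := by positivity
  have h1 := ENNReal.gronwall (y := fun t => KL (ρ t) (μ t))
    (R := fun t => ∫⁻ x, ‖u t x‖ₑ ^ 2 ∂(densMeasure (ρ t))) ha hT
    (hρ.curve.aemeasurable_KL hμ.curve le_rfl) fun s hs hsT => by
      refine le_trans (add_le_add_right ?_ _) (hu.entropy_dissipation hπ hs hsT)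
      rw [← lintegral_const_mul' _ _ ENNReal.ofReal_ne_top,
        ← lintegral_const_mul' _ _ ENNReal.ofReal_ne_top]
      exact setLIntegral_mono' measurableSet_Ioc fun t ht =>
        (hμLSI t (hs.trans_lt ht.1)).mul_KL_le hlam (hρ.curve.isDensity t (hs.trans ht.1.le))
  have h2 : ∀ t, 3 * lam / 2 * t = 3 * lam * t / 2 := fun t => by ring
  simp only [h2] at h1
  refine h1.trans (add_le_add_right (setLIntegral_mono' measurableSet_Ioc fun t ht => ?_) _)
  obtain ⟨v, hv, hve⟩ := hv t ht.1
  rw [hve, mul_right_comm _ (ENNReal.ofReal (Real.exp _)), mul_comm]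
  exact mul_le_mul_left (enorm_sub_regularizedOp_sq_le hν (hγ t ht.1).1 hv) _
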